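/- **Setting.** Let $G$ be a (second countable, Hausdorff, finite-dimensional) locally compact Lie group with Haar measure $\mu$, let $n\in\mathbb N$ and let $\mathcal H=L^2(G^{n},\mu^{n})$ be the one-particle space of group fields, with inner product $(\cdot,\cdot)$ antilinear in the first argument. Let $W(f)$, $f\in\mathcal H$, be the Weyl elements, $W(f)^*=W(-f)$, $W(f)W(g)=e^{-\frac i2\mathrm{Im}(f,g)}W(f+g)$, and let $(\mathcal F,\pi_F,\Omega)$ be the GNS triple of the Fock state $\omega_F(W(f))=e^{-(f,f)/4}$ (the bosonic Fock space over $\mathcal H$). Write $W(tf)=e^{it\Phi(f)}$, $\Psi(f)=\frac1{\sqrt2}(\Phi(f)+i\Phi(if))$, $\Psi^\dagger(f)=\frac1{\sqrt2}(\Phi(f)-i\Phi(if))$, and $|f,k\rangle=\frac1{\sqrt{k!}}\Psi^\dagger(f)^k\Omega$. The doubled Weyl $C^*$-algebra $\mathsf W=\mathcal W\otimes\mathcal W'$ is the $C^*$-algebra generated on the Hilbert tensor product $\mathcal F\otimes\mathcal F$ by $W(f,g)=W(f)\otimes W(g)$, $f,g\in\mathcal H$; operators of the second factor carry a tilde. Let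 $\psi,\psi'\in\mathcal H$ be unit vectors and $b\in\mathbb C$, with $b=|b|e^{i\vartheta}$ (and $\vartheta=0$ if $b=0$). Then there is a unique strongly continuous one-parameter unitary group $U(t)=\exp\{t(b\,\Psi^\dagger(\psi)\tilde\Psi^\dagger(\psi')-\bar b\,\tilde\Psi(\psi')\Psi(\psi))\}$ on $\mathcal F\otimes\mathcal F$ with the displayed generator on finite-particle vectors. The squeezed vacuum is $|\Omega_S\rangle=U(1)(\Omega\otimes\Omega)$. For $X$ in the Lie algebra of $G^{n}$ let $U_*=U_*(X)$ be the infinitesimal generator, $e^{tU_*}=\Gamma(L^*_{e^{tX}})$, of the second-quantized left translations $(L^*_a\phi)(g)=\phi(a^{-1}g)$ on $\mathcal F$. It is anti-Hermitian, and the formal Gibbs states of the translation flow are $\propto e^{-i\beta U_*}$. **Theorem.** 1. (Bogoliubov transformation.) There is a symplectic automorphism $T$ of $\mathcal H\oplus\mathcal H$ (a real-linear homeomorphism preserving $\mathrm{Im}[(f_1,f_2)+(g_1,g_2)]$), namely $$T(f,g)=\bigl(f+[(\cosh|b|-1)(\psi,f)-e^{i\vartheta}\sinh|b|\,\overline{(\psi',g)}]\psi,\;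 g+[(\cosh|b|-1)(\psi',g)-e^{i\vartheta}\sinh|b|\,\overline{(\psi,f)}]\psi'\bigr),$$ and a $*$-automorphism $\alpha_T$ of $\mathsf W$ with $\alpha_T(W(f,g))=W(T(f,g))$, implemented by $U(1)$: $\alpha_T(a)=U(1)\,a\,U(1)^*$ for all $a\in\mathsf W$. On finite-particle vectors $v$ one has $U(1)\Psi(\psi)v=\bigl(\cosh|b|\,\Psi(\psi)-e^{i\vartheta}\sinh|b|\,\tilde\Psi^\dagger(\psi')\bigr)U(1)v$. 2. (Thermofield double form.) Let $b\neq0$ and let $u_*\ne 0$ be an eigenvalue of $U_*(X)$ on $\mathcal F$, for some $X$. Then $\varepsilon=iu_*$ is real, and there is a unique $\beta\in\mathbb R$ with $\beta\varepsilon>0$ and $\cosh|b|=(1-e^{-\beta\varepsilon})^{-1/2}$; for this $\beta$ also $\sinh|b|=e^{-\beta\varepsilon/2}(1-e^{-\beta\varepsilon})^{-1/2}$. With $Z=\sum_{k\ge0}e^{-ik\beta u_*}=(1-e^{-i\beta u_*})^{-1}$, $$|\Omega_S\rangle=\frac1{\sqrt Z}\sum_{k=0}^\infty e^{-ik\beta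 u_*/2}\,|\psi,k\rangle\otimes|e^{i\vartheta}\psi',k\rangle ,$$ with norm-convergent sum. Moreover there is a unitary $V$ implementing (in the sense of 1) a symplectic automorphism of $\mathcal H\oplus\mathcal H$ such that $V|\Omega_S\rangle=\frac1{\sqrt Z}\sum_{k\ge0} e^{-ik\beta u_*/2}|\psi,k\rangle\otimes|\psi',k\rangle$. 3. (Gibbs/KMS state.) In the situation of 2, $\langle\Omega_S|(a\otimes1)|\Omega_S\rangle=\frac1Z\sum_{k}e^{-ik\beta u_*}\langle\psi,k|a|\psi,k\rangle$ for every bounded operator $a$ on $\mathcal F$, and $\langle\Omega_S|(W(z\psi)\otimes1)|\Omega_S\rangle=e^{-\frac14\coth(i\beta u_*/2)|z|^2}$ for $z\in\mathbb C$. If in addition $U_*|\psi,1\rangle=u_*|\psi,1\rangle$, then $U_*|\psi,k\rangle=k\,u_*|\psi,k\rangle$ for all $k$, and on the $C^*$-algebra generated by $\{W(z\psi):z\in\mathbb C\}$ the reduced state $a\mapsto\langle\Omega_S|(a\otimes1)|\Omega_S\rangle$ is a KMS state at $\beta$ for the translation flow $\alpha_t(a)=e^{it\mathcal G}ae^{-it\mathcal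 G}$, $\mathcal G=iU_*$, under which this algebra is invariant. -/

import Mathlib

open scoped InnerProductSpace ComplexConjugate Manifold ContDiff TensorProduct

noncomputable section

/-! ### The Weyl relations, the Fock state and its GNS space

`H` is the one-particle Hilbert space.  The Weyl *-algebra over `H` is the vector space with basis
`W(f)`, `f : H`, with `W(f)* = W(-f)` and `W(f) W(g) = exp(-(i/2) Im ⟪f, g⟫) W(f + g)`. -/

section Fock

variable {H : Type*} [NormedAddCommGroup H] [InnerProductSpace ℂ H]

/-- The phase in `W(f) W(g) = weylPhase f g • W(f + g)`. -/
def weylPhase (f g : H) : ℂ := Complex.exp (-(Complex.I / 2) * ((⟪f, g⟫_ℂ).im : ℂ))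

/-- The Fock state `ω_F(W(f)) = exp(-(f, f) / 4)`. -/
def fockState (f : H) : ℂ := Complex.exp (-((‖f‖ ^ 2 / 4 : ℝ) : ℂ))

/-- `ω_F(W(f)* W(g))`. -/
def fockKernel (f g : H) : ℂ := weylPhase (-f) g * fockState (g - f)

lemma fockKernel_eq (f g : H) :
    fockKernel f g = fockState f * fockState g * Complex.exp ((1 / 2 : ℂ) * ⟪f, g⟫_ℂ) := by
  have h : ‖g - f‖ ^ 2 = ‖g‖ ^ 2 - 2 * (⟪f, g⟫_ℂ).re + ‖f‖ ^ 2 := by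
    have := norm_sub_sq (𝕜 := ℂ) f g
    rw [norm_sub_rev, this]
    simp only [RCLike.re_to_complex]
    ring
  have h2 : ⟪f, g⟫_ℂ = ((⟪f, g⟫_ℂ).re : ℂ) + ((⟪f, g⟫_ℂ).im : ℂ) * Complex.I :=
    (Complex.re_add_im _).symm
  unfold fockKernel weylPhase fockState
  rw [← Complex.exp_add, ← Complex.exp_add, ← Complex.exp_add]
  congr 1
  rw [h, inner_neg_left]
  conv_rhs => rw [h2]
  push_cast [Complex.neg_im]
  ring

lemma fockKernel_conj (f g : H) : conj (fockKernel f g) = fockKernel g f := by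
  simp only [fockKernel_eq, fockState, map_mul, ← Complex.exp_conj, map_neg, Complex.conj_ofReal,
    inner_conj_symm, map_div₀, map_one, map_ofNat]
  ring

variable (H) in
/-- The vector space of the Weyl *-algebra over `H`: formal linear combinations of the `W(f)`. -/
abbrev WeylSpan : Type _ := H →₀ ℂ

/-- The GNS form `(a, b) ↦ ω_F(a* b)` of the Fock state. -/
def gnsForm (a b : WeylSpan H) : ℂ := a.sum fun f x => b.sum fun g y => conj x * y * fockKernel f g

open scoped ComplexOrder in
lemma gram_pow_nonneg (s : Finset H) (k : ℕ) (x : H → ℂ) :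
    0 ≤ (∑ f ∈ s, ∑ g ∈ s, conj (x f) * x g * ⟪f, g⟫_ℂ ^ k).re := by
  classical
  have key : ∀ k : ℕ, (Matrix.of fun f g : s => ⟪(f : H), (g : H)⟫_ℂ ^ k).PosSemidef := by
    intro k
    induction k with
    | zero =>
      have e : (Matrix.of fun f g : s => ⟪(f : H), (g : H)⟫_ℂ ^ 0) =
          Matrix.gram ℂ (fun _ : s => (1 : ℂ)) := by
        ext f g
        simp [Matrix.gram_apply]
      rw [e]
      exact Matrix.posSemidef_gram ℂ _
    | succ k ih =>
      have e : (Matrix.of fun f g : s => ⟪(f : H), (g : H)⟫_ℂ ^ (k + 1)) =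
          (Matrix.of fun f g : s => ⟪(f : H), (g : H)⟫_ℂ ^ k).hadamard
            (Matrix.gram ℂ (fun f : s => (f : H))) := by
        ext f g
        simp [Matrix.gram_apply, pow_succ]
      rw [e]
      exact ih.hadamard (Matrix.posSemidef_gram ℂ _)
  have h := (key k).dotProduct_mulVec_nonneg (fun f : s => x f)
  have h' := (Complex.le_def.1 h).1
  rw [Complex.zero_re] at h'
  convert h' using 2
  simp only [dotProduct, Matrix.mulVec, Matrix.of_apply, Pi.star_apply, RCLike.star_def]
  rw [← Finset.sum_coe_sort s]
  refine Finset.sum_congr rfl fun f _ => ?_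
  rw [← Finset.sum_coe_sort s, Finset.mul_sum]
  refine Finset.sum_congr rfl fun g _ => ?_
  ring

lemma gnsForm_self_re_nonneg (a : WeylSpan H) : 0 ≤ (gnsForm a a).re := by
  have h1 : HasSum (fun k : ℕ => ∑ f ∈ a.support, ∑ g ∈ a.support,
      conj (a f * fockState f) * (a g * fockState g) *
        (((1 / 2 : ℂ) * ⟪f, g⟫_ℂ) ^ k / (k.factorial : ℂ))) (gnsForm a a) := by
    have : gnsForm a a = ∑ f ∈ a.support, ∑ g ∈ a.support,
        conj (a f * fockState f) * (a g * fockState g) * Complex.exp ((1 / 2 : ℂ) * ⟪f, g⟫_ℂ) := by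
      refine Finset.sum_congr rfl fun f _ => Finset.sum_congr rfl fun g _ => ?_
      have hc : conj (fockState f) = fockState f := by
        simp only [fockState, ← Complex.exp_conj, map_neg, Complex.conj_ofReal]
      simp only [fockKernel_eq, map_mul, hc]
      ring
    rw [this]
    refine hasSum_sum fun f _ => hasSum_sum fun g _ => HasSum.mul_left _ ?_
    rw [Complex.exp_eq_exp_ℂ]
    exact NormedSpace.expSeries_div_hasSum_exp _
  refine (Complex.hasSum_re h1).nonneg fun k => ?_
  have h2 := gram_pow_nonneg a.support k (fun f => a f * fockState f)
  have h3 : (∑ f ∈ a.support, ∑ g ∈ a.support, conj (a f * fockState f) * (a g * fockState g) *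
        (((1 / 2 : ℂ) * ⟪f, g⟫_ℂ) ^ k / (k.factorial : ℂ))) =
      (((1 / 2 : ℝ) ^ k / (k.factorial : ℝ) : ℝ) : ℂ) * ∑ f ∈ a.support, ∑ g ∈ a.support,
        conj (a f * fockState f) * (a g * fockState g) * ⟪f, g⟫_ℂ ^ k := by
    rw [Finset.mul_sum]
    refine Finset.sum_congr rfl fun f _ => ?_
    rw [Finset.mul_sum]
    refine Finset.sum_congr rfl fun g _ => ?_
    push_cast
    rw [mul_pow]
    ring
  rw [h3, Complex.re_ofReal_mul]
  exact mul_nonneg (by positivity) h2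

instance gnsCore : PreInnerProductSpace.Core ℂ (WeylSpan H) where
  inner a b := gnsForm a b
  conj_inner_symm a b := by
    change conj (gnsForm b a) = gnsForm a b
    unfold gnsForm
    rw [Finsupp.sum_comm]
    simp only [map_finsuppSum, map_mul, fockKernel_conj, Complex.conj_conj]
    congr! 5
    exact funext fun y => by ring
  re_inner_nonneg a := gnsForm_self_re_nonneg a
  add_left a b c := by
    change gnsForm (a + b) c = gnsForm a c + gnsForm b c
    unfold gnsForm
    rw [Finsupp.sum_add_index'] <;> simp [← Finsupp.sum_add, add_mul]
  smul_left a b r := by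
    change gnsForm (r • a) b = conj r * gnsForm a b
    unfold gnsForm
    rw [Finsupp.sum_smul_index] <;> simp [Finsupp.mul_sum, ← mul_assoc]

instance : SeminormedAddCommGroup (WeylSpan H) :=
  InnerProductSpace.Core.toSeminormedAddCommGroup (𝕜 := ℂ)

instance : InnerProductSpace ℂ (WeylSpan H) := InnerProductSpace.ofCore gnsCore

variable (H) in
/-- The bosonic Fock space over `H`: the GNS Hilbert space of the Fock state. -/
abbrev Fock : Type _ := UniformSpace.Completion (WeylSpan H)

/-- The linear map of the Weyl *-algebra with `W(f) ↦ c f • W(s f)`. -/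
def monomialMap {H : Type*} (s : H → H) (c : H → ℂ) : WeylSpan H →ₗ[ℂ] WeylSpan H :=
  Finsupp.lsum ℂ fun f => (c f) • (Finsupp.lsingle (s f) : ℂ →ₗ[ℂ] WeylSpan H)

lemma inner_single (f g : H) (x y : ℂ) :
    ⟪(Finsupp.single f x : WeylSpan H), (Finsupp.single g y : WeylSpan H)⟫_ℂ =
      conj x * y * fockKernel f g := by
  change gnsForm _ _ = _
  simp [gnsForm]

lemma monomialMap_single {H : Type*} (s : H → H) (c : H → ℂ) (f : H) (x : ℂ) :
    monomialMap s c (Finsupp.single f x) = Finsupp.single (s f) (c f * x) := by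
  simp [monomialMap]

lemma inner_monomialMap (s : H → H) (c : H → ℂ)
    (h : ∀ f g, conj (c f) * c g * fockKernel (s f) (s g) = fockKernel f g) (a b : WeylSpan H) :
    ⟪monomialMap s c a, monomialMap s c b⟫_ℂ = ⟪a, b⟫_ℂ := by
  induction a using Finsupp.induction_linear with
  | zero => simp
  | add a₁ a₂ h₁ h₂ => rw [map_add, inner_add_left, inner_add_left, h₁, h₂]
  | single f x =>
    induction b using Finsupp.induction_linear with
    | zero => simp
    | add b₁ b₂ h₁ h₂ => rw [map_add, inner_add_right, inner_add_right, h₁, h₂]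
    | single g y =>
      rw [monomialMap_single, monomialMap_single, inner_single, inner_single, ← h f g, map_mul]
      ring

/-- A kernel-preserving monomial map, extended to the Fock space. -/
def monomialOp (s : H → H) (c : H → ℂ)
    (h : ∀ f g, conj (c f) * c g * fockKernel (s f) (s g) = fockKernel f g) :
    Fock H →L[ℂ] Fock H :=
  ((monomialMap s c).isometryOfInner (inner_monomialMap s c h)).toContinuousLinearMap.completion

lemma monomialOp_coe_single (s : H → H) (c : H → ℂ)
    (h : ∀ f g, conj (c f) * c g * fockKernel (s f) (s g) = fockKernel f g) (f : H) (x : ℂ) :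
    monomialOp s c h ((Finsupp.single f x : WeylSpan H) : Fock H) =
      ((Finsupp.single (s f) (c f * x) : WeylSpan H) : Fock H) := by
  rw [← monomialMap_single]
  exact ContinuousLinearMap.completion_apply_coe _ _

/-- The vectors `W(f) Ω` are total. -/
lemma fock_ext {A B : Fock H →L[ℂ] Fock H}
    (h : ∀ f : H, A ((Finsupp.single f 1 : WeylSpan H) : Fock H) =
      B ((Finsupp.single f 1 : WeylSpan H) : Fock H)) : A = B := by
  ext v
  induction v using UniformSpace.Completion.induction_on with
  | hp => exact isClosed_eq A.continuous B.continuous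
  | ih a =>
    induction a using Finsupp.induction_linear with
    | zero => rw [UniformSpace.Completion.coe_zero, map_zero, map_zero]
    | add a₁ a₂ h₁ h₂ => rw [UniformSpace.Completion.coe_add, map_add, map_add, h₁, h₂]
    | single f x =>
      have : (Finsupp.single f x : WeylSpan H) = x • Finsupp.single f 1 := by simp
      rw [this, UniformSpace.Completion.coe_smul, map_smul, map_smul, h f]

lemma weyl_kernel (k f g : H) :
    conj (weylPhase k f) * weylPhase k g * fockKernel (k + f) (k + g) = fockKernel f g := by
  have hk : (⟪k, k⟫_ℂ).im = 0 := inner_self_im (𝕜 := ℂ) k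
  have hf : (⟪f, k⟫_ℂ).im = -(⟪k, f⟫_ℂ).im := by
    rw [← inner_conj_symm, Complex.conj_im]
  unfold fockKernel weylPhase
  rw [add_sub_add_left_eq_sub, ← Complex.exp_conj, ← mul_assoc, ← Complex.exp_add,
    ← Complex.exp_add]
  congr 2
  simp only [map_mul, map_neg, map_div₀, Complex.conj_I, map_ofNat, Complex.conj_ofReal,
    inner_neg_left, inner_add_left, inner_add_right, Complex.neg_im, Complex.add_im, hk, hf]
  push_cast
  ring

/-- The Weyl operator `π_F(W(k))`: left multiplication by `W(k)` in the GNS space. -/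
def weyl (k : H) : Fock H →L[ℂ] Fock H := monomialOp (k + ·) (weylPhase k) (weyl_kernel k)

lemma weyl_coe_single (k f : H) (x : ℂ) :
    weyl k ((Finsupp.single f x : WeylSpan H) : Fock H) =
      ((Finsupp.single (k + f) (weylPhase k f * x) : WeylSpan H) : Fock H) :=
  monomialOp_coe_single _ _ _ _ _

lemma secondQuant_kernel (V : H →ₗᵢ[ℂ] H) (f g : H) :
    conj (1 : ℂ) * 1 * fockKernel (V f) (V g) = fockKernel f g := by
  simp [fockKernel_eq, fockState]

/-- The second quantization `Γ(V)` of an isometry: `Γ(V) W(f) Ω = W(V f) Ω`. -/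
def secondQuant (V : H →ₗᵢ[ℂ] H) : Fock H →L[ℂ] Fock H :=
  monomialOp V (fun _ => 1) (secondQuant_kernel V)

variable (H) in
/-- The Fock vacuum `Ω`: the GNS vector, i.e. the class of `W(0) = 1`. -/
def vacuum : Fock H := ((Finsupp.single 0 1 : WeylSpan H) : Fock H)

lemma inner_vacuum_weyl (f : H) : ⟪vacuum H, weyl f (vacuum H)⟫_ℂ = fockState f := by
  rw [vacuum, weyl_coe_single, UniformSpace.Completion.inner_coe, inner_single]
  simp [fockKernel, weylPhase]

lemma secondQuant_weyl_vacuum (V : H →ₗᵢ[ℂ] H) (f : H) :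
    secondQuant V (weyl f (vacuum H)) = weyl (V f) (vacuum H) := by
  rw [vacuum, weyl_coe_single, weyl_coe_single]
  refine (monomialOp_coe_single _ _ _ _ _).trans ?_
  simp [weylPhase]

lemma weyl_mul (f g : H) : weyl f * weyl g = weylPhase f g • weyl (f + g) := by
  refine fock_ext fun k => ?_
  have hp : weylPhase g k * weylPhase f (g + k) = weylPhase f g * weylPhase (f + g) k := by
    unfold weylPhase
    rw [← Complex.exp_add, ← Complex.exp_add]
    congr 1
    rw [inner_add_left, inner_add_right]
    push_cast [Complex.add_im]
    ring
  change weyl f (weyl g _) = weylPhase f g • weyl (f + g) _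
  rw [weyl_coe_single, weyl_coe_single, weyl_coe_single]
  rw [← UniformSpace.Completion.coe_smul, Finsupp.smul_single, add_assoc]
  congr 2
  rw [mul_one, mul_one, smul_eq_mul, mul_comm, hp]


end Fock

/-! ### Field operators

For a regular family `W` of Weyl operators on a Hilbert space `K`, indexed by a complex vector
space `E` of test functions, the fields are the Stone generators: `W(t f) = exp(i t Φ(f))`.
They are only applied to vectors along which `t ↦ W(t f)` is differentiable. -/

section Fields

variable {E K : Type*} [AddCommGroup E] [Module ℂ E] [NormedAddCommGroup K]
  [InnerProductSpace ℂ K]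

/-- `Φ(f) v = -i d/dt W(t f) v` at `t = 0`. -/
def segalField (W : E → K →L[ℂ] K) (f : E) (v : K) : K :=
  -Complex.I • deriv (fun t : ℝ => W ((t : ℂ) • f) v) 0

/-- The annihilation operator `Ψ(f) = (Φ(f) + i Φ(i f)) / √2`, antilinear in `f`. -/
def annihilation (W : E → K →L[ℂ] K) (f : E) (v : K) : K :=
  ((1 / √2 : ℝ) : ℂ) • (segalField W f v + Complex.I • segalField W (Complex.I • f) v)

/-- The creation operator `Ψ†(f) = (Φ(f) - i Φ(i f)) / √2`, linear in `f`. -/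
def creation (W : E → K →L[ℂ] K) (f : E) (v : K) : K :=
  ((1 / √2 : ℝ) : ℂ) • (segalField W f v - Complex.I • segalField W (Complex.I • f) v)

/-- `u` is an eigenvalue, with eigenvector `v`, of the infinitesimal generator of `V`. -/
def IsGeneratorEigenvector (V : ℝ → K →L[ℂ] K) (u : ℂ) (v : K) : Prop :=
  v ≠ 0 ∧ HasDerivAt (fun t : ℝ => V t v) (u • v) 0

/-- `φ` is a KMS state at `β` on the operator algebra `A`, for the flow `α`: for `a, b ∈ A` there
is a bounded continuous function `F` on the closed strip between `Im z = 0` and `Im z = β`,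
analytic inside, with `F(t) = φ(a α_t(b))` and `F(t + iβ) = φ(α_t(b) a)`. -/
structure IsKMSState [CompleteSpace K] (A : StarSubalgebra ℂ (K →L[ℂ] K)) (φ : (K →L[ℂ] K) → ℂ)
    (α : ℝ → (K →L[ℂ] K) → (K →L[ℂ] K)) (β : ℝ) : Prop where
  invariant : ∀ t, ∀ a ∈ A, α t a ∈ A
  kms : ∀ a ∈ A, ∀ b ∈ A, ∃ F : ℂ → ℂ,
    ContinuousOn F {z | z.im ∈ Set.Icc (min 0 β) (max 0 β)} ∧
    DifferentiableOn ℂ F {z | z.im ∈ Set.Ioo (min 0 β) (max 0 β)} ∧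
    (∃ C : ℝ, ∀ z : ℂ, z.im ∈ Set.Icc (min 0 β) (max 0 β) → ‖F z‖ ≤ C) ∧
    ∀ t : ℝ, F t = φ (a * α t b) ∧ F (t + β * Complex.I) = φ (α t b * a)

end Fields

section Doubled

variable {H : Type*} [NormedAddCommGroup H] [InnerProductSpace ℂ H]

/-- The `n`-quanta Fock state `Ψ†(f)ⁿ Ω / √(n!)` of the mode `f`. -/
def numberState (f : H) (n : ℕ) : Fock H :=
  ((1 / √(n.factorial : ℝ) : ℝ) : ℂ) • (creation weyl f)^[n] (vacuum H)

/-- The C*-algebra generated by the Weyl operators `W(z f)`, `z ∈ ℂ`, of the single mode `f`. -/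
def modeAlgebra (f : H) : StarSubalgebra ℂ (Fock H →L[ℂ] Fock H) :=
  (StarAlgebra.adjoin ℂ (Set.range fun z : ℂ => weyl (z • f))).topologicalClosure

variable (H) in
/-- The doubled Fock space: the Hilbert tensor product of two copies of the Fock space. -/
def DFock : Type _ := UniformSpace.Completion (Fock H ⊗[ℂ] Fock H)

instance : NormedAddCommGroup (DFock H) :=
  inferInstanceAs (NormedAddCommGroup (UniformSpace.Completion (Fock H ⊗[ℂ] Fock H)))

instance : InnerProductSpace ℂ (DFock H) :=
  inferInstanceAs (InnerProductSpace ℂ (UniformSpace.Completion (Fock H ⊗[ℂ] Fock H)))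

instance : CompleteSpace (DFock H) :=
  inferInstanceAs (CompleteSpace (UniformSpace.Completion (Fock H ⊗[ℂ] Fock H)))

/-- The product vector `v ⊗ w`. -/
def prodVec (v w : Fock H) : DFock H := ((v ⊗ₜ[ℂ] w : Fock H ⊗[ℂ] Fock H) : UniformSpace.Completion (Fock H ⊗[ℂ] Fock H))

/-- The product operator `a ⊗ b`. -/
def prodOp (a b : Fock H →L[ℂ] Fock H) : DFock H →L[ℂ] DFock H :=
  (TensorProduct.mapL a b).completion

lemma inner_prodVec (v w v' w' : Fock H) :
    ⟪prodVec v w, prodVec v' w'⟫_ℂ = ⟪v, v'⟫_ℂ * ⟪w, w'⟫_ℂ :=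
  (UniformSpace.Completion.inner_coe _ _).trans (TensorProduct.inner_tmul ..)

lemma prodOp_prodVec (a b : Fock H →L[ℂ] Fock H) (v w : Fock H) :
    prodOp a b (prodVec v w) = prodVec (a v) (b w) :=
  ContinuousLinearMap.completion_apply_coe _ _

variable (H) in
/-- The doubled Fock vacuum `Ω ⊗ Ω`. -/
def dvacuum : DFock H := prodVec (vacuum H) (vacuum H)

/-- The Weyl operators `W(f) ⊗ W(g)` of the doubled system. -/
def dweyl (p : H × H) : DFock H →L[ℂ] DFock H := prodOp (weyl p.1) (weyl p.2)

variable (H) in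
/-- The doubled Weyl C*-algebra, in its (faithful) Fock representation: the C*-algebra generated
by all `W(f) ⊗ W(g)`. -/
def dweylAlgebra : StarSubalgebra ℂ (DFock H →L[ℂ] DFock H) :=
  (StarAlgebra.adjoin ℂ (Set.range (dweyl (H := H)))).topologicalClosure

lemma dweyl_mem (p : H × H) : dweyl p ∈ dweylAlgebra H :=
  StarSubalgebra.le_topologicalClosure _ (StarAlgebra.subset_adjoin ℂ _ ⟨p, rfl⟩)

variable (H) in
/-- The finite-particle vectors: linear combinations of products of creation operators (of either
copy) applied to the doubled vacuum. -/
def finiteParticle : Submodule ℂ (DFock H) :=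
  Submodule.span ℂ (Set.range fun l : List (H × H) => l.foldr (creation dweyl) (dvacuum H))

/-- The two-mode pair operator `b Ψ†(ψ) Ψ̃†(ψ') - b̄ Ψ̃(ψ') Ψ(ψ)`. -/
def pairOp (ψ ψ' : H) (b : ℂ) (v : DFock H) : DFock H :=
  b • creation dweyl (ψ, 0) (creation dweyl (0, ψ') v) -
    conj b • annihilation dweyl (0, ψ') (annihilation dweyl (ψ, 0) v)

/-- `U(t) = exp(t (b Ψ†(ψ) Ψ̃†(ψ') - b̄ Ψ̃(ψ') Ψ(ψ)))`: a strongly continuous one-parameter unitary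
group whose generator is the pair operator on finite-particle vectors. -/
structure IsSqueezingGroup (ψ ψ' : H) (b : ℂ) (U : ℝ → unitary (DFock H →L[ℂ] DFock H)) :
    Prop where
  map_add : ∀ s t, U (s + t) = U s * U t
  continuous : ∀ v, Continuous fun t => (U t : DFock H →L[ℂ] DFock H) v
  generator : ∀ v ∈ finiteParticle H,
    HasDerivAt (fun t => (U t : DFock H →L[ℂ] DFock H) v) (pairOp ψ ψ' b v) 0

/-- The squeezed vacuum `U(1) (Ω ⊗ Ω)`. -/
def squeezedVacuum (U : ℝ → unitary (DFock H →L[ℂ] DFock H)) : DFock H :=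
  (U 1 : DFock H →L[ℂ] DFock H) (dvacuum H)

/-- The symplectic form of the doubled one-particle space. -/
def symplecticForm (p q : H × H) : ℝ := (⟪p.1, q.1⟫_ℂ + ⟪p.2, q.2⟫_ℂ).im

/-- `T` is a symplectic automorphism of the test function space, and the *-automorphism
`W(p) ↦ W(T p)` of the doubled Weyl C*-algebra is implemented by the unitary `U`. -/
structure IsImplementedBogoliubov (T : (H × H) ≃L[ℝ] (H × H))
    (U : unitary (DFock H →L[ℂ] DFock H)) : Prop where
  symplectic : ∀ p q, symplecticForm (T p) (T q) = symplecticForm p q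
  implemented : ∃ α : dweylAlgebra H ≃⋆ₐ[ℂ] dweylAlgebra H,
    (∀ p, α ⟨dweyl p, dweyl_mem p⟩ = ⟨dweyl (T p), dweyl_mem (T p)⟩) ∧
    ∀ a, (α a : DFock H →L[ℂ] DFock H) =
      (U : DFock H →L[ℂ] DFock H) * a * ((star U : unitary _) : DFock H →L[ℂ] DFock H)

/-- The symplectic map `p ↦ T p` of two-mode squeezing with phase `c` and coefficients `C, S`. -/
def squeezeMap (ψ ψ' : H) (c : ℂ) (C S : ℝ) (p : H × H) : H × H :=
  (p.1 + (((C : ℂ) - 1) * ⟪ψ, p.1⟫_ℂ - c * S * conj ⟪ψ', p.2⟫_ℂ) • ψ,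
   p.2 + (((C : ℂ) - 1) * ⟪ψ', p.2⟫_ℂ - c * S * conj ⟪ψ, p.1⟫_ℂ) • ψ')

/-- The phase of `b`. -/
def phase (b : ℂ) : ℂ := Complex.exp (b.arg * Complex.I)

/-- `Φ = (1/√Z) ∑ₙ exp(-i n β u / 2) |ψ, n⟩ ⊗ |ψ', n⟩`. -/
def IsTFDState (ψ ψ' : H) (Z β : ℝ) (u : ℂ) (Φ : DFock H) : Prop :=
  HasSum (fun n : ℕ => ((1 / √Z : ℝ) * Complex.exp (-(Complex.I * n * β * u / 2)) : ℂ) •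
    prodVec (numberState ψ n) (numberState ψ' n)) Φ

/-- The reduced state on the first factor: `a ↦ ⟨Φ, (a ⊗ 1) Φ⟩`. -/
def reducedState (Φ : DFock H) (a : Fock H →L[ℂ] Fock H) : ℂ := ⟪Φ, prodOp a 1 Φ⟫_ℂ

end Doubled

/-! ### Group fields and left translations -/

section GroupField

variable {G : Type*} [Group G] [MeasurableSpace G]

/-- The one-particle space `L²(Gⁿ, μⁿ)` of group fields. -/
abbrev GroupFields (n : ℕ) (μ : MeasureTheory.Measure G) : Type _ :=
  MeasureTheory.Lp ℂ 2 (MeasureTheory.Measure.pi fun _ : Fin n => μ)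

/-- The collective left translation `(L*_a φ)(g) = φ(a⁻¹ g)` on `L²(Gⁿ)`. -/
def leftTranslation {n : ℕ} (μ : MeasureTheory.Measure G) [MeasureTheory.SigmaFinite μ]
    [MeasurableMul G] [μ.IsMulLeftInvariant] (a : Fin n → G) :
    GroupFields n μ →ₗᵢ[ℂ] GroupFields n μ :=
  MeasureTheory.Lp.compMeasurePreservingₗᵢ ℂ (fun g : Fin n → G => a⁻¹ * g)
    (MeasureTheory.measurePreserving_mul_left _ a⁻¹)

/-- `γ(t) = exp(t X)`: the one-parameter subgroup with velocity `X` at the identity. -/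
structure IsExpCurve {E : Type*} [NormedAddCommGroup E] [NormedSpace ℝ E] [TopologicalSpace G]
    [ChartedSpace E G] (X : GroupLieAlgebra 𝓘(ℝ, E) G) (γ : ℝ → G) : Prop where
  map_add : ∀ s t, γ (s + t) = γ s * γ t
  hasDeriv : HasMFDerivAt 𝓘(ℝ, ℝ) 𝓘(ℝ, E) γ 0
    (ContinuousLinearMap.toSpanSingleton ℝ (X : E) : ℝ →L[ℝ] E)

/-- The implementing group `t ↦ Γ(L*_{γ(t)}) = exp(t U_*)` on the Fock space of group fields. -/
def translationFlow {n : ℕ} (μ : MeasureTheory.Measure G) [MeasureTheory.SigmaFinite μ]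
    [MeasurableMul G] [μ.IsMulLeftInvariant] (γ : Fin n → ℝ → G) (t : ℝ) :
    Fock (GroupFields n μ) →L[ℂ] Fock (GroupFields n μ) :=
  secondQuant (leftTranslation μ fun i => γ i t)

/-- The automorphism flow `a ↦ exp(it𝒢) a exp(-it𝒢)` with `𝒢 = i U_*`. -/
def gibbsFlow {n : ℕ} (μ : MeasureTheory.Measure G) [MeasureTheory.SigmaFinite μ]
    [MeasurableMul G] [μ.IsMulLeftInvariant] (γ : Fin n → ℝ → G) (t : ℝ)
    (a : Fock (GroupFields n μ) →L[ℂ] Fock (GroupFields n μ)) :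
    Fock (GroupFields n μ) →L[ℂ] Fock (GroupFields n μ) :=
  translationFlow μ γ (-t) * a * translationFlow μ γ t

end GroupField

end

/-! Rescaled to exponential vectors e(f), the vectors W(f)Ω have inner products exp((f, g)/2), so a
vector v is determined by its symbol g ↦ ⟪e g, v⟫, a Bargmann-type picture. On symbols the creation
operator of k is, up to a constant, multiplication by (g, k), and the annihilation operator is
differentiation along k; the canonical commutation relations are the product rule. This is carried
out for an abstract `IsFockSystem`, so that the Fock space over H and the doubled one over H × H are
treated at once.

The commutation relations bound the pair operator A = b a₁† a₂† - b̄ a₂ a₁: it raises the particle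
number by at most two and costs a factor of order N + 1 on vectors with at most N particles. Hence
‖Aⁿ v‖ ≤ C cⁿ n! with c independent of v, and Nelson's theorem (`exists_unitary_group_of_analytic`)
produces the squeezing group. A Taylor argument (`eq_zero_of_hasDerivAt_chain`) gives its uniqueness
and also transports commutators from the generator to the group: [A, Φ(q)] is again a field, with q
moved by a real-linear map whose exponential is the squeezing of test functions (`pairGroup_phi`). A
second use of the argument passes from fields to Weyl operators (`intertwines_weyl`,
`pairGroup_weyl`). Intertwining is proved weakly, between finite-particle vectors, because U(t) need
not preserve that domain.

Since a₁Ω = 0, the transported annihilator kills U(1)Ω. This is a recursion for the diagonal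
coefficients with ratio phase · tanh|b|, and a differential equation fixes the vacuum coefficient
1/cosh|b|. The squares of these coefficients sum to one, so there is no further component
(`hasSum_squeezedVacuum`). With tanh|b| = exp(-βε/2) this is the thermofield double, and
orthonormality of the second factor leaves the Gibbs weights in the reduced state. The squeezing
determines only the product βε; the eigenvalue u converts it into β.

The KMS function is an explicit double series over matrix elements between number states, dominated
on the closed strip by its values on the two edges (`Orthonormal.exists_kms_function`). The number
states of ψ may be inserted as intermediate states because the algebra of the mode preserves their
closed span. -/

/-! ### Quasi-analytic uniqueness and one-parameter groups with analytic vectors -/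

section Analytic

open Filter Topology
open Set (Icc)

variable {F : Type*} [NormedAddCommGroup F] [NormedSpace ℝ F]

/-- Taylor's inequality for a chain of successive derivatives vanishing at the base point. -/
lemma norm_le_of_hasDerivAt_chain {f : ℕ → ℝ → F}
    (hf : ∀ k t, HasDerivAt (f k) (f (k + 1) t) t) {t₀ t₁ B : ℝ} (h0 : ∀ k, f k t₀ = 0) (n : ℕ) :
    ∀ k, (∀ s ∈ Icc t₀ t₁, ‖f (k + n) s‖ ≤ B) →
      ∀ t ∈ Icc t₀ t₁, ‖f k t‖ ≤ B * (t - t₀) ^ n / n.factorial := by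
  induction n with
  | zero => intro k h t ht; simpa using h t ht
  | succ n ih =>
    intro k h t ht
    have h1 := ih (k + 1) (fun s hs => by
      have := h s hs
      rwa [show k + (n + 1) = k + 1 + n by ring] at this)
    refine image_norm_le_of_norm_deriv_right_le_deriv_boundary
      (f := f k) (f' := f (k + 1)) (a := t₀) (b := t₁)
      (B := fun t => B * (t - t₀) ^ (n + 1) / (n + 1).factorial)
      (B' := fun t => B * (t - t₀) ^ n / n.factorial) ?_ ?_ ?_ ?_ ?_ ht
    · exact fun x _ => (hf k x).continuousAt.continuousWithinAt
    · exact fun x _ => (hf k x).hasDerivWithinAt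
    · simp [h0]
    · intro x
      have h2 := ((((hasDerivAt_id x).sub_const t₀).pow (n + 1)).const_mul B).div_const
        ((n + 1).factorial : ℝ)
      refine h2.congr_deriv ?_
      have : (n.factorial : ℝ) ≠ 0 := by positivity
      simp [Nat.factorial_succ]
      field_simp
    · exact fun x hx => h1 x ⟨hx.1, hx.2.le⟩

lemma factorial_add_le (k n : ℕ) :
    ((k + n).factorial : ℝ) ≤ 2 ^ (k + n) * (k.factorial * n.factorial) := by
  have h := Nat.add_choose_mul_factorial_mul_factorial k n
  have h2 := Nat.choose_le_two_pow (k + n) n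
  rw [← h]
  push_cast
  rw [mul_assoc]
  gcongr
  exact_mod_cast h2

/-- A chain of successive derivatives of analytic growth that vanishes at `0` vanishes on
`[0, ∞)`. -/
lemma eq_zero_of_hasDerivAt_chain_of_nonneg {f : ℕ → ℝ → F}
    (hf : ∀ k t, HasDerivAt (f k) (f (k + 1) t) t) {c : ℝ} (hc : 0 < c)
    (hb : ∀ R, ∃ M, ∀ k t, |t| ≤ R → ‖f k t‖ ≤ M * c ^ k * k.factorial)
    (h0 : ∀ k, f k 0 = 0) {t : ℝ} (ht : 0 ≤ t) (k : ℕ) : f k t = 0 := by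
  -- The bound (k + n)! ≤ 2^(k + n) k! n! doubles c, so a step of 1/(4c) leaves the ratio 1/2 in the
  -- Taylor remainder. The step does not depend on M, which varies with the interval, so finitely
  -- many steps reach any t.
  set δ : ℝ := 1 / (4 * c) with hδ
  have hδ0 : 0 < δ := by positivity
  have key : ∀ m : ℕ, ∀ t ∈ Icc (0 : ℝ) (m * δ), ∀ k, f k t = 0 := by
    intro m
    induction m with
    | zero =>
      intro t ht k
      have : t = 0 := le_antisymm (by simpa using ht.2) ht.1
      rw [this, h0]
    | succ m ih =>
      intro t ht k
      rcases le_total t (m * δ) with h | h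
      · exact ih t ⟨ht.1, h⟩ k
      obtain ⟨M, hM⟩ := hb ((m + 1 : ℕ) * δ)
      have hm0 : 0 ≤ (m : ℝ) * δ := by positivity
      have hM0 : 0 ≤ M := by
        have := (norm_nonneg _).trans (hM 0 0 (by simp; positivity))
        simpa using this
      have hbd : ∀ n : ℕ, ‖f k t‖ ≤ (M * (2 * c) ^ k * k.factorial) * (1 / 2) ^ n := by
        intro n
        have h1 := norm_le_of_hasDerivAt_chain hf (t₀ := m * δ) (t₁ := (m + 1 : ℕ) * δ)
          (B := M * c ^ (k + n) * (k + n).factorial)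
          (ih (m * δ) ⟨hm0, le_rfl⟩) n k (fun s hs => hM _ s (by
            rw [abs_of_nonneg (hm0.trans hs.1)]; exact hs.2)) t ⟨h, ht.2⟩
        refine h1.trans ?_
        have h2 : (t - m * δ) ^ n ≤ δ ^ n := by
          refine pow_le_pow_left₀ (by linarith) ?_ n
          have := ht.2
          push_cast at this
          linarith
        calc M * c ^ (k + n) * (k + n).factorial * (t - m * δ) ^ n / n.factorial
            ≤ M * c ^ (k + n) * (2 ^ (k + n) * (k.factorial * n.factorial)) * δ ^ n
                / n.factorial := by
              gcongr
              exact factorial_add_le k n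
          _ = (M * (2 * c) ^ k * k.factorial) * (1 / 2) ^ n := by
              have hn : (n.factorial : ℝ) ≠ 0 := by positivity
              have h3 : c ^ n * δ ^ n = (1 / 4) ^ n := by
                rw [← mul_pow, hδ]; congr 1; field_simp
              have h4 : (2 : ℝ) ^ n * (1 / 4) ^ n = (1 / 2) ^ n := by
                rw [← mul_pow]; norm_num
              rw [← h4, ← h3, pow_add, pow_add, mul_pow]
              field_simp
      have hlim : Tendsto (fun n : ℕ => (M * (2 * c) ^ k * k.factorial) * (1 / 2 : ℝ) ^ n) atTop
          (𝓝 0) := by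
        have := (tendsto_pow_atTop_nhds_zero_of_lt_one (r := (1 / 2 : ℝ)) (by norm_num)
          (by norm_num)).const_mul (M * (2 * c) ^ k * k.factorial)
        simpa using this
      exact norm_le_zero_iff.1 (ge_of_tendsto' hlim hbd)
  obtain ⟨m, hm⟩ := exists_nat_ge (t / δ)
  exact key m t ⟨ht, (div_le_iff₀ hδ0).1 hm⟩ k

/-- A chain of successive derivatives of analytic growth that vanishes at `0` vanishes. -/
lemma eq_zero_of_hasDerivAt_chain {f : ℕ → ℝ → F}
    (hf : ∀ k t, HasDerivAt (f k) (f (k + 1) t) t) {c : ℝ} (hc : 0 < c)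
    (hb : ∀ R, ∃ M, ∀ k t, |t| ≤ R → ‖f k t‖ ≤ M * c ^ k * k.factorial)
    (h0 : ∀ k, f k 0 = 0) (t : ℝ) (k : ℕ) : f k t = 0 := by
  rcases le_total 0 t with ht | ht
  · exact eq_zero_of_hasDerivAt_chain_of_nonneg hf hc hb h0 ht k
  -- Time reversal: the signs make the reversed family a chain of derivatives again.
  · have := eq_zero_of_hasDerivAt_chain_of_nonneg (f := fun k t => (-1 : ℝ) ^ k • f k (-t)) ?_ hc
      ?_ (by simp [h0]) (neg_nonneg.2 ht) k
    · simpa using this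
    · intro k t
      have h1 : HasDerivAt (fun t : ℝ => f k (-t)) ((-1 : ℝ) • f (k + 1) (-t)) t :=
        (hf k (-t)).scomp t (hasDerivAt_neg t)
      refine (h1.const_smul ((-1 : ℝ) ^ k)).congr_deriv ?_
      rw [smul_smul, pow_succ]
    · intro R
      obtain ⟨M, hM⟩ := hb R
      refine ⟨M, fun k t ht => ?_⟩
      rw [norm_smul, norm_pow, norm_neg, norm_one, one_pow, one_mul]
      exact hM k _ (by rwa [abs_neg])

/-- The double exponential series of a sequence of analytic growth. -/
lemma tsum_tsum_exp_series [CompleteSpace F] {x : ℕ → F} {C c : ℝ}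
    (hx : ∀ n, ‖x n‖ ≤ C * c ^ n * n.factorial) {s t : ℝ} (hc : 0 ≤ c)
    (hst : c * (|s| + |t|) < 1) :
    ∑' k : ℕ, ∑' j : ℕ, (t ^ k / k.factorial) • (s ^ j / j.factorial : ℝ) • x (k + j) =
      ∑' n : ℕ, ((s + t) ^ n / n.factorial : ℝ) • x n := by
  set g : ℕ × ℕ → F := fun p => (t ^ p.1 / p.1.factorial) • (s ^ p.2 / p.2.factorial : ℝ) • x (p.1 + p.2)
    with hg
  have hC : 0 ≤ C := by simpa using (norm_nonneg _).trans (hx 0)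
  have hfib : ∀ (u v : ℝ) (n : ℕ), ∑ p ∈ Finset.HasAntidiagonal.antidiagonal n,
      (v ^ p.1 / p.1.factorial) * (u ^ p.2 / p.2.factorial) = (u + v) ^ n / n.factorial := by
    intro u v n
    rw [add_comm u v, (Commute.all v u).add_pow', Finset.sum_div]
    refine Finset.sum_congr rfl fun p hp => ?_
    have hp' := Finset.HasAntidiagonal.mem_antidiagonal.1 hp
    rw [nsmul_eq_mul, ← hp', Nat.choose_symm_add, Nat.add_choose, Nat.cast_div (Nat.factorial_mul_factorial_dvd_factorial_add _ _) (by positivity)]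
    push_cast
    field_simp
  -- Grouped along antidiagonals, the norms are dominated by a geometric series of ratio c(|s| +
  -- |t|).
  have hs : Summable g := by
    refine Summable.of_norm ?_
    rw [← (Finset.HasAntidiagonal.sigmaAntidiagonalEquivProd (A := ℕ)).summable_iff]
    refine (summable_sigma_of_nonneg (fun _ => norm_nonneg _)).2 ?_
    refine ⟨fun n => (hasSum_fintype _).summable, ?_⟩
    have hgeo : Summable fun n : ℕ => C * (c * (|s| + |t|)) ^ n :=
      (summable_geometric_of_lt_one (by positivity) hst).mul_left C
    refine Summable.of_nonneg_of_le (fun n => tsum_nonneg fun _ => norm_nonneg _) (fun n => ?_) hgeo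
    rw [tsum_fintype, Finset.univ_eq_attach]
    have h1 : ∑ p ∈ (Finset.HasAntidiagonal.antidiagonal n).attach, ‖g (p : ℕ × ℕ)‖ =
      ∑ p ∈ Finset.HasAntidiagonal.antidiagonal n, ‖g p‖ := Finset.sum_attach _ (fun p => ‖g p‖)
    refine (le_of_eq h1).trans ?_
    have h2 : ∀ p ∈ Finset.HasAntidiagonal.antidiagonal n, ‖g p‖ ≤
        ((|t| ^ p.1 / p.1.factorial) * (|s| ^ p.2 / p.2.factorial)) * (C * c ^ n * n.factorial) := by
      intro p hp
      have hp' := Finset.HasAntidiagonal.mem_antidiagonal.1 hp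
      simp only [hg, norm_smul, norm_div, norm_pow, Real.norm_eq_abs, Nat.abs_cast]
      rw [← mul_assoc]
      gcongr
      rw [← hp']
      exact hx _
    refine (Finset.sum_le_sum h2).trans (le_of_eq ?_)
    rw [← Finset.sum_mul, hfib, mul_pow]
    field_simp
  have e1 : ∑' p, g p = ∑' k : ℕ, ∑' j : ℕ, g (k, j) := hs.tsum_prod
  rw [show (∑' k : ℕ, ∑' j : ℕ, (t ^ k / k.factorial) • (s ^ j / j.factorial : ℝ) • x (k + j)) =
    ∑' k : ℕ, ∑' j : ℕ, g (k, j) from rfl, ← e1,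
    ← (Finset.HasAntidiagonal.sigmaAntidiagonalEquivProd (A := ℕ)).tsum_eq]
  have hs' := (Finset.HasAntidiagonal.sigmaAntidiagonalEquivProd (A := ℕ)).summable_iff.2 hs
  refine hs'.tsum_sigma.trans ?_
  refine tsum_congr fun n => ?_
  rw [tsum_fintype, Finset.univ_eq_attach]
  have h1 : ∑ p ∈ (Finset.HasAntidiagonal.antidiagonal n).attach, g (p : ℕ × ℕ) =
      ∑ p ∈ Finset.HasAntidiagonal.antidiagonal n, g p := Finset.sum_attach _ (fun p => g p)
  refine h1.trans ?_
  rw [← hfib, Finset.sum_smul]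
  refine Finset.sum_congr rfl fun p hp => ?_
  have hp' := Finset.HasAntidiagonal.mem_antidiagonal.1 hp
  simp only [hg, smul_smul, hp']

/-- A local one-parameter group in a monoid extends to a global one. -/
lemma exists_group_of_local {M : Type*} [Monoid M] {u : ℝ → M} {r : ℝ} (hr : 0 < r)
    (h0 : u 0 = 1)
    (hadd : ∀ s t, |s| < r → |t| < r → |s + t| < r → u (s + t) = u s * u t) :
    ∃ U : ℝ → M, (∀ s t, U (s + t) = U s * U t) ∧ ∀ t, |t| < r → U t = u t := by
  have hpow : ∀ (s : ℝ) (m : ℕ), (m : ℝ) * |s| < r → u (m * s) = u s ^ m := by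
    intro s m
    induction m with
    | zero => intro _; simp [h0]
    | succ m ih =>
      intro hm
      push_cast at hm
      have hs := abs_nonneg s
      have hms : 0 ≤ (m : ℝ) * |s| := by positivity
      have h1 : |(m : ℝ) * s| < r := by rw [abs_mul, Nat.abs_cast]; linarith
      have h2 : |(m : ℝ) * s + s| < r := by
        refine (abs_add_le _ _).trans_lt ?_
        rw [abs_mul, Nat.abs_cast]; linarith
      rw [pow_succ, ← ih (by linarith), ← hadd _ _ h1 (by linarith) h2]
      push_cast
      ring_nf
  have hscale : ∀ (t : ℝ) (N m : ℕ), 0 < N → 0 < m → |t| < N * r →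
      u (t / (N * m : ℕ)) ^ (N * m) = u (t / N) ^ N := by
    intro t N m hN hm ht
    have hN' : (0 : ℝ) < N := by exact_mod_cast hN
    have hm' : (0 : ℝ) < m := by exact_mod_cast hm
    have h1 := hpow (t / (N * m : ℕ)) m (by
      rw [abs_div, Nat.abs_cast]
      push_cast
      rw [mul_div_assoc', div_lt_iff₀ (by positivity)]
      nlinarith)
    rw [mul_comm N m, pow_mul, mul_comm m N, ← h1]
    congr 2
    push_cast
    field_simp
  have hNt : ∀ t : ℝ, |t| < ((⌊|t| / r⌋₊ + 1 : ℕ) : ℝ) * r := by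
    intro t
    have := Nat.lt_floor_add_one (|t| / r)
    rw [div_lt_iff₀ hr] at this
    push_cast
    exact this
  set N : ℝ → ℕ := fun t => ⌊|t| / r⌋₊ + 1 with hNdef
  -- Any sufficiently fine subdivision of t gives the same power: two of them are compared through
  -- their common refinement.
  have hU : ∀ (t : ℝ) (m : ℕ), 0 < m → |t| < m * r → u (t / m) ^ m = u (t / N t) ^ N t := by
    intro t m hm ht
    rw [← hscale t m (N t) hm (Nat.succ_pos _) ht, ← hscale t (N t) m (Nat.succ_pos _) hm (hNt t),
      mul_comm]
  refine ⟨fun t => u (t / N t) ^ N t, fun s t => ?_, fun t ht => ?_⟩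
  · have hm : 0 < N s + N t := by simp [hNdef]
    have hm' : (0 : ℝ) < (N s + N t : ℕ) := by exact_mod_cast hm
    have hNs : (0 : ℝ) ≤ N s := Nat.cast_nonneg _
    have hNt' : (0 : ℝ) ≤ N t := Nat.cast_nonneg _
    have a1 : |s| < (N s + N t : ℕ) * r := by
      have := hNt s; push_cast [hNdef] at this ⊢; nlinarith
    have a2 : |t| < (N s + N t : ℕ) * r := by
      have := hNt t; push_cast [hNdef] at this ⊢; nlinarith
    have a3 : |s + t| < (N s + N t : ℕ) * r := by
      have := hNt t; have := hNt s; have := abs_add_le s t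
      push_cast [hNdef] at *; nlinarith
    change u ((s + t) / N (s + t)) ^ N (s + t) = u (s / N s) ^ N s * u (t / N t) ^ N t
    rw [← hU _ _ hm a1, ← hU _ _ hm a2, ← hU _ _ hm a3]
    have b : ∀ x : ℝ, |x| < (N s + N t : ℕ) * r → |x / (N s + N t : ℕ)| < r := by
      intro x hx
      rw [abs_div, Nat.abs_cast, div_lt_iff₀ hm', mul_comm]
      exact hx
    have c1 := hadd _ _ (b s a1) (b t a2) (by rw [← add_div]; exact b _ a3)
    -- Addition of reals is commutative, so the two small factors commute and the power of their
    -- product splits.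
    have c2 := hadd _ _ (b t a2) (b s a1) (by rw [← add_div, add_comm]; exact b _ a3)
    rw [← add_div] at c1 c2
    rw [add_comm t s] at c2
    rw [c1, Commute.mul_pow]
    exact c1.symm.trans c2
  · have := hU t 1 one_pos (by simpa using ht)
    simpa using this.symm

end Analytic

/-! ### Nelson's analytic vector theorem and uniqueness of unitary groups -/

section Nelson

open Filter Topology

variable {K : Type*} [NormedAddCommGroup K] [InnerProductSpace ℂ K]

/-- Every vector of the domain of `A` is analytic for `A`, with a radius independent of it. -/
def HasAnalyticVectors {D : Submodule ℂ K} (A : Module.End ℂ D) (c : ℝ) : Prop :=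
  ∀ v : D, ∃ C : ℝ, ∀ n : ℕ, ‖(A ^ n) v‖ ≤ C * c ^ n * n.factorial

/-- The exponential series of an operator at a vector. -/
noncomputable def expSum {D : Submodule ℂ K} (A : Module.End ℂ D) (t : ℝ) (v : D) : K :=
  ∑' n : ℕ, (t ^ n / n.factorial : ℝ) • (((A ^ n) v : D) : K)

lemma inner_real_smul_left (r : ℝ) (x y : K) : ⟪r • x, y⟫_ℂ = r * ⟪x, y⟫_ℂ := by
  rw [← Complex.coe_smul, inner_smul_left, Complex.conj_ofReal]

lemma inner_real_smul_right (r : ℝ) (x y : K) : ⟪x, r • y⟫_ℂ = r * ⟪x, y⟫_ℂ := by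
  rw [← Complex.coe_smul, inner_smul_right]

/-- Strong continuity of a family of isometries follows from that on a dense set of vectors. -/
lemma continuous_of_isometry_of_dense {ι : Type*} [TopologicalSpace ι] {V : ι → K →L[ℂ] K}
    (hV : ∀ t x, ‖V t x‖ = ‖x‖) {S : Set K} (hS : Dense S)
    (h : ∀ x ∈ S, Continuous fun t => V t x) (x : K) : Continuous fun t => V t x := by
  refine continuous_iff_continuousAt.2 fun t => Metric.tendsto_nhds.2 fun ε hε => ?_
  obtain ⟨y, hy, hxy⟩ := Metric.dense_iff.1 hS x (ε / 3) (by positivity)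
  have h2 : y ∈ S := hxy
  have h1 : dist y x < ε / 3 := hy
  have h3 := Metric.tendsto_nhds.1 ((h y h2).tendsto t) (ε / 3) (by positivity)
  filter_upwards [h3] with s hs
  have e : ∀ r, dist (V r y) (V r x) = dist y x := fun r => by
    rw [dist_eq_norm, ← map_sub, hV, ← dist_eq_norm]
  calc dist (V s x) (V t x) ≤ dist (V s x) (V s y) + dist (V s y) (V t y) + dist (V t y) (V t x) :=
        dist_triangle4 _ _ _ _
    _ < ε / 3 + ε / 3 + ε / 3 := by
        rw [dist_comm (V s x), e, e]
        gcongr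
    _ = ε := by ring

lemma continuous_of_isometric_group {V : ℝ → K →L[ℂ] K}
    (hadd : ∀ s t, V (s + t) = V s * V t) (x : K) (h : ContinuousAt (fun t => V t x) 0)
    (hV : ∀ t x, ‖V t x‖ = ‖x‖) : Continuous fun t => V t x := by
  refine continuous_iff_continuousAt.2 fun t => ?_
  have h0 : V 0 x = x := by
    have h1 := hadd 0 0
    have h2 : V 0 (V 0 x) = V 0 x := by
      rw [add_zero] at h1
      conv_rhs => rw [h1]
      rfl
    -- `V 0` is an idempotent isometry: it annihilates `V 0 x - x` and preserves its norm.
    have h3 : ‖V 0 x - x‖ = 0 := by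
      rw [← hV 0, map_sub, h2, sub_self, norm_zero]
    exact sub_eq_zero.1 (norm_eq_zero.1 h3)
  have h1 : Tendsto (fun s => V t (V (s - t) x)) (𝓝 t) (𝓝 (V t (V 0 x))) := by
    refine ((V t).continuous.tendsto _).comp ?_
    have h2 : Tendsto (fun s : ℝ => s - t) (𝓝 t) (𝓝 0) := by
      have : Continuous fun s : ℝ => s - t := by fun_prop
      simpa using this.tendsto t
    exact Tendsto.comp h h2
  have h2 : (fun s => V t (V (s - t) x)) = fun s => V s x := by
    funext s
    have := hadd t (s - t)
    rw [add_sub_cancel] at this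
    rw [this]
    rfl
  rw [h2, h0] at h1
  exact h1

/-- The derivative of an operator group at any time, from the one at `0`. -/
lemma hasDerivAt_of_group {V : ℝ → K →L[ℂ] K} (hadd : ∀ s t, V (s + t) = V s * V t) {x y : K}
    (h : HasDerivAt (fun t => V t x) y 0) (t : ℝ) : HasDerivAt (fun t => V t x) (V t y) t := by
  have h1 : HasDerivAt (fun s => V (s - t) x) y t := by
    have h2 : HasDerivAt (fun t => V t x) y (t - t) := by rwa [sub_self]
    exact h2.comp_sub_const t t
  have h2 := ((V t).restrictScalars ℝ).hasFDerivAt.comp_hasDerivAt t h1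
  refine h2.congr_of_eventuallyEq (Eventually.of_forall fun s => ?_)
  change V s x = V t (V (s - t) x)
  have := hadd t (s - t)
  rw [add_sub_cancel] at this
  rw [this]
  rfl

variable {D : Submodule ℂ K} {A : Module.End ℂ D} {c : ℝ}

lemma norm_expSum_term_le {v : D} {C : ℝ} (hC : ∀ n : ℕ, ‖(A ^ n) v‖ ≤ C * c ^ n * n.factorial)
    (t : ℝ) (n : ℕ) :
    ‖(t ^ n / n.factorial : ℝ) • (((A ^ n) v : D) : K)‖ ≤ C * (c * |t|) ^ n := by
  rw [norm_smul, norm_div, norm_pow, Real.norm_eq_abs, Real.norm_eq_abs, Nat.abs_cast]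
  have h := hC n
  rw [Submodule.coe_norm] at h
  calc |t| ^ n / n.factorial * ‖(((A ^ n) v : D) : K)‖
      ≤ |t| ^ n / n.factorial * (C * c ^ n * n.factorial) := by gcongr
    _ = C * (c * |t|) ^ n := by rw [mul_pow]; field_simp

lemma summable_expSum [CompleteSpace K] (hA : HasAnalyticVectors A c) (hc : 0 < c) {t : ℝ}
    (ht : c * |t| < 1) (v : D) :
    Summable fun n : ℕ => (t ^ n / n.factorial : ℝ) • (((A ^ n) v : D) : K) := by
  obtain ⟨C, hC⟩ := hA v
  exact Summable.of_norm_bounded ((summable_geometric_of_lt_one (by positivity) ht).mul_left C)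
    (norm_expSum_term_le hC t)

lemma inner_pow_left (hskew : ∀ v w : D, ⟪((A v : D) : K), (w : K)⟫_ℂ = -⟪(v : K), ((A w : D) : K)⟫_ℂ)
    (n : ℕ) (v w : D) :
    ⟪(((A ^ n) v : D) : K), (w : K)⟫_ℂ = (-1) ^ n * ⟪(v : K), (((A ^ n) w : D) : K)⟫_ℂ := by
  induction n generalizing v with
  | zero => simp
  | succ n ih =>
    rw [pow_succ, Module.End.mul_apply, ih, hskew, ← Module.End.mul_apply, ← pow_succ', pow_succ]
    ring

/-- Skewness moves the series in the left slot to the right with t replaced by -t, so the double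
series is the exponential at t - t = 0. Its absolute convergence involves |t| + |-t|, whence the
halved radius. -/
lemma inner_expSum [CompleteSpace K] (hA : HasAnalyticVectors A c) (hc : 0 < c)
    (hskew : ∀ v w : D, ⟪((A v : D) : K), (w : K)⟫_ℂ = -⟪(v : K), ((A w : D) : K)⟫_ℂ)
    {t : ℝ} (ht : c * (2 * |t|) < 1) (v w : D) :
    ⟪expSum A t v, expSum A t w⟫_ℂ = ⟪(v : K), (w : K)⟫_ℂ := by
  have ht1 : c * |t| < 1 := by
    have : 0 ≤ c * |t| := by positivity
    linarith
  have hv := summable_expSum hA hc ht1 v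
  have hw := summable_expSum hA hc ht1 w
  obtain ⟨C, hC⟩ := hA w
  have key := tsum_tsum_exp_series (x := fun n => ⟪(v : K), (((A ^ n) w : D) : K)⟫_ℂ)
    (C := ‖(v : K)‖ * C) (c := c) (s := t) (t := -t) (fun n => by
      refine (norm_inner_le_norm _ _).trans ?_
      have := hC n
      rw [Submodule.coe_norm] at this
      rw [mul_assoc, mul_assoc]
      gcongr
      rwa [← mul_assoc]) hc.le (by rw [abs_neg]; linarith)
  have h1 : ⟪expSum A t v, expSum A t w⟫_ℂ = ∑' k : ℕ,
      ⟪(t ^ k / k.factorial : ℝ) • (((A ^ k) v : D) : K), expSum A t w⟫_ℂ :=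
    (innerSLFlip ℂ (expSum A t w)).map_tsum hv
  rw [h1]
  have h2 : ∀ k : ℕ, ⟪(t ^ k / k.factorial : ℝ) • (((A ^ k) v : D) : K), expSum A t w⟫_ℂ =
      ∑' j : ℕ, ⟪(t ^ k / k.factorial : ℝ) • (((A ^ k) v : D) : K),
        (t ^ j / j.factorial : ℝ) • (((A ^ j) w : D) : K)⟫_ℂ := fun k =>
    (innerSL ℂ ((t ^ k / k.factorial : ℝ) • (((A ^ k) v : D) : K))).map_tsum hw
  simp_rw [h2]
  have h3 : ∀ k j : ℕ, ⟪(t ^ k / k.factorial : ℝ) • (((A ^ k) v : D) : K),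
        (t ^ j / j.factorial : ℝ) • (((A ^ j) w : D) : K)⟫_ℂ =
      ((-t) ^ k / k.factorial : ℝ) • (t ^ j / j.factorial : ℝ) •
        ⟪(v : K), (((A ^ (k + j)) w : D) : K)⟫_ℂ := by
    intro k j
    rw [inner_real_smul_left, inner_real_smul_right, inner_pow_left hskew, pow_add,
      Module.End.mul_apply, neg_pow t k]
    simp only [Complex.real_smul]
    push_cast
    ring
  simp_rw [h3]
  rw [key, tsum_eq_single 0 (fun n hn => by simp [hn])]
  simp

/-- The exponential series, extended to the whole space. -/
lemma exists_isometry_extending_expSum [CompleteSpace K] (hD : Dense (D : Set K))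
    (hA : HasAnalyticVectors A c) (hc : 0 < c)
    (hskew : ∀ v w : D, ⟪((A v : D) : K), (w : K)⟫_ℂ = -⟪(v : K), ((A w : D) : K)⟫_ℂ)
    {t : ℝ} (ht : c * (2 * |t|) < 1) :
    ∃ V : K →L[ℂ] K, (∀ x, ‖V x‖ = ‖x‖) ∧ ∀ v : D, V v = expSum A t v := by
  have ht1 : c * |t| < 1 := by
    have : 0 ≤ c * |t| := by positivity
    linarith
  let f : D →ₗ[ℂ] K :=
    { toFun := expSum A t
      map_add' := fun v w => by
        rw [expSum, expSum, expSum, ← (summable_expSum hA hc ht1 v).tsum_add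
          (summable_expSum hA hc ht1 w)]
        exact tsum_congr fun n => by rw [map_add, Submodule.coe_add, smul_add]
      map_smul' := fun r v => by
        rw [expSum, expSum, ← (summable_expSum hA hc ht1 v).tsum_const_smul]
        exact tsum_congr fun n => by
          rw [map_smul, Submodule.coe_smul, RingHom.id_apply, smul_comm] }
  have hf : ∀ v, ‖f v‖ = ‖(v : K)‖ := fun v => by
    rw [@norm_eq_sqrt_re_inner ℂ, @norm_eq_sqrt_re_inner ℂ]
    exact congrArg (fun z : ℂ => √(RCLike.re z)) (inner_expSum hA hc hskew ht v v)
  have hdense : DenseRange D.subtype := by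
    rw [DenseRange, Submodule.coe_subtype, Subtype.range_coe]
    exact hD
  have hb : ∃ C, ∀ x, ‖f x‖ ≤ C * ‖D.subtype x‖ := ⟨1, fun x => by simp [hf]⟩
  refine ⟨f.extendOfNorm D.subtype, ?_, fun v => f.extendOfNorm_eq hdense hb v⟩
  refine fun x => hdense.induction_on (p := fun x => ‖f.extendOfNorm D.subtype x‖ = ‖x‖) x ?_ ?_
  · exact isClosed_eq (by fun_prop) continuous_norm
  · intro v
    rw [f.extendOfNorm_eq hdense hb, hf]
    rfl

lemma hasDerivAt_expSum [CompleteSpace K] (hA : HasAnalyticVectors A c) (hc : 0 < c) (v : D) :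
    HasDerivAt (fun t => expSum A t v) ((A v : D) : K) 0 := by
  obtain ⟨C, hC⟩ := hA v
  have hC0 : 0 ≤ C := by simpa using (norm_nonneg _).trans (hC 0)
  -- On the ball of radius 1/(2c) the differentiated terms are dominated by a multiple of n / 2ⁿ.
  set r : ℝ := 1 / (2 * c) with hr
  have hr0 : 0 < r := by positivity
  have hcr : c * r = 1 / 2 := by rw [hr]; field_simp
  have h1 := hasDerivAt_tsum_of_isPreconnected
    (g := fun (n : ℕ) (t : ℝ) => (t ^ n / n.factorial : ℝ) • (((A ^ n) v : D) : K))
    (g' := fun (n : ℕ) (t : ℝ) => (n * t ^ (n - 1) / n.factorial : ℝ) • (((A ^ n) v : D) : K))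
    (u := fun n : ℕ => (C * (1 / r)) * (n * (1 / 2) ^ n)) (t := Metric.ball (0 : ℝ) r) (y₀ := 0)
    (y := 0) ?_ Metric.isOpen_ball (convex_ball _ _).isPreconnected ?_ ?_
    (Metric.mem_ball_self hr0) ?_ (Metric.mem_ball_self hr0)
  · refine h1.congr_deriv ?_
    rw [tsum_eq_single 1]
    · simp
    · intro n hn
      rcases Nat.lt_or_gt_of_ne hn with h | h
      · have : n = 0 := by omega
        simp [this]
      · have : n - 1 ≠ 0 := by omega
        simp [this]
  · refine Summable.mul_left _ ?_
    have := summable_pow_mul_geometric_of_norm_lt_one 1 (r := (1 / 2 : ℝ)) (by norm_num)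
    simpa using this
  · intro n y _
    exact ((hasDerivAt_pow n y).div_const _).smul_const _
  · intro n y hy
    have hy' : |y| ≤ r := by
      have := Metric.mem_ball.1 hy
      rw [Real.dist_eq, sub_zero] at this
      exact this.le
    rcases Nat.eq_zero_or_pos n with rfl | hn
    · simp
    obtain ⟨m, rfl⟩ : ∃ m, n = m + 1 := ⟨n - 1, by omega⟩
    have h := hC (m + 1)
    rw [Submodule.coe_norm] at h
    rw [norm_smul, norm_div, norm_mul, norm_pow, Real.norm_eq_abs, Real.norm_eq_abs,
      Real.norm_eq_abs, Nat.abs_cast, Nat.abs_cast, Nat.add_sub_cancel]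
    calc ((m + 1 : ℕ) : ℝ) * |y| ^ m / (m + 1).factorial * ‖(((A ^ (m + 1)) v : D) : K)‖
        ≤ ((m + 1 : ℕ) : ℝ) * r ^ m / (m + 1).factorial *
          (C * c ^ (m + 1) * (m + 1).factorial) := by gcongr
      _ = C * (1 / r) * ((m + 1 : ℕ) * (c * r) ^ (m + 1)) := by
          rw [mul_pow, pow_succ r]; field_simp
      _ = _ := by rw [hcr]
  · simpa using summable_expSum hA hc (t := 0) (by simp) v

/-- The adjoint of an isometry is a left inverse, so it coincides with any right inverse and is
two-sided. -/
lemma mem_unitary_of_isometry [CompleteSpace K] {V V' : K →L[ℂ] K} (h : ∀ x, ‖V x‖ = ‖x‖)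
    (hV : V * V' = 1) : V ∈ unitary (K →L[ℂ] K) := by
  have h1 : star V * V = 1 := V.norm_map_iff_adjoint_comp_self.1 h
  have h2 : star V = V' := by
    calc star V = star V * (V * V') := by rw [hV, mul_one]
      _ = V' := by rw [← mul_assoc, h1, one_mul]
  exact Unitary.mem_iff.2 ⟨h1, by rw [h2, hV]⟩

/-- Nelson's analytic vector theorem: a skew operator with a dense invariant domain of uniformly
analytic vectors generates a strongly continuous unitary group. -/
theorem exists_unitary_group_of_analytic [CompleteSpace K] (hD : Dense (D : Set K))
    (hA : HasAnalyticVectors A c) (hc : 0 < c)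
    (hskew : ∀ v w : D, ⟪((A v : D) : K), (w : K)⟫_ℂ = -⟪(v : K), ((A w : D) : K)⟫_ℂ) :
    ∃ U : ℝ → unitary (K →L[ℂ] K), (∀ s t, U (s + t) = U s * U t) ∧
      (∀ x, Continuous fun t => (U t : K →L[ℂ] K) x) ∧
      ∀ v : D, HasDerivAt (fun t => (U t : K →L[ℂ] K) v) ((A v : D) : K) 0 := by
  set r : ℝ := 1 / (2 * c) with hr
  have hr0 : 0 < r := by positivity
  have hiff : ∀ t : ℝ, |t| < r ↔ c * (2 * |t|) < 1 := fun t => by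
    rw [hr, lt_div_iff₀ (by positivity)]
    constructor <;> intro h <;> linarith
  have hex : ∀ t : ℝ, ∃ V : K →L[ℂ] K, |t| < r → (∀ x, ‖V x‖ = ‖x‖) ∧
      ∀ v : D, V v = expSum A t v := fun t => by
    by_cases ht : |t| < r
    · obtain ⟨V, hV⟩ := exists_isometry_extending_expSum hD hA hc hskew ((hiff t).1 ht)
      exact ⟨V, fun _ => hV⟩
    · exact ⟨1, fun h => absurd h ht⟩
  choose u hu using hex
  have hext : ∀ {V V' : K →L[ℂ] K}, (∀ v : D, V v = V' v) → V = V' := fun {V V'} h =>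
    ContinuousLinearMap.ext fun x => congrFun (Continuous.ext_on hD V.continuous V'.continuous
      fun y hy => h ⟨y, hy⟩) x
  have h0 : u 0 = 1 := hext fun v => by
    rw [(hu 0 (by simpa using hr0)).2, expSum, tsum_eq_single 0 (fun n hn => by simp [hn])]
    simp
  have hadd : ∀ s t, |s| < r → |t| < r → |s + t| < r → u (s + t) = u s * u t := by
    intro s t hs ht hst
    refine hext fun v => ?_
    obtain ⟨C, hC⟩ := hA v
    have hs' := (hiff s).1 hs
    have ht' := (hiff t).1 ht
    have ht1 : c * |t| < 1 := by
      have : 0 ≤ c * |t| := by positivity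
      linarith
    have key := tsum_tsum_exp_series (x := fun n => (((A ^ n) v : D) : K)) (C := C) (c := c) (s := s)
      (t := t) hC hc.le (by linarith)
    rw [(hu _ hst).2, expSum, ← key, mul_apply_eq_comp, (hu t ht).2, expSum,
      (u s).map_tsum (summable_expSum hA hc ht1 v)]
    refine tsum_congr fun k => ?_
    rw [← Complex.coe_smul, map_smul, Complex.coe_smul, (hu s hs).2, expSum,
      ← tsum_const_smul'']
    refine tsum_congr fun j => ?_
    rw [add_comm k j, pow_add, Module.End.mul_apply]
  obtain ⟨U, hU, hUu⟩ := exists_group_of_local hr0 h0 hadd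
  have hU0 : U 0 = 1 := (hUu 0 (by simpa using hr0)).trans h0
  -- Isometry is known for small times only; every U(t) is a power of a small-time operator.
  have hiso : ∀ t x, ‖U t x‖ = ‖x‖ := by
    intro t
    obtain ⟨N, hN⟩ := exists_nat_gt (|t| / r)
    have hN0 : (0 : ℝ) < N := lt_of_le_of_lt (by positivity) hN
    have hpow : ∀ m : ℕ, U (m * (t / N)) = U (t / N) ^ m := by
      intro m
      induction m with
      | zero => simp [hU0]
      | succ m ih => rw [pow_succ, ← ih, ← hU]; congr 1; push_cast; ring
    have h1 : |t / N| < r := by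
      rw [abs_div, Nat.abs_cast, div_lt_iff₀ hN0]
      rw [div_lt_iff₀ hr0] at hN
      linarith
    have h2 : ∀ (m : ℕ) x, ‖(U (t / N) ^ m) x‖ = ‖x‖ := by
      intro m
      induction m with
      | zero => simp
      | succ m ih =>
        intro x
        rw [pow_succ, mul_apply_eq_comp, ih, hUu _ h1, (hu _ h1).1]
    have h3 := h2 N
    rw [← hpow, mul_div_cancel₀ _ hN0.ne'] at h3
    exact h3
  have hmem : ∀ t, U t ∈ unitary (K →L[ℂ] K) := fun t =>
    mem_unitary_of_isometry (hiso t) (V' := U (-t)) (by rw [← hU, add_neg_cancel, hU0])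
  have hderiv : ∀ v : D, HasDerivAt (fun t => U t v) ((A v : D) : K) 0 := fun v => by
    refine (hasDerivAt_expSum hA hc v).congr_of_eventuallyEq ?_
    have : Metric.ball (0 : ℝ) r ∈ 𝓝 (0 : ℝ) := Metric.ball_mem_nhds _ hr0
    filter_upwards [this] with t ht
    have ht' : |t| < r := by simpa [Real.dist_eq] using Metric.mem_ball.1 ht
    rw [hUu t ht', (hu t ht').2]
  refine ⟨fun t => ⟨U t, hmem t⟩, fun s t => Subtype.ext (hU s t), fun x => ?_, hderiv⟩
  exact continuous_of_isometry_of_dense hiso hD (fun y hy =>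
    continuous_of_isometric_group hU y (hderiv ⟨y, hy⟩).continuousAt hiso) x

/-- Unitary groups are determined by their generators on a dense invariant domain of uniformly
analytic vectors. -/
theorem unitary_group_unique [CompleteSpace K] (hD : Dense (D : Set K))
    (hA : HasAnalyticVectors A c) (hc : 0 < c) {U U' : ℝ → unitary (K →L[ℂ] K)}
    (hU : ∀ s t, U (s + t) = U s * U t) (hU' : ∀ s t, U' (s + t) = U' s * U' t)
    (h : ∀ v : D, HasDerivAt (fun t => (U t : K →L[ℂ] K) v) ((A v : D) : K) 0)
    (h' : ∀ v : D, HasDerivAt (fun t => (U' t : K →L[ℂ] K) v) ((A v : D) : K) 0) : U = U' := by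
  have hnorm : ∀ (V : unitary (K →L[ℂ] K)) x, ‖(V : K →L[ℂ] K) x‖ = ‖x‖ := fun V =>
    (V : K →L[ℂ] K).norm_map_iff_adjoint_comp_self.2 (Unitary.mem_iff.1 V.2).1
  have key : ∀ (v : D) (t : ℝ), (U t : K →L[ℂ] K) v - (U' t : K →L[ℂ] K) v = 0 := by
    intro v t
    obtain ⟨C, hC⟩ := hA v
    -- Evaluated at Aᵏ v, the difference of the two groups is the k-th derivative of the difference
    -- evaluated at v.
    refine eq_zero_of_hasDerivAt_chain (f := fun k t =>
      (U t : K →L[ℂ] K) ((A ^ k) v : D) - (U' t : K →L[ℂ] K) ((A ^ k) v : D)) ?_ hc ?_ ?_ t 0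
    · intro k t
      have h1 := hasDerivAt_of_group (V := fun t => (U t : K →L[ℂ] K))
        (fun s t => congrArg Subtype.val (hU s t)) (h ((A ^ k) v)) t
      have h2 := hasDerivAt_of_group (V := fun t => (U' t : K →L[ℂ] K))
        (fun s t => congrArg Subtype.val (hU' s t)) (h' ((A ^ k) v)) t
      rw [pow_succ']
      exact h1.sub h2
    · refine fun R => ⟨2 * C, fun k t _ => ?_⟩
      refine (norm_sub_le _ _).trans ?_
      have := hC k
      rw [Submodule.coe_norm] at this
      rw [hnorm, hnorm]
      linarith
    · intro k
      have e : ∀ {V : ℝ → unitary (K →L[ℂ] K)}, (∀ s t, V (s + t) = V s * V t) → V 0 = 1 :=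
        fun {V} hV => by
          have := hV 0 0
          rw [add_zero] at this
          exact left_eq_mul.1 this
      rw [e hU, e hU', sub_self]
  funext t
  refine Subtype.ext (ContinuousLinearMap.ext fun x => ?_)
  exact congrFun (Continuous.ext_on hD (U t : K →L[ℂ] K).continuous (U' t : K →L[ℂ] K).continuous
      fun y hy => sub_eq_zero.1 (key ⟨y, hy⟩ t)) x

end Nelson

/-! ### Abstract Fock representations and exponential vectors -/

/-- A Fock representation, with cyclic vacuum `Ω`, of the Weyl relations over a complex vector space
`E` with positive semidefinite hermitian form `B`. -/
structure IsFockSystem {E K : Type*} [AddCommGroup E] [Module ℂ E] [NormedAddCommGroup K]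
    [InnerProductSpace ℂ K] (B : E →ₗ⋆[ℂ] E →ₗ[ℂ] ℂ) (W : E → K →L[ℂ] K) (Ω : K) : Prop where
  form_conj : ∀ f g, conj (B f g) = B g f
  form_nonneg : ∀ f, 0 ≤ (B f f).re
  weyl_weyl : ∀ f g, W f (W g Ω) =
    Complex.exp (-(Complex.I / 2) * ((B f g).im : ℂ)) • W (f + g) Ω
  inner_weyl : ∀ f g, ⟪W f Ω, W g Ω⟫_ℂ = Complex.exp (-(B f f + B g g) / 4 + B f g / 2)
  weyl_zero : W 0 Ω = Ω
  total : Dense (Submodule.span ℂ (Set.range fun f => W f Ω) : Set K)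

/-- The exponential vector `exp(B(f, f) / 4) W(f) Ω`. -/
noncomputable def expVec {E K : Type*} [AddCommGroup E] [Module ℂ E] [NormedAddCommGroup K]
    [InnerProductSpace ℂ K] (B : E →ₗ⋆[ℂ] E →ₗ[ℂ] ℂ) (W : E → K →L[ℂ] K) (Ω : K) (f : E) : K :=
  Complex.exp (B f f / 4) • W f Ω

namespace IsFockSystem

open Filter Topology

variable {E K : Type*} [AddCommGroup E] [Module ℂ E] [NormedAddCommGroup K]
  [InnerProductSpace ℂ K] {B : E →ₗ⋆[ℂ] E →ₗ[ℂ] ℂ} {W : E → K →L[ℂ] K} {Ω : K}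

local notation "e" => expVec B W Ω

lemma inner_expVec (h : IsFockSystem B W Ω) (f g : E) : ⟪e f, e g⟫_ℂ = Complex.exp (B f g / 2) := by
  rw [expVec, expVec, inner_smul_left, inner_smul_right, h.inner_weyl, ← Complex.exp_conj,
    ← Complex.exp_add, ← Complex.exp_add, map_div₀, h.form_conj, map_ofNat]
  ring_nf

lemma weyl_expVec (h : IsFockSystem B W Ω) (k f : E) :
    W k (e f) = Complex.exp (-(B k k) / 4 - B k f / 2) • e (k + f) := by
  rw [expVec, expVec, map_smul, h.weyl_weyl, smul_smul, smul_smul, ← Complex.exp_add,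
    ← Complex.exp_add]
  congr 2
  have h1 : B f k = (B k f).re - (B k f).im * Complex.I := by
    rw [← h.form_conj k f]
    apply Complex.ext <;> simp
  simp only [map_add, LinearMap.add_apply]
  rw [h1]
  linear_combination (-1 / 4 : ℂ) * (Complex.re_add_im (B k f))

lemma expVec_zero (h : IsFockSystem B W Ω) : e 0 = Ω := by
  simp [expVec, h.weyl_zero]

lemma dense_expVec (h : IsFockSystem B W Ω) :
    Dense (Submodule.span ℂ (Set.range (e)) : Set K) := by
  refine h.total.mono ?_
  refine Submodule.span_le.2 ?_
  rintro _ ⟨f, rfl⟩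
  have : W f Ω = (Complex.exp (B f f / 4))⁻¹ • e f := by
    rw [expVec, smul_smul, inv_mul_cancel₀ (Complex.exp_ne_zero _), one_smul]
  change W f Ω ∈ _
  rw [this]
  exact Submodule.smul_mem _ _ (Submodule.subset_span ⟨f, rfl⟩)

/-- Exponential vectors span a dense subspace, so the symbol g ↦ ⟪e g, v⟫ determines v. Operator
identities below are checked on symbols by this lemma. -/
lemma ext_inner (h : IsFockSystem B W Ω) {v w : K} (hvw : ∀ g, ⟪e g, v⟫_ℂ = ⟪e g, w⟫_ℂ) :
    v = w := by
  refine h.dense_expVec.eq_of_inner_right (𝕜 := ℂ) fun y hy => ?_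
  induction hy using Submodule.span_induction with
  | mem x hx => obtain ⟨g, rfl⟩ := hx; exact hvw g
  | zero => simp
  | add x y _ _ hx hy => rw [inner_add_left, inner_add_left, hx, hy]
  | smul a x _ hx => rw [inner_smul_left, inner_smul_left, hx]

lemma op_ext (h : IsFockSystem B W Ω) {S T : K →L[ℂ] K} (hST : ∀ f, S (e f) = T (e f)) : S = T := by
  refine ContinuousLinearMap.ext_on h.dense_expVec ?_
  rintro _ ⟨f, rfl⟩
  exact hST f

lemma weyl_add_smul (h : IsFockSystem B W Ω) (k : E) (s t : ℝ) :
    W (((s + t : ℝ) : ℂ) • k) = W ((s : ℂ) • k) * W ((t : ℂ) • k) := by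
  refine h.op_ext fun f => ?_
  rw [mul_apply_eq_comp, h.weyl_expVec, h.weyl_expVec ((t : ℂ) • k), (W ((s : ℂ) • k)).map_smul,
    h.weyl_expVec, smul_smul, ← Complex.exp_add]
  have : ((s + t : ℝ) : ℂ) • k + f = (s : ℂ) • k + ((t : ℂ) • k + f) := by
    push_cast; rw [add_smul, add_assoc]
  rw [this]
  congr 2
  simp only [map_add, map_smulₛₗ, LinearMap.smul_apply, smul_eq_mul,
    Complex.conj_ofReal, RingHom.id_apply]
  push_cast
  ring

lemma weyl_zero_op (h : IsFockSystem B W Ω) : W 0 = 1 :=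
  h.op_ext fun f => by rw [h.weyl_expVec]; simp

lemma weyl_neg (h : IsFockSystem B W Ω) (k : E) : W k * W (-k) = 1 := by
  have := h.weyl_add_smul k 1 (-1)
  rw [add_neg_cancel] at this
  simpa [h.weyl_zero_op] using this.symm

/-- The squared distance of two exponential vectors is a combination of four kernel values. Thus
continuity of the form along the curve suffices, and `E` itself needs no topology. -/
lemma continuous_expVec (h : IsFockSystem B W Ω) {X : Type*} [TopologicalSpace X] {p : X → E}
    (hp : Continuous fun z : X × X => B (p z.1) (p z.2)) : Continuous fun x => e (p x) := by
  refine continuous_iff_continuousAt.2 fun x => ?_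
  refine tendsto_iff_norm_sub_tendsto_zero.2 ?_
  have h1 : ∀ y, ‖e (p y) - e (p x)‖ = √(RCLike.re (Complex.exp (B (p y) (p y) / 2) -
      Complex.exp (B (p y) (p x) / 2) - Complex.exp (B (p x) (p y) / 2) +
      Complex.exp (B (p x) (p x) / 2))) := by
    intro y
    rw [@norm_eq_sqrt_re_inner ℂ, inner_sub_left, inner_sub_right, inner_sub_right]
    simp only [h.inner_expVec]
    ring_nf
  simp_rw [h1]
  have c1 : Continuous fun y => B (p y) (p y) := hp.comp (continuous_id.prodMk continuous_id)
  have c2 : Continuous fun y => B (p y) (p x) := hp.comp (continuous_id.prodMk continuous_const)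
  have c3 : Continuous fun y => B (p x) (p y) := hp.comp (continuous_const.prodMk continuous_id)
  have c4 : Continuous fun y => √(RCLike.re (Complex.exp (B (p y) (p y) / 2) -
      Complex.exp (B (p y) (p x) / 2) - Complex.exp (B (p x) (p y) / 2) +
      Complex.exp (B (p x) (p x) / 2))) := by
    refine Real.continuous_sqrt.comp (RCLike.continuous_re.comp ?_)
    exact (((Complex.continuous_exp.comp (c1.div_const 2)).sub
      (Complex.continuous_exp.comp (c2.div_const 2))).sub
      (Complex.continuous_exp.comp (c3.div_const 2))).add continuous_const
  have := c4.tendsto x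
  simpa using this

variable [CompleteSpace K]

lemma inner_weyl_weyl (h : IsFockSystem B W Ω) (k : E) (x y : K) :
    ⟪W k x, W k y⟫_ℂ = ⟪x, y⟫_ℂ := by
  have h1 : ContinuousLinearMap.adjoint (W k) * W k = 1 := by
    refine h.op_ext fun f => h.ext_inner fun g => ?_
    rw [mul_apply_eq_comp, ContinuousLinearMap.adjoint_inner_right, h.weyl_expVec,
      h.weyl_expVec, inner_smul_left, inner_smul_right, h.inner_expVec, one_apply_eq_self,
      h.inner_expVec, ← Complex.exp_conj, ← Complex.exp_add, ← Complex.exp_add]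
    congr 1
    simp only [map_add, LinearMap.add_apply, map_sub, map_div₀, map_neg, h.form_conj, map_ofNat]
    ring
  rw [← ContinuousLinearMap.adjoint_inner_right, ← mul_apply_eq_comp, h1]
  rfl

lemma norm_weyl (h : IsFockSystem B W Ω) (k : E) (x : K) : ‖W k x‖ = ‖x‖ := by
  rw [@norm_eq_sqrt_re_inner ℂ, @norm_eq_sqrt_re_inner ℂ, h.inner_weyl_weyl]

lemma inner_weyl_left (h : IsFockSystem B W Ω) (k : E) (x y : K) :
    ⟪W k x, y⟫_ℂ = ⟪x, W (-k) y⟫_ℂ := by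
  conv_lhs => rw [← one_apply_eq_self (F := K →L[ℂ] K) y, ← h.weyl_neg k]
  exact h.inner_weyl_weyl k x _

lemma continuous_weyl (h : IsFockSystem B W Ω) (k : E) (x : K) :
    Continuous fun t : ℝ => W ((t : ℂ) • k) x := by
  refine continuous_of_isometry_of_dense (fun t => h.norm_weyl _) h.dense_expVec (fun y hy => ?_) x
  induction hy using Submodule.span_induction with
  | mem x hx =>
    obtain ⟨g, rfl⟩ := hx
    simp_rw [h.weyl_expVec]
    have c : Continuous fun t : ℝ => e ((t : ℂ) • k + g) := by
      refine h.continuous_expVec ?_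
      simp only [map_add, LinearMap.add_apply, map_smulₛₗ, LinearMap.smul_apply, smul_eq_mul,
        Complex.conj_ofReal, RingHom.id_apply]
      fun_prop
    refine Continuous.smul ?_ c
    simp only [map_smulₛₗ, LinearMap.smul_apply, smul_eq_mul,
        Complex.conj_ofReal, RingHom.id_apply]
    fun_prop
  | zero => simpa using continuous_const
  | add x y _ _ hx hy => simp_rw [map_add]; exact hx.add hy
  | smul a x _ hx => simp_rw [map_smul]; exact hx.const_smul a

/-- A vector is in the domain of a field operator once this holds weakly on exponential vectors. -/
lemma hasDerivAt_weyl_of_weak (h : IsFockSystem B W Ω) {k : E} {v x : K}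
    (hv : ∀ g, HasDerivAt (fun t : ℝ => ⟪e g, W ((t : ℂ) • k) v⟫_ℂ) ⟪e g, x⟫_ℂ 0) :
    HasDerivAt (fun t : ℝ => W ((t : ℂ) • k) v) x 0 := by
  -- W(-tk) sends an exponential vector to a multiple of another one, so the group law moves the
  -- weak derivative from 0 to every t.
  have hall : ∀ g (t : ℝ), HasDerivAt (fun t : ℝ => ⟪e g, W ((t : ℂ) • k) v⟫_ℂ)
      ⟪e g, W ((t : ℂ) • k) x⟫_ℂ t := by
    intro g t
    have hadj : ∀ y, ⟪e g, W ((t : ℂ) • k) y⟫_ℂ = ⟪W (-((t : ℂ) • k)) (e g), y⟫_ℂ := fun y => by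
      rw [h.inner_weyl_left, neg_neg]
    have h1 : ∀ s : ℝ, ⟪e g, W ((s : ℂ) • k) v⟫_ℂ =
        ⟪W (-((t : ℂ) • k)) (e g), W (((s - t : ℝ) : ℂ) • k) v⟫_ℂ := by
      intro s
      rw [← hadj, ← mul_apply_eq_comp, ← h.weyl_add_smul, add_sub_cancel]
    simp_rw [h1]
    rw [hadj, h.weyl_expVec]
    simp_rw [inner_smul_left]
    have h2 := hv (-((t : ℂ) • k) + g)
    rw [show (0 : ℝ) = t - t by ring] at h2
    exact (h2.comp_sub_const t t).const_mul _
  have hcont := h.continuous_weyl k x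
  -- The weak derivative integrates to an identity of vectors, whose right side is differentiable in
  -- norm because the integrand is norm continuous.
  have hint : ∀ t : ℝ, W ((t : ℂ) • k) v = v + ∫ r in (0 : ℝ)..t, W ((r : ℂ) • k) x := by
    intro t
    refine h.ext_inner fun g => ?_
    have h1 : ⟪e g, ∫ r in (0 : ℝ)..t, W ((r : ℂ) • k) x⟫_ℂ =
        ∫ r in (0 : ℝ)..t, ⟪e g, W ((r : ℂ) • k) x⟫_ℂ :=
      ((innerSL ℂ (e g)).intervalIntegral_comp_comm (hcont.intervalIntegrable _ _)).symm
    have h2 := intervalIntegral.integral_eq_sub_of_hasDerivAt (a := 0) (b := t)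
      (fun r _ => hall g r) ((continuous_const.inner hcont).intervalIntegrable _ _)
    rw [inner_add_right, h1, h2]
    simp [h.weyl_zero_op]
  have hd := (intervalIntegral.integral_hasDerivAt_right (hcont.intervalIntegrable 0 0)
    (hcont.stronglyMeasurableAtFilter _ _) hcont.continuousAt).const_add v
  simp only [Complex.ofReal_zero, zero_smul, h.weyl_zero_op, one_apply_eq_self] at hd
  exact hd.congr_of_eventuallyEq (Eventually.of_forall hint)

end IsFockSystem

/-! ### Vectors with monomial symbols -/

open MeasureTheory in
/-- The first Taylor coefficient of `z ↦ exp(x z)` as an integral over the unit circle. -/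
lemma integral_exp_circle (x : ℂ) :
    ∫ θ in Set.Icc 0 (2 * Real.pi), Complex.exp (-(θ * Complex.I)) *
      Complex.exp (Complex.exp (θ * Complex.I) * x) = 2 * Real.pi * x := by
  have h1 := Complex.two_pi_I_inv_smul_circleIntegral_sub_sq_inv_smul_of_differentiable
    (U := Set.univ) isOpen_univ (c := 0) (w₀ := 0) (R := 1) (f := fun z => Complex.exp (z * x))
    (Set.subset_univ _) (by fun_prop) (by simp)
  have h2 : deriv (fun z : ℂ => Complex.exp (z * x)) 0 = x := by simp
  rw [h2, circleIntegral] at h1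
  rw [integral_Icc_eq_integral_Ioc, ← intervalIntegral.integral_of_le (by positivity)]
  have h3 : ∫ θ in (0 : ℝ)..2 * Real.pi, Complex.exp (-(θ * Complex.I)) *
      Complex.exp (Complex.exp (θ * Complex.I) * x) =
      Complex.I⁻¹ * ∫ θ in (0 : ℝ)..2 * Real.pi, deriv (circleMap 0 1) θ •
        ((circleMap 0 1 θ - 0) ^ 2)⁻¹ • Complex.exp (circleMap 0 1 θ * x) := by
    rw [← intervalIntegral.integral_const_mul]
    refine intervalIntegral.integral_congr fun θ _ => ?_
    simp only [deriv_circleMap, circleMap, Complex.ofReal_one, one_mul, zero_add, sub_zero,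
      smul_eq_mul, Complex.exp_neg]
    have := Complex.exp_ne_zero (θ * Complex.I)
    field_simp
  rw [h3]
  rw [smul_eq_mul, inv_mul_eq_iff_eq_mul₀ Complex.two_pi_I_ne_zero] at h1
  rw [h1]
  field_simp

namespace IsFockSystem

open Filter Topology MeasureTheory

variable {E K : Type*} [AddCommGroup E] [Module ℂ E] [NormedAddCommGroup K]
  [InnerProductSpace ℂ K] {B : E →ₗ⋆[ℂ] E →ₗ[ℂ] ℂ} {W : E → K →L[ℂ] K} {Ω : K}

local notation "e" => expVec B W Ω

/-- Every product of one-particle functionals is represented by a vector. -/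
lemma exists_monomial [CompleteSpace K] (h : IsFockSystem B W Ω) (l : List E) :
    ∃ v : K, ∀ g, ⟪e g, v⟫_ℂ = (l.map (B g)).prod := by
  set n := l.length
  set k : Fin n → E := l.get
  -- Averaging e(∑ exp(iθⱼ) kⱼ) over the torus against ∏ exp(-iθⱼ) extracts the part of the
  -- exponential that is linear in each kⱼ.
  set p : (Fin n → ℝ) → E := fun θ => ∑ j, Complex.exp (θ j * Complex.I) • k j with hp
  set S : Set (Fin n → ℝ) := Set.univ.pi fun _ => Set.Icc 0 (2 * Real.pi) with hS
  have hSc : IsCompact S := isCompact_univ_pi fun _ => isCompact_Icc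
  set c : (Fin n → ℝ) → ℂ := fun θ => ∏ j, Complex.exp (-(θ j * Complex.I)) with hcdef
  have hpc : Continuous fun θ => e (p θ) := by
    refine h.continuous_expVec ?_
    simp only [hp, map_sum, map_smulₛₗ, LinearMap.sum_apply, LinearMap.smul_apply, smul_eq_mul,
      RingHom.id_apply, ← Complex.exp_conj, map_mul, Complex.conj_ofReal]
    fun_prop
  have hc : Continuous fun θ => c θ • e (p θ) := by
    refine Continuous.smul ?_ hpc
    simp only [hcdef]
    fun_prop
  -- Each angle contributes 2π · B(g, kⱼ)/2, so one factor π per variable has to be removed.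
  refine ⟨((Real.pi : ℂ) ^ n)⁻¹ • ∫ θ in S, c θ • e (p θ), fun g => ?_⟩
  have h1 : ⟪e g, ∫ θ in S, c θ • e (p θ)⟫_ℂ = ∫ θ in S, ⟪e g, c θ • e (p θ)⟫_ℂ :=
    ((innerSL ℂ (e g)).integral_comp_comm (hc.continuousOn.integrableOn_compact hSc)).symm
  have h2 : ∀ θ, ⟪e g, c θ • e (p θ)⟫_ℂ = ∏ j, (Complex.exp (-(θ j * Complex.I)) *
      Complex.exp (Complex.exp (θ j * Complex.I) * (B g (k j) / 2))) := by
    intro θ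
    rw [inner_smul_right, h.inner_expVec, Finset.prod_mul_distrib]
    congr 1
    rw [← Complex.exp_sum]
    simp only [hp, map_sum, map_smul, smul_eq_mul, Finset.sum_div]
    congr 1
    exact Finset.sum_congr rfl fun j _ => by ring
  have h3 : ∫ θ in S, ⟪e g, c θ • e (p θ)⟫_ℂ = ∏ j, (2 * Real.pi * (B g (k j) / 2)) := by
    simp_rw [h2]
    rw [hS, volume_pi, Measure.restrict_pi_pi]
    rw [integral_fintype_prod_eq_prod (f := fun (j : Fin n) (x : ℝ) =>
      Complex.exp (-(x * Complex.I)) *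
      Complex.exp (Complex.exp (x * Complex.I) * (B g (k j) / 2)))]
    exact Finset.prod_congr rfl fun j _ => integral_exp_circle _
  have h4 : ∏ j, (2 * Real.pi * (B g (k j) / 2)) = (Real.pi : ℂ) ^ n * ∏ j, B g (k j) := by
    have : ∀ j, 2 * (Real.pi : ℂ) * (B g (k j) / 2) = Real.pi * B g (k j) := fun j => by ring
    simp_rw [this]
    rw [Finset.prod_mul_distrib]
    simp
  rw [inner_smul_right, h1, h3, h4, ← mul_assoc, inv_mul_cancel₀
    (pow_ne_zero _ (by exact_mod_cast Real.pi_ne_zero)), one_mul]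
  conv_rhs => rw [← List.ofFn_get l, List.map_ofFn, List.prod_ofFn]
  rfl

end IsFockSystem

/-! ### Particle number, creation and annihilation operators, commutation relations -/

section Degree

variable {E K : Type*} [AddCommGroup E] [Module ℂ E] [NormedAddCommGroup K]
  [InnerProductSpace ℂ K]

/-- The vectors with fewer than `N` particles. -/
def degLT (B : E →ₗ⋆[ℂ] E →ₗ[ℂ] ℂ) (W : E → K →L[ℂ] K) (Ω : K) (N : ℕ) : Submodule ℂ K :=
  Submodule.span ℂ {v | ∃ l : List E, l.length < N ∧
    ∀ g, ⟪expVec B W Ω g, v⟫_ℂ = (l.map (B g)).prod}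

/-- The finite-particle vectors. -/
def finPart (W : E → K →L[ℂ] K) (Ω : K) : Submodule ℂ K :=
  Submodule.span ℂ (Set.range fun l : List E => l.foldr (creation W) Ω)

end Degree

namespace IsFockSystem

open Filter Topology

variable {E K : Type*} [AddCommGroup E] [Module ℂ E] [NormedAddCommGroup K]
  [InnerProductSpace ℂ K] {B : E →ₗ⋆[ℂ] E →ₗ[ℂ] ℂ} {W : E → K →L[ℂ] K} {Ω : K}

local notation "e" => expVec B W Ω
local notation "deg" => degLT B W Ω

lemma degLT_mono {M N : ℕ} (hMN : M ≤ N) : deg M ≤ deg N :=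
  Submodule.span_mono fun _ ⟨l, hl, hv⟩ => ⟨l, hl.trans_le hMN, hv⟩

lemma degLT_zero : deg 0 = ⊥ := by
  rw [eq_bot_iff, degLT, Submodule.span_le]
  rintro v ⟨l, hl, -⟩
  exact absurd hl (Nat.not_lt_zero _)

lemma hasDerivAt_form (k g x : E) (z : ℂ) :
    HasDerivAt (fun t : ℝ => B (g + (t * z : ℂ) • k) x) (conj z * B k x) 0 := by
  have h1 : ∀ t : ℝ, B (g + (t * z : ℂ) • k) x = B g x + t * (conj z * B k x) := fun t => by
    rw [map_add, map_smulₛₗ, LinearMap.add_apply, LinearMap.smul_apply, smul_eq_mul, map_mul,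
      Complex.conj_ofReal]
    ring
  simp_rw [h1]
  have h2 := ((Complex.ofRealCLM.hasDerivAt (x := 0)).mul_const (conj z * B k x)).const_add (B g x)
  simpa using h2

variable [CompleteSpace K]

/-- This is the creation operator up to a constant; on monomial symbols it adds one factor to the
list. -/
lemma exists_mul (h : IsFockSystem B W Ω) (k : E) {N : ℕ} {v : K} (hv : v ∈ deg N) :
    ∃ w ∈ deg (N + 1), ∀ g, ⟪e g, w⟫_ℂ = B g k * ⟪e g, v⟫_ℂ := by
  induction hv using Submodule.span_induction with
  | mem v hv =>
    obtain ⟨l, hl, hv⟩ := hv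
    obtain ⟨w, hw⟩ := h.exists_monomial (k :: l)
    refine ⟨w, Submodule.subset_span ⟨k :: l, by simpa using hl, hw⟩, fun g => ?_⟩
    rw [hw, hv, List.map_cons, List.prod_cons]
  | zero => exact ⟨0, zero_mem _, by simp⟩
  | add v v' _ _ hv hv' =>
    obtain ⟨w, hw, hw2⟩ := hv
    obtain ⟨w', hw', hw2'⟩ := hv'
    exact ⟨w + w', add_mem hw hw', fun g => by
      rw [inner_add_right, inner_add_right, hw2, hw2', mul_add]⟩
  | smul a v _ hv =>
    obtain ⟨w, hw, hw2⟩ := hv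
    exact ⟨a • w, Submodule.smul_mem _ _ hw, fun g => by
      rw [inner_smul_right, inner_smul_right, hw2]; ring⟩

/-- The product rule, by induction on the number of factors. The scalar z is tracked because symbols
are antiholomorphic in g: one vector w then serves for both directions k and i k, that is, for Φ(k)
and Φ(i k). -/
lemma exists_directional_aux (h : IsFockSystem B W Ω) (k : E) (l : List E) {v : K}
    (hv : ∀ g, ⟪e g, v⟫_ℂ = (l.map (B g)).prod) :
    ∃ w ∈ deg l.length, ∀ g (z : ℂ), HasDerivAt (fun t : ℝ => ⟪e (g + (t * z : ℂ) • k), v⟫_ℂ)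
      (conj z * ⟪e g, w⟫_ℂ) 0 := by
  induction l generalizing v with
  | nil =>
    refine ⟨0, zero_mem _, fun g z => ?_⟩
    simp_rw [hv]
    simpa using hasDerivAt_const (0 : ℝ) (1 : ℂ)
  | cons x l ih =>
    obtain ⟨m, hm⟩ := h.exists_monomial l
    obtain ⟨d, hd, hd2⟩ := ih hm
    obtain ⟨c, hc, hc2⟩ := h.exists_mul x hd
    refine ⟨B k x • m + c, add_mem (Submodule.smul_mem _ _ (Submodule.subset_span ⟨l, by simp, hm⟩))
      hc, fun g z => ?_⟩
    have h1 : ∀ g, ⟪e g, v⟫_ℂ = B g x * ⟪e g, m⟫_ℂ := fun g => by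
      rw [hv, hm, List.map_cons, List.prod_cons]
    simp_rw [h1]
    refine ((hasDerivAt_form k g x z).mul (hd2 g z)).congr_deriv ?_
    rw [inner_add_right, inner_smul_right, hc2]
    simp
    ring

lemma exists_directional (h : IsFockSystem B W Ω) (k : E) {N : ℕ} {v : K} (hv : v ∈ deg (N + 1)) :
    ∃ w ∈ deg N, ∀ g (z : ℂ), HasDerivAt (fun t : ℝ => ⟪e (g + (t * z : ℂ) • k), v⟫_ℂ)
      (conj z * ⟪e g, w⟫_ℂ) 0 := by
  induction hv using Submodule.span_induction with
  | mem v hv =>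
    obtain ⟨l, hl, hv⟩ := hv
    obtain ⟨w, hw, hw2⟩ := h.exists_directional_aux k l hv
    exact ⟨w, degLT_mono (Nat.lt_succ_iff.1 hl) hw, hw2⟩
  | zero => exact ⟨0, zero_mem _, fun g z => by simpa using hasDerivAt_const (0 : ℝ) (0 : ℂ)⟩
  | add v v' _ _ hv hv' =>
    obtain ⟨w, hw, hw2⟩ := hv
    obtain ⟨w', hw', hw2'⟩ := hv'
    refine ⟨w + w', add_mem hw hw', fun g z => ?_⟩
    simp_rw [inner_add_right, mul_add]
    exact (hw2 g z).add (hw2' g z)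
  | smul a v _ hv =>
    obtain ⟨w, hw, hw2⟩ := hv
    refine ⟨a • w, Submodule.smul_mem _ _ hw, fun g z => ?_⟩
    simp_rw [inner_smul_right]
    exact ((hw2 g z).const_mul a).congr_deriv (by ring)

/-- The derivative of the Weyl operators on finite-particle vectors. -/
lemma hasDerivAt_weyl_aux (h : IsFockSystem B W Ω) {k : E} {v c d : K}
    (hc : ∀ g, ⟪e g, c⟫_ℂ = B g k * ⟪e g, v⟫_ℂ)
    (hd : ∀ g (z : ℂ), HasDerivAt (fun t : ℝ => ⟪e (g + (t * z : ℂ) • k), v⟫_ℂ)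
      (conj z * ⟪e g, d⟫_ℂ) 0) (z : ℂ) :
    HasDerivAt (fun t : ℝ => W ((t : ℂ) • z • k) v) ((z / 2) • c - conj z • d) 0 := by
  refine h.hasDerivAt_weyl_of_weak fun g => ?_
  -- Moved to the left slot, the Weyl operator shifts g by -t z k and produces a scalar exponential.
  -- To first order in t the exponential multiplies the symbol and the shift differentiates it.
  have h1 : ∀ t : ℝ, ⟪e g, W ((t : ℂ) • z • k) v⟫_ℂ =
      Complex.exp ((t : ℂ) * (z * B g k / 2) - (t : ℂ) ^ 2 * (z * conj z * B k k / 4)) *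
        ⟪e (g + (t * (-z) : ℂ) • k), v⟫_ℂ := by
    intro t
    have h2 : ⟪e g, W ((t : ℂ) • z • k) v⟫_ℂ = ⟪W (-((t : ℂ) • z • k)) (e g), v⟫_ℂ := by
      rw [h.inner_weyl_left, neg_neg]
    rw [h2, h.weyl_expVec, inner_smul_left, ← Complex.exp_conj]
    have h3 : -((t : ℂ) • z • k) + g = g + (t * (-z) : ℂ) • k := by
      rw [smul_smul, mul_neg, neg_smul, add_comm]
    rw [h3]
    congr 2
    simp only [map_neg, map_smulₛₗ, LinearMap.neg_apply, LinearMap.smul_apply, smul_eq_mul, map_sub,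
      map_div₀, map_mul, h.form_conj, Complex.conj_ofReal, Complex.conj_conj, map_ofNat,
      RingHom.id_apply]
    ring
  simp_rw [h1]
  have hofReal : HasDerivAt (fun t : ℝ => (t : ℂ)) 1 0 := Complex.ofRealCLM.hasDerivAt
  have h4 : HasDerivAt (fun t : ℝ => Complex.exp ((t : ℂ) * (z * B g k / 2) -
      (t : ℂ) ^ 2 * (z * conj z * B k k / 4))) (z * B g k / 2) 0 := by
    have := ((hofReal.mul_const (z * B g k / 2)).sub
      ((hofReal.pow 2).mul_const (z * conj z * B k k / 4))).cexp
    simpa using this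
  refine (h4.mul (hd g (-z))).congr_deriv ?_
  rw [inner_sub_right, inner_smul_right, inner_smul_right, hc]
  simp
  ring

/-- The derivative (z/2) c - z̄ d of W(t z k) v has a linear and an antilinear part in z. The values
at z = 1 and z = i, combined as Φ(k) ∓ iΦ(i k), isolate one part each. -/
lemma fields_aux (h : IsFockSystem B W Ω) {k : E} {v c d : K}
    (hc : ∀ g, ⟪e g, c⟫_ℂ = B g k * ⟪e g, v⟫_ℂ)
    (hd : ∀ g (z : ℂ), HasDerivAt (fun t : ℝ => ⟪e (g + (t * z : ℂ) • k), v⟫_ℂ)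
      (conj z * ⟪e g, d⟫_ℂ) 0) :
    creation W k v = (-(Complex.I / (√2 : ℝ))) • c ∧
      annihilation W k v = (Complex.I * (√2 : ℝ)) • d := by
  have h1 := (h.hasDerivAt_weyl_aux hc hd 1).deriv
  have h2 := (h.hasDerivAt_weyl_aux hc hd Complex.I).deriv
  simp only [one_smul] at h1
  have hs : ((√2 : ℝ) : ℂ) * ((√2 : ℝ) : ℂ) = 2 := by
    rw [← Complex.ofReal_mul, Real.mul_self_sqrt (by norm_num)]; norm_num
  have hs0 : ((√2 : ℝ) : ℂ) ≠ 0 := fun h0 => by simp [h0] at hs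
  rw [creation, annihilation, segalField, segalField, h1, h2]
  have hinv : (((1 / √2 : ℝ) : ℝ) : ℂ) = (√2 : ℝ) / 2 := by
    push_cast; rw [eq_div_iff two_ne_zero, ← hs]; field_simp
  have hI2 : Complex.I / ((√2 : ℝ) : ℂ) = Complex.I * (√2 : ℝ) / 2 := by
    rw [eq_div_iff two_ne_zero, ← hs]; field_simp
  rw [hinv, hI2]
  have hI := Complex.I_mul_I
  constructor
  · match_scalars <;> simp <;> ring_nf <;> simp <;> ring
  · match_scalars <;> simp <;> ring_nf <;> simp

lemma creation_spec (h : IsFockSystem B W Ω) (k : E) {N : ℕ} {v : K} (hv : v ∈ deg N) :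
    creation W k v ∈ deg (N + 1) ∧
      ∀ g, ⟪e g, creation W k v⟫_ℂ = -(Complex.I / (√2 : ℝ)) * (B g k * ⟪e g, v⟫_ℂ) := by
  obtain ⟨c, hcm, hc⟩ := h.exists_mul k hv
  obtain ⟨d, -, hd⟩ := h.exists_directional k (degLT_mono (Nat.le_succ N) hv)
  rw [(h.fields_aux hc hd).1]
  exact ⟨Submodule.smul_mem _ _ hcm, fun g => by rw [inner_smul_right, hc]⟩

lemma annihilation_spec (h : IsFockSystem B W Ω) (k : E) {N : ℕ} {v : K} (hv : v ∈ deg (N + 1)) :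
    annihilation W k v ∈ deg N ∧ ∀ g (z : ℂ),
      HasDerivAt (fun t : ℝ => ⟪e (g + (t * z : ℂ) • k), v⟫_ℂ)
        (conj z * (-(Complex.I / (√2 : ℝ)) * ⟪e g, annihilation W k v⟫_ℂ)) 0 := by
  obtain ⟨c, -, hc⟩ := h.exists_mul k hv
  obtain ⟨d, hdm, hd⟩ := h.exists_directional k hv
  rw [(h.fields_aux hc hd).2]
  refine ⟨Submodule.smul_mem _ _ hdm, fun g z => (hd g z).congr_deriv ?_⟩
  have hs0 : ((√2 : ℝ) : ℂ) ≠ 0 := by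
    simp
  rw [inner_smul_right]
  field_simp
  simp

lemma hasDerivAt_weyl (h : IsFockSystem B W Ω) (k : E) {N : ℕ} {v : K} (hv : v ∈ deg N) :
    HasDerivAt (fun t : ℝ => W ((t : ℂ) • k) v)
      ((Complex.I / (√2 : ℝ)) • (creation W k v + annihilation W k v)) 0 := by
  obtain ⟨c, -, hc⟩ := h.exists_mul k hv
  obtain ⟨d, -, hd⟩ := h.exists_directional k (degLT_mono (Nat.le_succ N) hv)
  have h1 := h.hasDerivAt_weyl_aux hc hd 1
  simp only [one_smul] at h1
  refine h1.congr_deriv ?_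
  rw [(h.fields_aux hc hd).1, (h.fields_aux hc hd).2]
  have hs : ((√2 : ℝ) : ℂ) * ((√2 : ℝ) : ℂ) = 2 := by
    rw [← Complex.ofReal_mul, Real.mul_self_sqrt (by norm_num)]; norm_num
  have hs0 : ((√2 : ℝ) : ℂ) ≠ 0 := fun h0 => by simp [h0] at hs
  have hI2 : Complex.I / ((√2 : ℝ) : ℂ) = Complex.I * (√2 : ℝ) / 2 := by
    rw [eq_div_iff two_ne_zero, ← hs]; field_simp
  rw [hI2]
  have hs2 : ((√2 : ℝ) : ℂ) ^ 2 = 2 := by rw [sq, hs]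
  match_scalars
  · simp; ring_nf; simp only [Complex.I_sq, hs2]; norm_num
  · simp; ring_nf; simp only [Complex.I_sq, hs2]; norm_num

end IsFockSystem

lemma inner_self_eq_ofReal {K : Type*} [NormedAddCommGroup K] [InnerProductSpace ℂ K] (x : K) :
    ⟪x, x⟫_ℂ = ((‖x‖ ^ 2 : ℝ) : ℂ) := by
  rw [inner_self_eq_norm_sq_to_K]
  push_cast
  rfl

namespace IsFockSystem

open Filter Topology

variable {E K : Type*} [AddCommGroup E] [Module ℂ E] [NormedAddCommGroup K]
  [InnerProductSpace ℂ K] {B : E →ₗ⋆[ℂ] E →ₗ[ℂ] ℂ} {W : E → K →L[ℂ] K} {Ω : K}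

local notation "e" => expVec B W Ω
local notation "deg" => degLT B W Ω
local notation "𝓓" => finPart W Ω

lemma inner_expVec_vacuum (h : IsFockSystem B W Ω) (g : E) : ⟪e g, Ω⟫_ℂ = 1 := by
  have h1 := h.inner_expVec g 0
  rw [h.expVec_zero] at h1
  simpa using h1

lemma vacuum_mem (h : IsFockSystem B W Ω) : Ω ∈ deg 1 :=
  Submodule.subset_span ⟨[], by simp, fun g => by simp [h.inner_expVec_vacuum]⟩

lemma norm_vacuum (h : IsFockSystem B W Ω) : ‖Ω‖ = 1 := by
  have h1 := h.inner_expVec_vacuum 0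
  rw [h.expVec_zero, inner_self_eq_ofReal] at h1
  have h2 : ‖Ω‖ ^ 2 = 1 := by exact_mod_cast h1
  exact (pow_eq_one_iff_of_nonneg (norm_nonneg _) two_ne_zero).1 h2

lemma finPart_ext {v w : 𝓓} (hvw : ∀ x : 𝓓, ⟪(v : K), (x : K)⟫_ℂ = ⟪(w : K), (x : K)⟫_ℂ) : v = w := by
  have h1 := hvw (v - w)
  rw [← sub_eq_zero, ← inner_sub_left, ← Submodule.coe_sub, inner_self_eq_zero] at h1
  exact sub_eq_zero.1 (Subtype.ext h1)

variable [CompleteSpace K]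

lemma foldr_spec (h : IsFockSystem B W Ω) (l : List E) :
    l.foldr (creation W) Ω ∈ deg (l.length + 1) ∧
      ∀ g, ⟪e g, l.foldr (creation W) Ω⟫_ℂ =
        (-(Complex.I / (√2 : ℝ))) ^ l.length * (l.map (B g)).prod := by
  induction l with
  | nil => exact ⟨h.vacuum_mem, fun g => by simp [h.inner_expVec_vacuum]⟩
  | cons k l ih =>
    obtain ⟨h1, h2⟩ := h.creation_spec k ih.1
    refine ⟨h1, fun g => ?_⟩
    rw [List.foldr_cons, h2, ih.2, List.map_cons, List.prod_cons, List.length_cons, pow_succ]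
    ring

/-- Products of creation operators on the vacuum have monomial symbols up to a nonzero constant. The
domain thus acquires the degree filtration on which norms are estimated. -/
lemma mem_finPart_iff (h : IsFockSystem B W Ω) {v : K} : v ∈ 𝓓 ↔ ∃ N, v ∈ deg (N + 1) := by
  constructor
  · intro hv
    induction hv using Submodule.span_induction with
    | mem v hv => obtain ⟨l, rfl⟩ := hv; exact ⟨_, (h.foldr_spec l).1⟩
    | zero => exact ⟨0, zero_mem _⟩
    | add v w _ _ hv hw =>
      obtain ⟨N, hv⟩ := hv
      obtain ⟨M, hw⟩ := hw
      exact ⟨max N M, add_mem (degLT_mono (by omega) hv) (degLT_mono (by omega) hw)⟩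
    | smul a v _ hv => obtain ⟨N, hv⟩ := hv; exact ⟨N, Submodule.smul_mem _ _ hv⟩
  · rintro ⟨N, hv⟩
    refine Submodule.span_le.2 ?_ hv
    rintro v ⟨l, -, hv⟩
    have hs : (-(Complex.I / ((√2 : ℝ) : ℂ))) ^ l.length ≠ 0 := pow_ne_zero _ (by simp)
    have : v = ((-(Complex.I / ((√2 : ℝ) : ℂ))) ^ l.length)⁻¹ • l.foldr (creation W) Ω := by
      refine h.ext_inner fun g => ?_
      rw [inner_smul_right, (h.foldr_spec l).2, hv, inv_mul_cancel_left₀ hs]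
    rw [this]
    exact Submodule.smul_mem _ _ (Submodule.subset_span ⟨l, rfl⟩)

lemma creation_inner (h : IsFockSystem B W Ω) (k : E) (v : 𝓓) (g : E) :
    ⟪e g, creation W k v⟫_ℂ = -(Complex.I / (√2 : ℝ)) * (B g k * ⟪e g, (v : K)⟫_ℂ) := by
  obtain ⟨N, hN⟩ := h.mem_finPart_iff.1 v.2
  exact (h.creation_spec k hN).2 g

lemma annihilation_hasDerivAt (h : IsFockSystem B W Ω) (k : E) (v : 𝓓) (g : E) (z : ℂ) :
    HasDerivAt (fun t : ℝ => ⟪e (g + (t * z : ℂ) • k), (v : K)⟫_ℂ)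
      (conj z * (-(Complex.I / (√2 : ℝ)) * ⟪e g, annihilation W k v⟫_ℂ)) 0 := by
  obtain ⟨N, hN⟩ := h.mem_finPart_iff.1 v.2
  exact (h.annihilation_spec k hN).2 g z

/-- A vector with the derivative characterising `annihilation W k v`. -/
lemma annihilation_eq (h : IsFockSystem B W Ω) (k : E) (v : 𝓓) (w : K)
    (hw : ∀ g, HasDerivAt (fun t : ℝ => ⟪e (g + (t : ℂ) • k), (v : K)⟫_ℂ)
      (-(Complex.I / (√2 : ℝ)) * ⟪e g, w⟫_ℂ) 0) : annihilation W k v = w := by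
  refine h.ext_inner fun g => ?_
  have h1 := h.annihilation_hasDerivAt k v g 1
  simp only [mul_one, map_one, one_mul] at h1
  have h2 := h1.unique (hw g)
  have hs : -(Complex.I / ((√2 : ℝ) : ℂ)) ≠ 0 := by simp
  exact mul_left_cancel₀ hs h2

/-- The creation operators on finite-particle vectors. -/
noncomputable def cre (h : IsFockSystem B W Ω) (k : E) : Module.End ℂ 𝓓 where
  toFun v := ⟨creation W k v, by
    obtain ⟨N, hN⟩ := h.mem_finPart_iff.1 v.2
    exact h.mem_finPart_iff.2 ⟨_, (h.creation_spec k hN).1⟩⟩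
  map_add' v w := Subtype.ext <| h.ext_inner fun g => by
    change ⟪e g, creation W k (v + w : 𝓓)⟫_ℂ = ⟪e g, creation W k v + creation W k w⟫_ℂ
    rw [inner_add_right]
    simp only [creation_inner h]
    rw [Submodule.coe_add, inner_add_right]
    ring
  map_smul' a v := Subtype.ext <| h.ext_inner fun g => by
    change ⟪e g, creation W k (a • v : 𝓓)⟫_ℂ = ⟪e g, a • creation W k v⟫_ℂ
    rw [inner_smul_right]
    simp only [creation_inner h]
    rw [Submodule.coe_smul, inner_smul_right]
    ring

/-- The annihilation operators on finite-particle vectors. -/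
noncomputable def ann (h : IsFockSystem B W Ω) (k : E) : Module.End ℂ 𝓓 where
  toFun v := ⟨annihilation W k v, by
    obtain ⟨N, hN⟩ := h.mem_finPart_iff.1 v.2
    exact h.mem_finPart_iff.2 ⟨_, degLT_mono (Nat.le_succ _) (h.annihilation_spec k hN).1⟩⟩
  map_add' v w := Subtype.ext <| h.annihilation_eq k (v + w) _ fun g => by
    have h1 := (h.annihilation_hasDerivAt k v g 1).add (h.annihilation_hasDerivAt k w g 1)
    simp only [mul_one, map_one, one_mul] at h1
    simp only [Submodule.coe_add, inner_add_right, mul_add]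
    exact h1
  map_smul' a v := Subtype.ext <| h.annihilation_eq k (a • v) _ fun g => by
    have h1 := (h.annihilation_hasDerivAt k v g 1).const_mul a
    simp only [mul_one, map_one, one_mul] at h1
    simp only [Submodule.coe_smul, inner_smul_right, RingHom.id_apply]
    exact h1.congr_deriv (by ring)

lemma coe_cre (h : IsFockSystem B W Ω) (k : E) (v : 𝓓) : (h.cre k v : K) = creation W k v := rfl

lemma coe_ann (h : IsFockSystem B W Ω) (k : E) (v : 𝓓) : (h.ann k v : K) = annihilation W k v := rfl

lemma cre_add (h : IsFockSystem B W Ω) (k l : E) : h.cre (k + l) = h.cre k + h.cre l := by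
  refine LinearMap.ext fun v => Subtype.ext <| h.ext_inner fun g => ?_
  rw [LinearMap.add_apply, Submodule.coe_add, inner_add_right]
  simp only [coe_cre, creation_inner h, map_add]
  ring

lemma cre_smul (h : IsFockSystem B W Ω) (a : ℂ) (k : E) : h.cre (a • k) = a • h.cre k := by
  refine LinearMap.ext fun v => Subtype.ext <| h.ext_inner fun g => ?_
  rw [LinearMap.smul_apply, Submodule.coe_smul, inner_smul_right]
  simp only [coe_cre, creation_inner h, map_smul, smul_eq_mul]
  ring

lemma ann_smul (h : IsFockSystem B W Ω) (a : ℂ) (k : E) : h.ann (a • k) = conj a • h.ann k := by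
  refine LinearMap.ext fun v => Subtype.ext <| h.annihilation_eq (a • k) v _ fun g => ?_
  have h1 := h.annihilation_hasDerivAt k v g a
  simp_rw [smul_smul]
  refine h1.congr_deriv ?_
  rw [LinearMap.smul_apply, Submodule.coe_smul, inner_smul_right, coe_ann]
  ring

lemma cre_comm (h : IsFockSystem B W Ω) (k l : E) : h.cre k * h.cre l = h.cre l * h.cre k := by
  refine LinearMap.ext fun v => Subtype.ext <| h.ext_inner fun g => ?_
  rw [Module.End.mul_apply, Module.End.mul_apply, h.coe_cre k (h.cre l v), creation_inner h,
    h.coe_cre l (h.cre k v), creation_inner h, coe_cre, coe_cre, creation_inner h, creation_inner h]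
  ring

/-- Creation multiplies the symbol by B(g, l) and annihilation differentiates it along k; the
product rule leaves the extra term B(k, l). -/
lemma ann_mul_cre (h : IsFockSystem B W Ω) (k l : E) :
    h.ann k * h.cre l = h.cre l * h.ann k + B k l • 1 := by
  refine LinearMap.ext fun v => Subtype.ext <| h.annihilation_eq k (h.cre l v) _ fun g => ?_
  simp only [coe_cre, creation_inner h]
  have h1 := (hasDerivAt_form (B := B) k g l 1).mul (h.annihilation_hasDerivAt k v g 1)
  simp only [mul_one, map_one, one_mul] at h1
  refine (h1.const_mul _).congr_deriv ?_
  rw [LinearMap.add_apply, Submodule.coe_add, inner_add_right, Module.End.mul_apply,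
    coe_cre, creation_inner h, LinearMap.smul_apply, Submodule.coe_smul, inner_smul_right, coe_ann]
  simp
  ring

/-- The field operators on finite-particle vectors. -/
noncomputable def phi (h : IsFockSystem B W Ω) (k : E) : Module.End ℂ 𝓓 :=
  ((1 / √2 : ℝ) : ℂ) • (h.cre k + h.ann k)

lemma hasDerivAt_phi (h : IsFockSystem B W Ω) (k : E) (v : 𝓓) :
    HasDerivAt (fun t : ℝ => W ((t : ℂ) • k) v) (Complex.I • (h.phi k v : K)) 0 := by
  obtain ⟨N, hN⟩ := h.mem_finPart_iff.1 v.2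
  refine (h.hasDerivAt_weyl k hN).congr_deriv ?_
  rw [phi, LinearMap.smul_apply, LinearMap.add_apply, Submodule.coe_smul, Submodule.coe_add,
    coe_cre, coe_ann, smul_smul]
  congr 1
  push_cast
  ring

/-- The inner product ⟪W(tk) v, W(tk) w⟫ is constant in t, and its derivative at 0 is the asserted
symmetry. -/
lemma inner_phi (h : IsFockSystem B W Ω) (k : E) (v w : 𝓓) :
    ⟪(h.phi k v : K), (w : K)⟫_ℂ = ⟪(v : K), (h.phi k w : K)⟫_ℂ := by
  have h1 := (h.hasDerivAt_phi k v).inner ℂ (h.hasDerivAt_phi k w)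
  simp only [h.inner_weyl_weyl, Complex.ofReal_zero, zero_smul, h.weyl_zero_op,
    one_apply_eq_self] at h1
  have h2 := h1.unique (hasDerivAt_const (0 : ℝ) ⟪(v : K), (w : K)⟫_ℂ)
  rw [inner_smul_right, inner_smul_left, Complex.conj_I] at h2
  have h3 := mul_left_cancel₀ Complex.I_ne_zero
    (show Complex.I * ⟪(v : K), (h.phi k w : K)⟫_ℂ = Complex.I * ⟪(h.phi k v : K), (w : K)⟫_ℂ by
      linear_combination h2)
  exact h3.symm

/-- The symmetry of Φ(k) and that of Φ(i k) are two linear relations between four inner products;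
solving them yields adjointness. -/
lemma inner_ann (h : IsFockSystem B W Ω) (k : E) (v w : 𝓓) :
    ⟪(h.ann k v : K), (w : K)⟫_ℂ = ⟪(v : K), (h.cre k w : K)⟫_ℂ := by
  have h1 := h.inner_phi k v w
  have h2 := h.inner_phi (Complex.I • k) v w
  have hs : ((1 / √2 : ℝ) : ℂ) ≠ 0 := by simp
  simp only [phi, cre_smul, ann_smul, LinearMap.smul_apply, LinearMap.add_apply,
    Submodule.coe_smul, Submodule.coe_add, inner_smul_left, inner_smul_right, inner_add_left,
    inner_add_right, Complex.conj_ofReal, Complex.conj_I, map_neg] at h1 h2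
  have h1' := mul_left_cancel₀ hs h1
  have h2' := mul_left_cancel₀ hs h2
  have hI := Complex.I_mul_I
  linear_combination (1 / 2 : ℂ) * h1' + (-Complex.I / 2) * h2' - (1 / 2 : ℂ) *
    (⟪(h.cre k v : K), (w : K)⟫_ℂ - ⟪(h.ann k v : K), (w : K)⟫_ℂ +
    ⟪(v : K), (h.cre k w : K)⟫_ℂ - ⟪(v : K), (h.ann k w : K)⟫_ℂ) * hI

lemma inner_cre (h : IsFockSystem B W Ω) (k : E) (v w : 𝓓) :
    ⟪(h.cre k v : K), (w : K)⟫_ℂ = ⟪(v : K), (h.ann k w : K)⟫_ℂ := by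
  rw [← inner_conj_symm, ← h.inner_ann, inner_conj_symm]

/-- Additivity in the test function comes from the adjoint, where it is evident, since annihilation
is characterised by derivatives along one fixed direction at a time. -/
lemma ann_add (h : IsFockSystem B W Ω) (k l : E) : h.ann (k + l) = h.ann k + h.ann l := by
  refine LinearMap.ext fun v => finPart_ext fun x => ?_
  rw [h.inner_ann, h.cre_add, LinearMap.add_apply, LinearMap.add_apply, Submodule.coe_add,
    Submodule.coe_add, inner_add_left, inner_add_right, h.inner_ann, h.inner_ann]

lemma ann_comm (h : IsFockSystem B W Ω) (k l : E) : h.ann k * h.ann l = h.ann l * h.ann k := by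
  refine LinearMap.ext fun v => finPart_ext fun x => ?_
  rw [Module.End.mul_apply, Module.End.mul_apply, h.inner_ann, h.inner_ann, h.inner_ann,
    h.inner_ann, ← Module.End.mul_apply, ← Module.End.mul_apply, h.cre_comm]

lemma phi_add (h : IsFockSystem B W Ω) (k l : E) : h.phi (k + l) = h.phi k + h.phi l := by
  rw [phi, phi, phi, h.cre_add, h.ann_add]
  module

lemma phi_real_smul (h : IsFockSystem B W Ω) (r : ℝ) (k : E) :
    h.phi ((r : ℂ) • k) = (r : ℂ) • h.phi k := by
  rw [phi, phi, h.cre_smul, h.ann_smul, Complex.conj_ofReal]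
  module

/-- The vacuum as a finite-particle vector. -/
def vac (_ : IsFockSystem B W Ω) : 𝓓 := ⟨Ω, Submodule.subset_span ⟨[], rfl⟩⟩

lemma ann_vac (h : IsFockSystem B W Ω) (k : E) : h.ann k h.vac = 0 := by
  refine Subtype.ext <| h.annihilation_eq k h.vac _ fun g => ?_
  simp only [vac, h.inner_expVec_vacuum]
  simpa using hasDerivAt_const (0 : ℝ) (1 : ℂ)

lemma norm_cre_sq (h : IsFockSystem B W Ω) (k : E) (v : 𝓓) :
    ‖h.cre k v‖ ^ 2 = ‖h.ann k v‖ ^ 2 + (B k k).re * ‖v‖ ^ 2 := by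
  have h1 : ⟪(h.cre k v : K), (h.cre k v : K)⟫_ℂ =
      ⟪(h.ann k v : K), (h.ann k v : K)⟫_ℂ + B k k * ⟪(v : K), (v : K)⟫_ℂ := by
    rw [h.inner_cre, ← Module.End.mul_apply, h.ann_mul_cre, LinearMap.add_apply, Submodule.coe_add,
      inner_add_right, Module.End.mul_apply, ← h.inner_ann, LinearMap.smul_apply,
      Submodule.coe_smul, inner_smul_right]
    rfl
  have hB : B k k = ((B k k).re : ℂ) := (Complex.conj_eq_iff_re.1 (h.form_conj k k)).symm
  rw [inner_self_eq_ofReal, inner_self_eq_ofReal, inner_self_eq_ofReal, hB] at h1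
  exact_mod_cast h1

/-- Induction through ‖a v‖² = ⟪v, a† a v⟫ ≤ ‖v‖ ‖a† a v‖, the commutation relation, and the bound
for a v, which has one particle fewer. Orthogonality of the particle sectors is not needed. -/
lemma norm_ann_sq_le (h : IsFockSystem B W Ω) (k : E) (N : ℕ) (v : 𝓓) (hv : (v : K) ∈ deg (N + 1)) :
    ‖h.ann k v‖ ^ 2 ≤ N * (B k k).re * ‖v‖ ^ 2 := by
  have hr := h.form_nonneg k
  induction N generalizing v with
  | zero =>
    have h1 := (h.annihilation_spec k hv).1
    rw [degLT_zero, Submodule.mem_bot] at h1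
    have : h.ann k v = 0 := Subtype.ext h1
    simp [this]
  | succ N ih =>
    set w := h.ann k v with hw
    have hw1 : (w : K) ∈ deg (N + 1) := (h.annihilation_spec k hv).1
    have h1 := ih w hw1
    have h2 : ‖h.cre k w‖ ^ 2 ≤ (N + 1 : ℕ) * (B k k).re * ‖w‖ ^ 2 := by
      rw [h.norm_cre_sq]; push_cast; linarith
    have h3 : ‖w‖ ^ 2 ≤ ‖v‖ * ‖h.cre k w‖ := by
      have h4 : ⟪(w : K), (w : K)⟫_ℂ = ⟪(v : K), (h.cre k w : K)⟫_ℂ := by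
        conv_lhs => rw [hw]
        rw [h.inner_ann]
      have h5 := norm_inner_le_norm (𝕜 := ℂ) (v : K) (h.cre k w : K)
      rw [← h4, inner_self_eq_norm_sq_to_K, norm_pow] at h5
      simpa using h5
    rcases (norm_nonneg w).eq_or_lt with h0 | h0
    · rw [← h0, zero_pow two_ne_zero]; positivity
    · have h6 : (‖w‖ ^ 2) ^ 2 ≤ ‖v‖ ^ 2 * ((N + 1 : ℕ) * (B k k).re * ‖w‖ ^ 2) := by
        calc (‖w‖ ^ 2) ^ 2 ≤ (‖v‖ * ‖h.cre k w‖) ^ 2 := by gcongr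
          _ = ‖v‖ ^ 2 * ‖h.cre k w‖ ^ 2 := by ring
          _ ≤ _ := by gcongr
      have h7 : 0 < ‖w‖ ^ 2 := by positivity
      refine le_of_mul_le_mul_right ?_ h7
      linarith

lemma norm_ann_le (h : IsFockSystem B W Ω) (k : E) {N : ℕ} {v : 𝓓} (hv : (v : K) ∈ deg (N + 1)) :
    ‖h.ann k v‖ ≤ √(B k k).re * √(N + 1) * ‖v‖ := by
  have hr := h.form_nonneg k
  refine le_of_sq_le_sq ?_ (by positivity)
  rw [mul_pow, mul_pow, Real.sq_sqrt hr, Real.sq_sqrt (by positivity)]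
  have := h.norm_ann_sq_le k N v hv
  have h2 : 0 ≤ (B k k).re * ‖v‖ ^ 2 := by positivity
  linarith

lemma norm_cre_le (h : IsFockSystem B W Ω) (k : E) {N : ℕ} {v : 𝓓} (hv : (v : K) ∈ deg (N + 1)) :
    ‖h.cre k v‖ ≤ √(B k k).re * √(N + 1) * ‖v‖ := by
  have hr := h.form_nonneg k
  refine le_of_sq_le_sq ?_ (by positivity)
  rw [mul_pow, mul_pow, Real.sq_sqrt hr, Real.sq_sqrt (by positivity), h.norm_cre_sq]
  have := h.norm_ann_sq_le k N v hv
  linarith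

lemma ann_mem (h : IsFockSystem B W Ω) (k : E) {N : ℕ} {v : 𝓓} (hv : (v : K) ∈ deg (N + 1)) :
    (h.ann k v : K) ∈ deg N := (h.annihilation_spec k hv).1

lemma cre_mem (h : IsFockSystem B W Ω) (k : E) {N : ℕ} {v : 𝓓} (hv : (v : K) ∈ deg N) :
    (h.cre k v : K) ∈ deg (N + 1) := (h.creation_spec k hv).1

end IsFockSystem

/-! ### Number bounds, analytic vectors, and intertwining from fields to Weyl operators -/

section Bounded

variable {E K : Type*} [AddCommGroup E] [Module ℂ E] [NormedAddCommGroup K]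
  [InnerProductSpace ℂ K]

/-- The operator raises the particle number by at most `2` and is bounded linearly in it. -/
structure IsDegBounded (B : E →ₗ⋆[ℂ] E →ₗ[ℂ] ℂ) {W : E → K →L[ℂ] K} {Ω : K}
    (T : Module.End ℂ (finPart W Ω)) (κ : ℝ) : Prop where
  mem : ∀ (N : ℕ) (v : finPart W Ω), (v : K) ∈ degLT B W Ω (N + 1) →
    (T v : K) ∈ degLT B W Ω (N + 2 + 1)
  norm_le : ∀ (N : ℕ) (v : finPart W Ω), (v : K) ∈ degLT B W Ω (N + 1) →
    ‖T v‖ ≤ κ * (N + 1) * ‖v‖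

variable {B : E →ₗ⋆[ℂ] E →ₗ[ℂ] ℂ} {W : E → K →L[ℂ] K} {Ω : K} {T : Module.End ℂ (finPart W Ω)}
  {κ : ℝ}

lemma IsDegBounded.pow_mem (hT : IsDegBounded B T κ) {N : ℕ} {v : finPart W Ω}
    (hv : (v : K) ∈ degLT B W Ω (N + 1)) (n : ℕ) :
    ((T ^ n) v : K) ∈ degLT B W Ω (N + 2 * n + 1) := by
  induction n with
  | zero => simpa using hv
  | succ n ih =>
    rw [pow_succ', Module.End.mul_apply]
    exact hT.mem _ _ ih

/-- Since N + 2n + 1 ≤ 2(N + n + 1), the successive bounds multiply up to (2κ)ⁿ (N + n)!/N!. Only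
the prefactor depends on N, not the rate 4κ; this gives the uniform radius demanded by
`HasAnalyticVectors`. -/
lemma IsDegBounded.norm_pow_le (hT : IsDegBounded B T κ) (hκ : 0 ≤ κ) {N : ℕ} {v : finPart W Ω}
    (hv : (v : K) ∈ degLT B W Ω (N + 1)) (n : ℕ) :
    ‖(T ^ n) v‖ ≤ (2 ^ N * ‖v‖) * (4 * κ) ^ n * n.factorial := by
  have h1 : ‖(T ^ n) v‖ * N.factorial ≤ (2 * κ) ^ n * (N + n).factorial * ‖v‖ := by
    induction n with
    | zero => simp [mul_comm]
    | succ n ih =>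
      rw [pow_succ', Module.End.mul_apply]
      have h2 := hT.norm_le _ _ (hT.pow_mem hv n)
      calc ‖T ((T ^ n) v)‖ * N.factorial
          ≤ (κ * ((N + 2 * n : ℕ) + 1) * ‖(T ^ n) v‖) * N.factorial := by gcongr
        _ = κ * ((N + 2 * n : ℕ) + 1) * (‖(T ^ n) v‖ * N.factorial) := by ring
        _ ≤ κ * (2 * (N + n + 1)) * ((2 * κ) ^ n * (N + n).factorial * ‖v‖) := by
            gcongr
            push_cast
            have : (0 : ℝ) ≤ N := Nat.cast_nonneg _
            linarith
        _ = _ := by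
            rw [← add_assoc, Nat.factorial_succ, pow_succ]; push_cast; ring
  have hN : (0 : ℝ) < N.factorial := by positivity
  refine le_of_mul_le_mul_right (h1.trans ?_) hN
  calc (2 * κ) ^ n * (N + n).factorial * ‖v‖
      ≤ (2 * κ) ^ n * (2 ^ (N + n) * (N.factorial * n.factorial)) * ‖v‖ := by
        gcongr
        exact factorial_add_le N n
    _ = _ := by
        have : (4 : ℝ) ^ n = 2 ^ n * 2 ^ n := by rw [← mul_pow]; norm_num
        rw [mul_pow, mul_pow, this, pow_add]; ring

lemma IsDegBounded.mono (hT : IsDegBounded B T κ) {κ' : ℝ} (h : κ ≤ κ') : IsDegBounded B T κ' :=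
  ⟨hT.mem, fun N v hv => (hT.norm_le N v hv).trans (by gcongr)⟩

lemma IsDegBounded.hasAnalyticVectors [CompleteSpace K] (hT : IsDegBounded B T κ) (hκ : 0 ≤ κ)
    (h : IsFockSystem B W Ω) : HasAnalyticVectors T (4 * κ) := fun v => by
  obtain ⟨N, hN⟩ := h.mem_finPart_iff.1 v.2
  exact ⟨_, hT.norm_pow_le hκ hN⟩

end Bounded

lemma norm_unitary_apply {K : Type*} [NormedAddCommGroup K] [InnerProductSpace ℂ K]
    [CompleteSpace K] (V : unitary (K →L[ℂ] K)) (x : K) : ‖(V : K →L[ℂ] K) x‖ = ‖x‖ :=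
  (V : K →L[ℂ] K).norm_map_iff_adjoint_comp_self.2 (Unitary.mem_iff.1 V.2).1 x

lemma inner_unitary_apply {K : Type*} [NormedAddCommGroup K] [InnerProductSpace ℂ K]
    [CompleteSpace K] (V : unitary (K →L[ℂ] K)) (x y : K) :
    ⟪(V : K →L[ℂ] K) x, (V : K →L[ℂ] K) y⟫_ℂ = ⟪x, y⟫_ℂ :=
  (V : K →L[ℂ] K).inner_map_map_iff_adjoint_comp_self.2 (Unitary.mem_iff.1 V.2).1 x y

namespace IsFockSystem

open Filter Topology

variable {E K : Type*} [AddCommGroup E] [Module ℂ E] [NormedAddCommGroup K]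
  [InnerProductSpace ℂ K] {B : E →ₗ⋆[ℂ] E →ₗ[ℂ] ℂ} {W : E → K →L[ℂ] K} {Ω : K}

local notation "e" => expVec B W Ω
local notation "deg" => degLT B W Ω
local notation "𝓓" => finPart W Ω

variable [CompleteSpace K]

lemma isDegBounded_iphi (h : IsFockSystem B W Ω) (k : E) :
    IsDegBounded B (Complex.I • h.phi k) (2 * √(B k k).re) := by
  refine ⟨fun N v hv => ?_, fun N v hv => ?_⟩
  · have h1 : ((h.cre k v : 𝓓) : K) ∈ deg (N + 2 + 1) := degLT_mono (by omega) (h.cre_mem k hv)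
    have h2 : ((h.ann k v : 𝓓) : K) ∈ deg (N + 2 + 1) := degLT_mono (by omega) (h.ann_mem k hv)
    exact Submodule.smul_mem _ _ (Submodule.smul_mem _ _ (add_mem h1 h2))
  · have h1 := h.norm_cre_le k hv
    have h2 := h.norm_ann_le k hv
    have h3 : ‖((1 / √2 : ℝ) : ℂ)‖ ≤ 1 := by
      rw [Complex.norm_real, Real.norm_eq_abs, abs_of_nonneg (by positivity),
        div_le_one (by positivity)]
      exact Real.one_le_sqrt.2 (by norm_num)
    have h4 : √((N : ℝ) + 1) ≤ N + 1 := by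
      rw [Real.sqrt_le_left (by positivity)]
      have : (0 : ℝ) ≤ N := Nat.cast_nonneg _
      nlinarith
    rw [LinearMap.smul_apply, norm_smul, Complex.norm_I, one_mul, phi, LinearMap.smul_apply,
      norm_smul, LinearMap.add_apply]
    calc ‖((1 / √2 : ℝ) : ℂ)‖ * ‖h.cre k v + h.ann k v‖
        ≤ 1 * (√(B k k).re * √(N + 1) * ‖v‖ + √(B k k).re * √(N + 1) * ‖v‖) := by
          gcongr
          exact (norm_add_le _ _).trans (add_le_add h1 h2)
      _ = 2 * √(B k k).re * √(N + 1) * ‖v‖ := by ring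
      _ ≤ 2 * √(B k k).re * (N + 1) * ‖v‖ := by gcongr

lemma analytic_iphi (h : IsFockSystem B W Ω) (k : E) :
    ∃ c > 0, HasAnalyticVectors (Complex.I • h.phi k) c :=
  ⟨4 * (2 * √(B k k).re + 1), by positivity,
    ((h.isDegBounded_iphi k).mono (by linarith)).hasAnalyticVectors (by positivity) h⟩

lemma hasDerivAt_weyl_iphi (h : IsFockSystem B W Ω) (k : E) (v : 𝓓) (t : ℝ) :
    HasDerivAt (fun t : ℝ => W ((t : ℂ) • k) v)
      (W ((t : ℂ) • k) ((Complex.I • h.phi k) v : 𝓓)) t :=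
  hasDerivAt_of_group (V := fun t : ℝ => W ((t : ℂ) • k)) (h.weyl_add_smul k) (h.hasDerivAt_phi k v) t

/-- For y orthogonal to all finite-particle vectors, ⟪y, W(tk)Ω⟫ has all derivatives zero at t = 0
and analytic growth, hence vanishes. So y is orthogonal to the total set of vectors W(k)Ω. -/
lemma dense_finPart (h : IsFockSystem B W Ω) : Dense (𝓓 : Set K) := by
  rw [Submodule.dense_iff_topologicalClosure_eq_top, Submodule.topologicalClosure_eq_top_iff,
    Submodule.eq_bot_iff]
  intro y hy
  have hy' : ∀ v : 𝓓, ⟪y, (v : K)⟫_ℂ = 0 := fun v => (Submodule.mem_orthogonal' _ _).1 hy v v.2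
  have hW : ∀ k, ⟪y, W k Ω⟫_ℂ = 0 := by
    intro k
    obtain ⟨c, hc, hA⟩ := h.analytic_iphi k
    obtain ⟨C, hC⟩ := hA h.vac
    have := eq_zero_of_hasDerivAt_chain (c := c) (f := fun n (t : ℝ) =>
      ⟪y, W ((t : ℂ) • k) (((Complex.I • h.phi k) ^ n) h.vac : 𝓓)⟫_ℂ) ?_ hc ?_ ?_ 1 0
    · simpa [vac] using this
    · intro n t
      have h1 := (hasDerivAt_const t y).inner ℂ
        (h.hasDerivAt_weyl_iphi k (((Complex.I • h.phi k) ^ n) h.vac) t)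
      rw [inner_zero_left, add_zero, ← Module.End.mul_apply, ← pow_succ'] at h1
      exact h1
    · refine fun R => ⟨‖y‖ * C, fun n t _ => (norm_inner_le_norm _ _).trans ?_⟩
      rw [h.norm_weyl, mul_assoc, mul_assoc, ← mul_assoc C]
      gcongr
      exact hC n
    · intro n
      simp [h.weyl_zero_op, hy']
  refine h.ext_inner fun g => ?_
  rw [expVec, inner_smul_left, inner_zero_right, ← inner_conj_symm, hW]
  simp

/-- An operator intertwining two fields weakly intertwines the Weyl operators. -/
lemma intertwines_weyl (h : IsFockSystem B W Ω) {V : K →L[ℂ] K} {p p' : E}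
    (hV : ∀ v w : 𝓓, ⟪(w : K), V (h.phi p v : 𝓓)⟫_ℂ = ⟪((h.phi p' w : 𝓓) : K), V v⟫_ℂ) :
    V * W p = W p' * V := by
  have hpow : ∀ (n : ℕ) (v w : 𝓓), ⟪(w : K), V (((Complex.I • h.phi p) ^ n) v : 𝓓)⟫_ℂ =
      ⟪((((Complex.I • h.phi (-p')) ^ n) w : 𝓓) : K), V v⟫_ℂ := by
    have h1 : h.phi (-p') = -h.phi p' := by
      have := h.phi_real_smul (-1) p'
      rw [Complex.ofReal_neg, Complex.ofReal_one, neg_one_smul ℂ p'] at this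
      refine this.trans (LinearMap.ext fun v => ?_)
      rw [LinearMap.smul_apply, LinearMap.neg_apply]
      exact neg_one_smul ℂ _
    intro n
    induction n with
    | zero => simp
    | succ n ih =>
      intro v w
      rw [pow_succ, Module.End.mul_apply, ih, pow_succ', Module.End.mul_apply, h1]
      rw [LinearMap.smul_apply, Submodule.coe_smul, map_smul, inner_smul_right, hV,
        LinearMap.smul_apply, Submodule.coe_smul, LinearMap.neg_apply, Submodule.coe_neg,
        inner_smul_left, inner_neg_left, Complex.conj_I]
      ring
  obtain ⟨c, hc, hA⟩ := h.analytic_iphi p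
  obtain ⟨c', hc', hA'⟩ := h.analytic_iphi (-p')
  -- V v need not lie in the domain of a field, so W(p') is carried by the finite-particle vector w,
  -- as W(-p') in the left slot.
  have key : ∀ v w : 𝓓, ⟪(w : K), V (W p v)⟫_ℂ = ⟪(w : K), W p' (V v)⟫_ℂ := by
    intro v w
    obtain ⟨C, hC⟩ := hA v
    obtain ⟨C', hC'⟩ := hA' w
    have hC0 : 0 ≤ C := by simpa using (norm_nonneg _).trans (hC 0)
    have hC0' : 0 ≤ C' := by simpa using (norm_nonneg _).trans (hC' 0)
    have := eq_zero_of_hasDerivAt_chain (c := max c c') (f := fun n (t : ℝ) =>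
      ⟪(w : K), V (W ((t : ℂ) • p) (((Complex.I • h.phi p) ^ n) v : 𝓓))⟫_ℂ -
      ⟪W ((t : ℂ) • (-p')) (((Complex.I • h.phi (-p')) ^ n) w : 𝓓), V v⟫_ℂ)
      ?_ (lt_max_of_lt_left hc) ?_ ?_ 1 0
    · rw [Complex.ofReal_one, one_smul, one_smul, pow_zero, pow_zero, Module.End.one_apply,
        Module.End.one_apply, sub_eq_zero, h.inner_weyl_left, neg_neg] at this
      exact this
    · intro n t
      have h1 := (hasDerivAt_const t (w : K)).inner ℂ ((V.restrictScalars ℝ).hasFDerivAt.comp_hasDerivAt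
        t (h.hasDerivAt_weyl_iphi p (((Complex.I • h.phi p) ^ n) v) t))
      have h2 := (h.hasDerivAt_weyl_iphi (-p') (((Complex.I • h.phi (-p')) ^ n) w) t).inner ℂ
        (hasDerivAt_const t (V v))
      rw [inner_zero_left, add_zero, ← Module.End.mul_apply, ← pow_succ'] at h1
      rw [inner_zero_right, zero_add, ← Module.End.mul_apply, ← pow_succ'] at h2
      exact h1.sub h2
    · refine fun R => ⟨‖(w : K)‖ * ‖V‖ * C + ‖V v‖ * C', fun n t _ => (norm_sub_le _ _).trans ?_⟩
      have a1 : ‖⟪(w : K), V (W ((t : ℂ) • p) (((Complex.I • h.phi p) ^ n) v : 𝓓))⟫_ℂ‖ ≤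
          ‖(w : K)‖ * (‖V‖ * (C * max c c' ^ n * n.factorial)) := by
        refine (norm_inner_le_norm _ _).trans ?_
        gcongr
        refine (V.le_opNorm _).trans ?_
        rw [h.norm_weyl]
        gcongr
        refine (hC n).trans ?_
        gcongr
        exact le_max_left _ _
      have a2 : ‖⟪W ((t : ℂ) • (-p')) (((Complex.I • h.phi (-p')) ^ n) w : 𝓓), V v⟫_ℂ‖ ≤
          (C' * max c c' ^ n * n.factorial) * ‖V v‖ := by
        refine (norm_inner_le_norm _ _).trans ?_
        rw [h.norm_weyl]
        gcongr
        refine (hC' n).trans ?_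
        gcongr
        exact le_max_right _ _
      refine (add_le_add a1 a2).trans (le_of_eq (by ring))
    · intro n
      simp only [Complex.ofReal_zero, zero_smul, h.weyl_zero_op, one_apply_eq_self]
      rw [hpow, sub_self]
  refine ContinuousLinearMap.ext fun x => ?_
  refine congrFun (Continuous.ext_on h.dense_finPart (V * W p).continuous (W p' * V).continuous
    fun v hv => ?_) x
  refine h.dense_finPart.eq_of_inner_right (𝕜 := ℂ) fun w hw => ?_
  exact key ⟨v, hv⟩ ⟨w, hw⟩

/-! ### Two-mode squeezing -/

/-- The two-mode pair operator on finite-particle vectors. -/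
noncomputable def pair (h : IsFockSystem B W Ω) (ψ₁ ψ₂ : E) (b : ℂ) : Module.End ℂ 𝓓 :=
  b • (h.cre ψ₁ * h.cre ψ₂) - conj b • (h.ann ψ₂ * h.ann ψ₁)

lemma inner_pair (h : IsFockSystem B W Ω) (ψ₁ ψ₂ : E) (b : ℂ) (v w : 𝓓) :
    ⟪((h.pair ψ₁ ψ₂ b v : 𝓓) : K), (w : K)⟫_ℂ = -⟪(v : K), (h.pair ψ₁ ψ₂ b w : 𝓓)⟫_ℂ := by
  simp only [pair, LinearMap.sub_apply, LinearMap.smul_apply, Module.End.mul_apply,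
    Submodule.coe_sub, Submodule.coe_smul, inner_sub_left, inner_sub_right, inner_smul_left,
    inner_smul_right, h.inner_cre, h.inner_ann, Complex.conj_conj]
  ring

/-- Each operator costs √(N + 1), the second creation at most 2√(N + 1) because the degree has
grown. The two pairs together cost 3‖b‖(N + 1), which 4‖b‖ covers. -/
lemma isDegBounded_pair (h : IsFockSystem B W Ω) {ψ₁ ψ₂ : E} (h₁ : B ψ₁ ψ₁ = 1) (h₂ : B ψ₂ ψ₂ = 1)
    (b : ℂ) : IsDegBounded B (h.pair ψ₁ ψ₂ b) (4 * ‖b‖) := by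
  have q₁ : √(B ψ₁ ψ₁).re = 1 := by simp [h₁]
  have q₂ : √(B ψ₂ ψ₂).re = 1 := by simp [h₂]
  refine ⟨fun N v hv => ?_, fun N v hv => ?_⟩
  · have a1 : ((h.cre ψ₁ (h.cre ψ₂ v) : 𝓓) : K) ∈ deg (N + 2 + 1) :=
      degLT_mono (by omega) (h.cre_mem _ (h.cre_mem _ hv))
    have a2 : ((h.ann ψ₂ (h.ann ψ₁ v) : 𝓓) : K) ∈ deg (N + 2 + 1) :=
      degLT_mono (by omega) (h.ann_mem ψ₂ (degLT_mono (Nat.le_succ N) (h.ann_mem ψ₁ hv)))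
    exact sub_mem (Submodule.smul_mem _ _ a1) (Submodule.smul_mem _ _ a2)
  · have hN : (0 : ℝ) ≤ N := Nat.cast_nonneg _
    have c1 := h.norm_cre_le ψ₂ hv
    have c2 := h.norm_cre_le ψ₁ (h.cre_mem ψ₂ hv)
    have d1 := h.norm_ann_le ψ₁ hv
    have d2 := h.norm_ann_le ψ₂ (degLT_mono (Nat.le_succ N) (h.ann_mem ψ₁ hv))
    rw [q₂, one_mul] at c1 d2
    rw [q₁, one_mul] at c2 d1
    have s1 : √((N : ℝ) + 1) * √((N : ℝ) + 1) = N + 1 := Real.mul_self_sqrt (by positivity)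
    have s2 : √(((N + 1 : ℕ) : ℝ) + 1) ≤ 2 * √((N : ℝ) + 1) := by
      rw [Real.sqrt_le_left (by positivity), mul_pow, Real.sq_sqrt (by positivity)]
      push_cast; linarith
    have c3 : ‖h.cre ψ₁ (h.cre ψ₂ v)‖ ≤ 2 * (N + 1) * ‖v‖ := by
      calc _ ≤ (2 * √((N : ℝ) + 1)) * (√((N : ℝ) + 1) * ‖v‖) := c2.trans (by gcongr)
        _ = 2 * (√((N : ℝ) + 1) * √((N : ℝ) + 1)) * ‖v‖ := by ring
        _ = _ := by rw [s1]
    have d3 : ‖h.ann ψ₂ (h.ann ψ₁ v)‖ ≤ (N + 1) * ‖v‖ := by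
      calc _ ≤ √((N : ℝ) + 1) * (√((N : ℝ) + 1) * ‖v‖) := d2.trans (by gcongr)
        _ = (√((N : ℝ) + 1) * √((N : ℝ) + 1)) * ‖v‖ := by ring
        _ = _ := by rw [s1]
    calc ‖h.pair ψ₁ ψ₂ b v‖ ≤ ‖b‖ * (2 * (N + 1) * ‖v‖) + ‖b‖ * ((N + 1) * ‖v‖) := by
          refine (norm_sub_le _ _).trans ?_
          rw [LinearMap.smul_apply, LinearMap.smul_apply, norm_smul, norm_smul, RCLike.norm_conj,
            Module.End.mul_apply, Module.End.mul_apply]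
          gcongr
      _ ≤ 4 * ‖b‖ * (N + 1) * ‖v‖ := by
          have : 0 ≤ ‖b‖ * ((N + 1) * ‖v‖) := by positivity
          linarith

lemma analytic_pair (h : IsFockSystem B W Ω) {ψ₁ ψ₂ : E} (h₁ : B ψ₁ ψ₁ = 1) (h₂ : B ψ₂ ψ₂ = 1)
    (b : ℂ) : HasAnalyticVectors (h.pair ψ₁ ψ₂ b) (4 * (4 * ‖b‖ + 1)) :=
  ((h.isDegBounded_pair h₁ h₂ b).mono (by linarith)).hasAnalyticVectors (by positivity) h

/-- The linear map `(C, S) ↦` two-mode squeezing of test functions. -/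
def squeeze (B : E →ₗ⋆[ℂ] E →ₗ[ℂ] ℂ) (ψ₁ ψ₂ : E) (c : ℂ) (C S : ℝ) (p : E) : E :=
  p + (((C : ℂ) - 1) * B ψ₁ p - c * S * conj (B ψ₂ p)) • ψ₁ +
    (((C : ℂ) - 1) * B ψ₂ p - c * S * conj (B ψ₁ p)) • ψ₂

/-- The commutator of a quadratic with a linear expression in creators and annihilators is linear.
It is a field again, with a test function real-linear in q: the infinitesimal squeezing. -/
lemma pair_mul_phi (h : IsFockSystem B W Ω) (ψ₁ ψ₂ : E) (b : ℂ) (q : E) :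
    h.pair ψ₁ ψ₂ b * h.phi q = h.phi q * h.pair ψ₁ ψ₂ b -
      h.phi (b • (conj (B ψ₂ q) • ψ₁ + conj (B ψ₁ q) • ψ₂)) := by
  have e1 : h.ann ψ₂ * h.ann ψ₁ * h.cre q = h.cre q * (h.ann ψ₂ * h.ann ψ₁) +
      B ψ₁ q • h.ann ψ₂ + B ψ₂ q • h.ann ψ₁ := by
    rw [mul_assoc, h.ann_mul_cre, mul_add, ← mul_assoc, h.ann_mul_cre]
    simp only [add_mul, mul_assoc, mul_smul_comm, smul_mul_assoc, mul_one, one_mul]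
    abel
  have e2 : h.ann q * (h.cre ψ₁ * h.cre ψ₂) = h.cre ψ₁ * h.cre ψ₂ * h.ann q +
      B q ψ₁ • h.cre ψ₂ + B q ψ₂ • h.cre ψ₁ := by
    rw [← mul_assoc, h.ann_mul_cre, add_mul, mul_assoc, h.ann_mul_cre]
    simp only [mul_add, mul_assoc, mul_smul_comm, smul_mul_assoc, mul_one, one_mul]
    abel
  have e3 : h.ann ψ₂ * h.ann ψ₁ * h.ann q = h.ann q * (h.ann ψ₂ * h.ann ψ₁) := by
    rw [mul_assoc, h.ann_comm ψ₁ q, ← mul_assoc, h.ann_comm ψ₂ q, mul_assoc]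
  have e4 : h.cre ψ₁ * h.cre ψ₂ * h.cre q = h.cre q * (h.cre ψ₁ * h.cre ψ₂) := by
    rw [mul_assoc, h.cre_comm ψ₂ q, ← mul_assoc, h.cre_comm ψ₁ q, mul_assoc]
  simp only [pair, phi, mul_smul_comm, smul_mul_assoc, sub_mul, mul_sub, add_mul, mul_add, e1,
    e2, e3, e4, h.cre_smul, h.cre_add, h.ann_smul, h.ann_add, h.form_conj]
  simp only [smul_add, smul_sub]
  module

end IsFockSystem

namespace IsFockSystem

open Filter Topology

variable {E K : Type*} [AddCommGroup E] [Module ℂ E] [NormedAddCommGroup K]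
  [InnerProductSpace ℂ K] {B : E →ₗ⋆[ℂ] E →ₗ[ℂ] ℂ} {W : E → K →L[ℂ] K} {Ω : K}

local notation "deg" => degLT B W Ω
local notation "𝓓" => finPart W Ω

/-- The test-function data of two-mode squeezing: two orthonormal modes. -/
structure IsModePair (B : E →ₗ⋆[ℂ] E →ₗ[ℂ] ℂ) (ψ₁ ψ₂ : E) : Prop where
  one_one : B ψ₁ ψ₁ = 1
  two_two : B ψ₂ ψ₂ = 1
  one_two : B ψ₁ ψ₂ = 0
  two_one : B ψ₂ ψ₁ = 0

lemma squeeze_squeeze {ψ₁ ψ₂ : E} (hψ : IsModePair B ψ₁ ψ₂) {c : ℂ} (hc : c * conj c = 1) {C S : ℝ}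
    (hCS : C ^ 2 - S ^ 2 = 1) (p : E) :
    squeeze B ψ₁ ψ₂ c C (-S) (squeeze B ψ₁ ψ₂ c C S p) = p := by
  have hCS' : (C : ℂ) ^ 2 - (S : ℂ) ^ 2 = 1 := by exact_mod_cast hCS
  simp only [squeeze, map_add, map_smul, smul_eq_mul, hψ.one_one, hψ.two_two, hψ.one_two,
    hψ.two_one, mul_one, mul_zero, add_zero, map_sub, map_mul, Complex.conj_conj,
    Complex.conj_ofReal, map_one, Complex.ofReal_neg]
  match_scalars
  · simp
  · simp
    linear_combination (B ψ₁ p) * hCS' - S ^ 2 * B ψ₁ p * hc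
  · simp
    linear_combination (B ψ₂ p) * hCS' - S ^ 2 * B ψ₂ p * hc

variable [CompleteSpace K]

/-- The unitary group generated by the pair operator. -/
structure IsPairGroup (h : IsFockSystem B W Ω) (ψ₁ ψ₂ : E) (b : ℂ)
    (U : ℝ → unitary (K →L[ℂ] K)) : Prop where
  map_add : ∀ s t, U (s + t) = U s * U t
  generator : ∀ v : 𝓓, HasDerivAt (fun t => (U t : K →L[ℂ] K) v) ((h.pair ψ₁ ψ₂ b v : 𝓓) : K) 0

variable {ψ₁ ψ₂ : E} {b : ℂ} {U : ℝ → unitary (K →L[ℂ] K)}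

/-- On Aⁿ v a field costs a multiple of N + 2n + 1 ≤ 2(N + 1) 2ⁿ; the factor 2ⁿ is absorbed by
doubling the rate from 4 to 8. -/
lemma norm_phi_pow_pair_le (h : IsFockSystem B W Ω) (hψ : IsModePair B ψ₁ ψ₂) (b : ℂ) (q : E)
    (v : 𝓓) : ∃ M, 0 ≤ M ∧ ∀ n : ℕ, ‖h.phi q (((h.pair ψ₁ ψ₂ b) ^ n) v)‖ ≤
      M * (8 * (4 * ‖b‖ + 1)) ^ n * n.factorial := by
  have hT := (h.isDegBounded_pair hψ.one_one hψ.two_two b).mono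
    (show 4 * ‖b‖ ≤ 4 * ‖b‖ + 1 by linarith)
  obtain ⟨N, hN⟩ := h.mem_finPart_iff.1 v.2
  refine ⟨2 * √(B q q).re * (2 * (N + 1)) * (2 ^ N * ‖v‖), by positivity, fun n => ?_⟩
  have h1 := (h.isDegBounded_iphi q).norm_le _ _ (hT.pow_mem hN n)
  rw [LinearMap.smul_apply, norm_smul, Complex.norm_I, one_mul] at h1
  have h2 := hT.norm_pow_le (by positivity) hN n
  have h3 : ((N + 2 * n : ℕ) : ℝ) + 1 ≤ 2 * (N + 1) * 2 ^ n := by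
    have a1 : (n : ℝ) + 1 ≤ 2 ^ n := by exact_mod_cast Nat.lt_two_pow_self
    have hN : (0 : ℝ) ≤ N := Nat.cast_nonneg _
    have hn : (0 : ℝ) ≤ n := Nat.cast_nonneg _
    push_cast
    nlinarith [mul_nonneg hN hn]
  calc _ ≤ 2 * √(B q q).re * (((N + 2 * n : ℕ) : ℝ) + 1) * ‖((h.pair ψ₁ ψ₂ b) ^ n) v‖ := h1
    _ ≤ 2 * √(B q q).re * (2 * (N + 1) * 2 ^ n) *
        ((2 ^ N * ‖v‖) * (4 * (4 * ‖b‖ + 1)) ^ n * n.factorial) := by gcongr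
    _ = _ := by
        have : (8 * (4 * ‖b‖ + 1)) ^ n = 2 ^ n * (4 * (4 * ‖b‖ + 1)) ^ n := by
          rw [← mul_pow]; ring
        rw [this]; ring

lemma pairGroup_zero (h : IsFockSystem B W Ω) (hU : IsPairGroup h ψ₁ ψ₂ b U) : U 0 = 1 := by
  have := hU.map_add 0 0
  rw [add_zero] at this
  exact left_eq_mul.1 this

lemma pairGroup_hasDerivAt (h : IsFockSystem B W Ω) (hU : IsPairGroup h ψ₁ ψ₂ b U) (v : 𝓓)
    (t : ℝ) : HasDerivAt (fun t => (U t : K →L[ℂ] K) v)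
      ((U t : K →L[ℂ] K) (h.pair ψ₁ ψ₂ b v : 𝓓)) t :=
  hasDerivAt_of_group (V := fun t => (U t : K →L[ℂ] K))
    (fun s t => congrArg Subtype.val (hU.map_add s t)) (hU.generator v) t

/-- The squeezed test functions along the group. -/
noncomputable def squeezeFlow (B : E →ₗ⋆[ℂ] E →ₗ[ℂ] ℂ) (ψ₁ ψ₂ : E) (b : ℂ) (t : ℝ) (p : E) : E :=
  squeeze B ψ₁ ψ₂ (phase b) (Real.cosh (‖b‖ * t)) (Real.sinh (‖b‖ * t)) p

end IsFockSystem

lemma phase_mul_conj (b : ℂ) : phase b * conj (phase b) = 1 := by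
  rw [phase, ← Complex.exp_conj, ← Complex.exp_add]
  simp

lemma norm_mul_phase (b : ℂ) : (‖b‖ : ℂ) * phase b = b := Complex.norm_mul_exp_arg_mul_I b

namespace IsFockSystem

open Filter Topology

variable {E K : Type*} [AddCommGroup E] [Module ℂ E] [NormedAddCommGroup K]
  [InnerProductSpace ℂ K] {B : E →ₗ⋆[ℂ] E →ₗ[ℂ] ℂ} {W : E → K →L[ℂ] K} {Ω : K}

local notation "deg" => degLT B W Ω
local notation "𝓓" => finPart W Ω

variable [CompleteSpace K] {ψ₁ ψ₂ : E} {b : ℂ} {U : ℝ → unitary (K →L[ℂ] K)}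

lemma phi_squeeze (h : IsFockSystem B W Ω) (c : ℂ) (C S : ℝ) (q : E) :
    h.phi (squeeze B ψ₁ ψ₂ c C S q) = h.phi q +
      ((C - 1 : ℝ) : ℂ) • h.phi (B ψ₁ q • ψ₁ + B ψ₂ q • ψ₂) -
      (S : ℂ) • h.phi (c • (conj (B ψ₂ q) • ψ₁ + conj (B ψ₁ q) • ψ₂)) := by
  have h1 : squeeze B ψ₁ ψ₂ c C S q = q + (((C - 1 : ℝ) : ℂ) • (B ψ₁ q • ψ₁ + B ψ₂ q • ψ₂) +
      ((-S : ℝ) : ℂ) • (c • (conj (B ψ₂ q) • ψ₁ + conj (B ψ₁ q) • ψ₂))) := by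
    simp only [squeeze]
    push_cast
    module
  rw [h1, h.phi_add, h.phi_add, h.phi_real_smul, h.phi_real_smul]
  push_cast
  module

/-- The squeezing group transforms the fields by the squeezing of test functions. -/
lemma pairGroup_phi_aux (h : IsFockSystem B W Ω) (hψ : IsModePair B ψ₁ ψ₂)
    (hU : IsPairGroup h ψ₁ ψ₂ b U) (q : E) (v w : 𝓓) (t : ℝ) :
    ⟪(w : K), (U t : K →L[ℂ] K)
      (h.phi (squeeze B ψ₁ ψ₂ (phase b) (Real.cosh (‖b‖ * t)) (-Real.sinh (‖b‖ * t)) q) v : 𝓓)⟫_ℂ =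
      ⟪((h.phi q w : 𝓓) : K), (U t : K →L[ℂ] K) v⟫_ℂ := by
  -- P is the part of q in the two modes and Q its conjugate-linear swap. The commutator with A
  -- sends Φ(q) and Φ(P) to -‖b‖ Φ(Q) and Φ(Q) to -‖b‖ Φ(P), a closed system solved by cosh and
  -- sinh.
  set P : E := B ψ₁ q • ψ₁ + B ψ₂ q • ψ₂ with hP
  set Q : E := phase b • (conj (B ψ₂ q) • ψ₁ + conj (B ψ₁ q) • ψ₂) with hQ
  set A := h.pair ψ₁ ψ₂ b with hA
  have hc := phase_mul_conj b
  have cq : ∀ x y : E, b • (conj (B ψ₂ x) • ψ₁ + conj (B ψ₁ x) • ψ₂) = (‖b‖ : ℂ) • y →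
      A * h.phi x = h.phi x * A - (‖b‖ : ℂ) • h.phi y := by
    intro x y hxy
    rw [hA, h.pair_mul_phi, hxy, h.phi_real_smul]
  have c0 : A * h.phi q = h.phi q * A - (‖b‖ : ℂ) • h.phi Q := by
    refine cq _ _ ?_
    conv_lhs => rw [← norm_mul_phase b]
    rw [hQ, mul_smul]
  have cP : A * h.phi P = h.phi P * A - (‖b‖ : ℂ) • h.phi Q := by
    refine cq _ _ ?_
    conv_lhs => rw [← norm_mul_phase b]
    rw [hQ, mul_smul]
    congr 2
    simp [hP, hψ.one_one, hψ.two_two, hψ.one_two, hψ.two_one]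
  have cQ : A * h.phi Q = h.phi Q * A - (‖b‖ : ℂ) • h.phi P := by
    refine cq _ _ ?_
    conv_lhs => rw [← norm_mul_phase b]
    rw [hP, mul_smul]
    congr 1
    simp only [hQ, map_smul, map_add, smul_eq_mul, hψ.one_one, hψ.two_two, hψ.one_two, hψ.two_one,
      mul_one, mul_zero, add_zero, zero_add, map_mul, Complex.conj_conj]
    match_scalars
    · linear_combination (B ψ₁ q) * hc
    · linear_combination (B ψ₂ q) * hc
  -- This compares U(t) Φ(q squeezed by -t) with Φ(q) U(t) between w and Aⁿ v. The derivatives of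
  -- cosh and sinh cancel the commutators, so differentiation merely raises n.
  set f : ℕ → ℝ → ℂ := fun n t =>
    ⟪(w : K), (U t : K →L[ℂ] K) (h.phi q ((A ^ n) v) : 𝓓)⟫_ℂ +
    ((Real.cosh (‖b‖ * t) - 1 : ℝ) : ℂ) * ⟪(w : K), (U t : K →L[ℂ] K) (h.phi P ((A ^ n) v) : 𝓓)⟫_ℂ +
    ((Real.sinh (‖b‖ * t) : ℝ) : ℂ) * ⟪(w : K), (U t : K →L[ℂ] K) (h.phi Q ((A ^ n) v) : 𝓓)⟫_ℂ -
    ⟪((h.phi q w : 𝓓) : K), (U t : K →L[ℂ] K) ((A ^ n) v : 𝓓)⟫_ℂ with hf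
  have hin : ∀ (x y : 𝓓) (t : ℝ), HasDerivAt (fun t => ⟪(x : K), (U t : K →L[ℂ] K) y⟫_ℂ)
      ⟪(x : K), (U t : K →L[ℂ] K) (A y : 𝓓)⟫_ℂ t := by
    intro x y t
    have := (hasDerivAt_const t (x : K)).inner ℂ (h.pairGroup_hasDerivAt hU y t)
    rwa [inner_zero_left, add_zero] at this
  have key := eq_zero_of_hasDerivAt_chain (f := f) (c := 8 * (4 * ‖b‖ + 1)) ?_ (by positivity)
    ?_ ?_ t 0
  · rw [h.phi_squeeze, ← hP, ← hQ]
    simp only [hf, pow_zero, Module.End.one_apply] at key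
    rw [LinearMap.sub_apply, LinearMap.add_apply, LinearMap.smul_apply, LinearMap.smul_apply,
      Submodule.coe_sub, Submodule.coe_add, Submodule.coe_smul, Submodule.coe_smul, map_sub,
      map_add, map_smul, map_smul, inner_sub_right, inner_add_right, inner_smul_right,
      inner_smul_right]
    push_cast at key ⊢
    linear_combination key
  · intro n t
    have hlin : HasDerivAt (fun t : ℝ => ‖b‖ * t) ‖b‖ t := by
      simpa using (hasDerivAt_id t).const_mul ‖b‖
    have hC : HasDerivAt (fun t : ℝ => ((Real.cosh (‖b‖ * t) - 1 : ℝ) : ℂ))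
        ((Real.sinh (‖b‖ * t) * ‖b‖ : ℝ) : ℂ) t := (hlin.cosh.sub_const 1).ofReal_comp
    have hS : HasDerivAt (fun t : ℝ => ((Real.sinh (‖b‖ * t) : ℝ) : ℂ))
        ((Real.cosh (‖b‖ * t) * ‖b‖ : ℝ) : ℂ) t := hlin.sinh.ofReal_comp
    have hd := (((hin w (h.phi q ((A ^ n) v)) t).add (hC.mul (hin w (h.phi P ((A ^ n) v)) t))).add
      (hS.mul (hin w (h.phi Q ((A ^ n) v)) t))).sub (hin (h.phi q w) ((A ^ n) v) t)
    refine hd.congr_deriv ?_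
    have c0' : ∀ y, A (h.phi q y) = h.phi q (A y) - (‖b‖ : ℂ) • h.phi Q y := LinearMap.congr_fun c0
    have cP' : ∀ y, A (h.phi P y) = h.phi P (A y) - (‖b‖ : ℂ) • h.phi Q y := LinearMap.congr_fun cP
    have cQ' : ∀ y, A (h.phi Q y) = h.phi Q (A y) - (‖b‖ : ℂ) • h.phi P y := LinearMap.congr_fun cQ
    simp only [hf, c0', cP', cQ', pow_succ' A n, Module.End.mul_apply, Submodule.coe_sub,
      Submodule.coe_smul, map_sub, map_smul, inner_sub_right, inner_smul_right]
    push_cast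
    ring
  · intro R
    obtain ⟨M₀, hM₀, hM₀'⟩ := h.norm_phi_pow_pair_le hψ b q v
    obtain ⟨M₁, hM₁, hM₁'⟩ := h.norm_phi_pow_pair_le hψ b P v
    obtain ⟨M₂, hM₂, hM₂'⟩ := h.norm_phi_pow_pair_le hψ b Q v
    obtain ⟨C, hC⟩ := h.analytic_pair hψ.one_one hψ.two_two b v
    have hC0 : 0 ≤ C := by simpa using (norm_nonneg _).trans (hC 0)
    refine ⟨‖w‖ * M₀ + Real.cosh (‖b‖ * R) * (‖w‖ * M₁) + Real.cosh (‖b‖ * R) * (‖w‖ * M₂) +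
      ‖h.phi q w‖ * C, fun n t ht => ?_⟩
    have hR : 0 ≤ R := (abs_nonneg t).trans ht
    have hcosh : Real.cosh (‖b‖ * t) ≤ Real.cosh (‖b‖ * R) := by
      rw [Real.cosh_le_cosh, abs_mul, abs_mul, abs_of_nonneg hR]
      gcongr
    have b1 : ‖((Real.cosh (‖b‖ * t) - 1 : ℝ) : ℂ)‖ ≤ Real.cosh (‖b‖ * R) := by
      rw [Complex.norm_real, Real.norm_eq_abs, abs_of_nonneg (by linarith [Real.one_le_cosh (‖b‖ * t)])]
      linarith
    have b2 : ‖((Real.sinh (‖b‖ * t) : ℝ) : ℂ)‖ ≤ Real.cosh (‖b‖ * R) := by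
      rw [Complex.norm_real, Real.norm_eq_abs]
      refine le_trans ?_ hcosh
      refine abs_le_of_sq_le_sq ?_ (Real.cosh_pos _).le
      have := Real.cosh_sq (‖b‖ * t)
      linarith
    have bin : ∀ (x y : 𝓓) (m : ℝ), ‖y‖ ≤ m → ‖⟪(x : K), (U t : K →L[ℂ] K) y⟫_ℂ‖ ≤ ‖x‖ * m := by
      intro x y m hy
      refine (norm_inner_le_norm _ _).trans ?_
      rw [norm_unitary_apply]
      gcongr
      · exact le_rfl
      · exact hy
    have hCn : ‖(A ^ n) v‖ ≤ C * (8 * (4 * ‖b‖ + 1)) ^ n * n.factorial := by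
      refine (hC n).trans ?_
      gcongr
      norm_num
    have d0 := bin w _ _ (hM₀' n)
    have d1 := bin w _ _ (hM₁' n)
    have d2 := bin w _ _ (hM₂' n)
    have d3 := bin (h.phi q w) _ _ hCn
    have hcp : 0 ≤ Real.cosh (‖b‖ * R) := (Real.cosh_pos _).le
    calc ‖f n t‖ ≤ ‖w‖ * (M₀ * (8 * (4 * ‖b‖ + 1)) ^ n * n.factorial) +
          Real.cosh (‖b‖ * R) * (‖w‖ * (M₁ * (8 * (4 * ‖b‖ + 1)) ^ n * n.factorial)) +
          Real.cosh (‖b‖ * R) * (‖w‖ * (M₂ * (8 * (4 * ‖b‖ + 1)) ^ n * n.factorial)) +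
          ‖h.phi q w‖ * (C * (8 * (4 * ‖b‖ + 1)) ^ n * n.factorial) := by
          refine (norm_sub_le _ _).trans (add_le_add ?_ d3)
          refine (norm_add_le _ _).trans (add_le_add ?_ ?_)
          · refine (norm_add_le _ _).trans (add_le_add d0 ?_)
            rw [norm_mul]
            exact mul_le_mul b1 d1 (norm_nonneg _) hcp
          · rw [norm_mul]
            exact mul_le_mul b2 d2 (norm_nonneg _) hcp
      _ = _ := by ring
  · intro n
    simp only [hf, h.pairGroup_zero hU, mul_zero, Real.cosh_zero, Real.sinh_zero, sub_self,
      Complex.ofReal_zero, zero_mul, add_zero, OneMemClass.coe_one, one_apply_eq_self]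
    rw [h.inner_phi, sub_self]

lemma pairGroup_phi (h : IsFockSystem B W Ω) (hψ : IsModePair B ψ₁ ψ₂)
    (hU : IsPairGroup h ψ₁ ψ₂ b U) (q : E) (v w : 𝓓) (t : ℝ) :
    ⟪(w : K), (U t : K →L[ℂ] K) (h.phi q v : 𝓓)⟫_ℂ =
      ⟪((h.phi (squeezeFlow B ψ₁ ψ₂ b t q) w : 𝓓) : K), (U t : K →L[ℂ] K) v⟫_ℂ := by
  rw [← h.pairGroup_phi_aux hψ hU, squeezeFlow, squeeze_squeeze hψ (phase_mul_conj b)]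
  rw [Real.cosh_sq]; ring

/-- The squeezing group implements the Bogoliubov transformation. -/
theorem pairGroup_weyl (h : IsFockSystem B W Ω) (hψ : IsModePair B ψ₁ ψ₂)
    (hU : IsPairGroup h ψ₁ ψ₂ b U) (p : E) (t : ℝ) :
    (U t : K →L[ℂ] K) * W p = W (squeezeFlow B ψ₁ ψ₂ b t p) * (U t : K →L[ℂ] K) :=
  h.intertwines_weyl fun v w => h.pairGroup_phi hψ hU p v w t

end IsFockSystem

/-! ### Field operators on squeezed vectors -/

namespace IsFockSystem

open Filter Topology

variable {E K : Type*} [AddCommGroup E] [Module ℂ E] [NormedAddCommGroup K]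
  [InnerProductSpace ℂ K] {B : E →ₗ⋆[ℂ] E →ₗ[ℂ] ℂ} {W : E → K →L[ℂ] K} {Ω : K}

local notation "deg" => degLT B W Ω
local notation "𝓓" => finPart W Ω

lemma squeezeFlow_neg {ψ₁ ψ₂ : E} (hψ : IsModePair B ψ₁ ψ₂) (b : ℂ) (t : ℝ) (p : E) :
    squeezeFlow B ψ₁ ψ₂ b t (squeezeFlow B ψ₁ ψ₂ b (-t) p) = p := by
  have := squeeze_squeeze hψ (phase_mul_conj b) (C := Real.cosh (‖b‖ * t))
    (S := -Real.sinh (‖b‖ * t)) (by rw [Real.cosh_sq]; ring) p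
  rw [neg_neg] at this
  rw [squeezeFlow, squeezeFlow, mul_neg, Real.cosh_neg, Real.sinh_neg]
  exact this

lemma squeezeFlow_real_smul (ψ₁ ψ₂ : E) (b : ℂ) (t r : ℝ) (p : E) :
    squeezeFlow B ψ₁ ψ₂ b t ((r : ℂ) • p) = (r : ℂ) • squeezeFlow B ψ₁ ψ₂ b t p := by
  simp only [squeezeFlow, squeeze, map_smul, smul_eq_mul, map_mul, Complex.conj_ofReal]
  module

variable [CompleteSpace K] {ψ₁ ψ₂ : E} {b : ℂ} {U : ℝ → unitary (K →L[ℂ] K)}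

/-- The field operators on squeezed finite-particle vectors. -/
lemma segalField_pairGroup (h : IsFockSystem B W Ω) (hψ : IsModePair B ψ₁ ψ₂)
    (hU : IsPairGroup h ψ₁ ψ₂ b U) (k : E) (v : 𝓓) (t : ℝ) :
    segalField W k ((U t : K →L[ℂ] K) v) =
      (U t : K →L[ℂ] K) (h.phi (squeezeFlow B ψ₁ ψ₂ b (-t) k) v : 𝓓) := by
  set p := squeezeFlow B ψ₁ ψ₂ b (-t) k with hp
  -- U(t) v need not be a finite-particle vector; the intertwining of Weyl operators puts it in the
  -- domain of the field all the same.
  have hW : ∀ s : ℝ, W ((s : ℂ) • k) ((U t : K →L[ℂ] K) v) =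
      (U t : K →L[ℂ] K) (W ((s : ℂ) • p) v) := fun s => by
    have h1 := h.pairGroup_weyl hψ hU ((s : ℂ) • p) t
    rw [squeezeFlow_real_smul, hp, squeezeFlow_neg hψ] at h1
    exact (congrArg (fun T : K →L[ℂ] K => T v) h1).symm
  have hd := ((U t : K →L[ℂ] K).restrictScalars ℝ).hasFDerivAt.comp_hasDerivAt (0 : ℝ)
    (h.hasDerivAt_phi p v)
  have hd' : HasDerivAt (fun s : ℝ => W ((s : ℂ) • k) ((U t : K →L[ℂ] K) v))
      ((U t : K →L[ℂ] K) (Complex.I • (h.phi p v : K))) 0 :=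
    hd.congr_of_eventuallyEq (Eventually.of_forall hW)
  rw [segalField, hd'.deriv, map_smul, smul_smul]
  simp

lemma squeezeFlow_one (hψ : IsModePair B ψ₁ ψ₂) (t : ℝ) (z : ℂ) :
    squeezeFlow B ψ₁ ψ₂ b (-t) (z • ψ₁) = ((Real.cosh (‖b‖ * t) : ℂ) * z) • ψ₁ +
      (phase b * Real.sinh (‖b‖ * t) * conj z) • ψ₂ := by
  rw [squeezeFlow, squeeze, mul_neg, Real.cosh_neg, Real.sinh_neg]
  simp only [map_smul, smul_eq_mul, hψ.one_one, hψ.two_one, mul_one, mul_zero, map_zero,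
    Complex.ofReal_neg]
  module

lemma squeezeFlow_two (hψ : IsModePair B ψ₁ ψ₂) (t : ℝ) (z : ℂ) :
    squeezeFlow B ψ₁ ψ₂ b (-t) (z • ψ₂) = ((Real.cosh (‖b‖ * t) : ℂ) * z) • ψ₂ +
      (phase b * Real.sinh (‖b‖ * t) * conj z) • ψ₁ := by
  rw [squeezeFlow, squeeze, mul_neg, Real.cosh_neg, Real.sinh_neg]
  simp only [map_smul, smul_eq_mul, hψ.one_two, hψ.two_two, mul_one, mul_zero, map_zero,
    Complex.ofReal_neg]
  module

lemma inv_sqrt_two_sq : ((1 / √2 : ℝ) : ℂ) * ((1 / √2 : ℝ) : ℂ) = 1 / 2 := by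
  rw [← Complex.ofReal_mul, div_mul_div_comm, Real.mul_self_sqrt (by norm_num)]
  norm_num

/-- Fields are only real-linear in the test function. With i in one coefficient and its conjugate in
the other, as in `squeezeFlow_one` at z = 1 and z = i, the combination defining an annihilator keeps
the annihilator of k and the creator of l. -/
lemma phi_comb_ann (h : IsFockSystem B W Ω) (x y : ℂ) (k l : E) (v : 𝓓) :
    ((1 / √2 : ℝ) : ℂ) • (h.phi (x • k + y • l) v + Complex.I •
      h.phi ((x * Complex.I) • k + (y * conj Complex.I) • l) v) = conj x • h.ann k v +
        y • h.cre l v := by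
  simp only [phi, h.cre_add, h.ann_add, h.cre_smul, h.ann_smul, LinearMap.smul_apply,
    LinearMap.add_apply, map_mul, Complex.conj_I, map_neg]
  have h2 := inv_sqrt_two_sq
  generalize ((1 / √2 : ℝ) : ℂ) = s at h2 ⊢
  have hI := Complex.I_mul_I
  match_scalars
  · linear_combination (x + Complex.I * Complex.I * x) * h2 + x / 2 * hI
  · linear_combination (y - Complex.I * Complex.I * y) * h2 - y / 2 * hI
  · linear_combination (conj x - Complex.I * Complex.I * conj x) * h2 - conj x / 2 * hI
  · linear_combination (conj y + Complex.I * Complex.I * conj y) * h2 + conj y / 2 * hI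

lemma phi_comb_cre (h : IsFockSystem B W Ω) (x y : ℂ) (k l : E) (v : 𝓓) :
    ((1 / √2 : ℝ) : ℂ) • (h.phi (x • k + y • l) v - Complex.I •
      h.phi ((x * Complex.I) • k + (y * conj Complex.I) • l) v) = x • h.cre k v +
        conj y • h.ann l v := by
  simp only [phi, h.cre_add, h.ann_add, h.cre_smul, h.ann_smul, LinearMap.smul_apply,
    LinearMap.add_apply, map_mul, Complex.conj_I, map_neg]
  have h2 := inv_sqrt_two_sq
  generalize ((1 / √2 : ℝ) : ℂ) = s at h2 ⊢
  have hI := Complex.I_mul_I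
  match_scalars
  · linear_combination (x - Complex.I * Complex.I * x) * h2 - x / 2 * hI
  · linear_combination (y + Complex.I * Complex.I * y) * h2 + y / 2 * hI
  · linear_combination (conj x + Complex.I * Complex.I * conj x) * h2 + conj x / 2 * hI
  · linear_combination (conj y - Complex.I * Complex.I * conj y) * h2 - conj y / 2 * hI

lemma annihilation_pairGroup (h : IsFockSystem B W Ω) (hψ : IsModePair B ψ₁ ψ₂)
    (hU : IsPairGroup h ψ₁ ψ₂ b U) (v : 𝓓) (t : ℝ) :
    annihilation W ψ₁ ((U t : K →L[ℂ] K) v) = (U t : K →L[ℂ] K)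
      ((Real.cosh (‖b‖ * t) : ℂ) • h.ann ψ₁ v + (phase b * Real.sinh (‖b‖ * t)) • h.cre ψ₂ v : 𝓓) := by
  have h1 := h.phi_comb_ann (Real.cosh (‖b‖ * t)) (phase b * Real.sinh (‖b‖ * t)) ψ₁ ψ₂ v
  have s1 := squeezeFlow_one (b := b) hψ t 1
  simp only [one_smul, map_one, mul_one] at s1
  rw [annihilation, h.segalField_pairGroup hψ hU, h.segalField_pairGroup hψ hU,
    squeezeFlow_one hψ, s1, ← map_smul, ← map_add, ← map_smul]
  rw [Complex.conj_ofReal] at h1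
  exact congrArg (fun x : 𝓓 => (U t : K →L[ℂ] K) x) h1

lemma creation_pairGroup (h : IsFockSystem B W Ω) (hψ : IsModePair B ψ₁ ψ₂)
    (hU : IsPairGroup h ψ₁ ψ₂ b U) (v : 𝓓) (t : ℝ) :
    creation W ψ₂ ((U t : K →L[ℂ] K) v) = (U t : K →L[ℂ] K)
      ((Real.cosh (‖b‖ * t) : ℂ) • h.cre ψ₂ v +
        (conj (phase b) * Real.sinh (‖b‖ * t)) • h.ann ψ₁ v : 𝓓) := by
  have h1 := h.phi_comb_cre (Real.cosh (‖b‖ * t)) (phase b * Real.sinh (‖b‖ * t)) ψ₂ ψ₁ v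
  have s1 := squeezeFlow_two (b := b) hψ t 1
  simp only [one_smul, map_one, mul_one] at s1
  rw [creation, h.segalField_pairGroup hψ hU, h.segalField_pairGroup hψ hU,
    squeezeFlow_two hψ, s1, ← map_smul, ← map_sub, ← map_smul]
  rw [map_mul, Complex.conj_ofReal] at h1
  exact congrArg (fun x : 𝓓 => (U t : K →L[ℂ] K) x) h1

/-- The Bogoliubov transformation on the annihilation operator. -/
theorem pairGroup_annihilation (h : IsFockSystem B W Ω) (hψ : IsModePair B ψ₁ ψ₂)
    (hU : IsPairGroup h ψ₁ ψ₂ b U) (v : 𝓓) (t : ℝ) :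
    (U t : K →L[ℂ] K) (annihilation W ψ₁ v) =
      (Real.cosh (‖b‖ * t) : ℂ) • annihilation W ψ₁ ((U t : K →L[ℂ] K) v) -
        (phase b * Real.sinh (‖b‖ * t)) • creation W ψ₂ ((U t : K →L[ℂ] K) v) := by
  rw [h.annihilation_pairGroup hψ hU, h.creation_pairGroup hψ hU,
    ← (U t : K →L[ℂ] K).map_smul, ← (U t : K →L[ℂ] K).map_smul, ← (U t : K →L[ℂ] K).map_sub]
  congr 1
  have hc := phase_mul_conj b
  -- The formulas for the transported annihilator and creator form a two-by-two system, inverted by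
  -- means of cosh² - sinh² = 1.
  have hcs : (Real.cosh (‖b‖ * t) : ℂ) ^ 2 - (Real.sinh (‖b‖ * t) : ℂ) ^ 2 = 1 := by
    exact_mod_cast Real.cosh_sq_sub_sinh_sq _
  rw [Submodule.coe_add, Submodule.coe_add, Submodule.coe_smul, Submodule.coe_smul,
    Submodule.coe_smul, Submodule.coe_smul, ← h.coe_ann]
  generalize (Real.sinh (‖b‖ * t) : ℂ) = S at hcs ⊢
  generalize (Real.cosh (‖b‖ * t) : ℂ) = C at hcs ⊢
  match_scalars
  · linear_combination -hcs + S ^ 2 * hc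
  · ring

/-! ### The coefficients of the squeezed vacuum -/

lemma ann_mul_cre_pow (h : IsFockSystem B W Ω) {k : E} (hk : B k k = 1) (n : ℕ) :
    h.ann k * h.cre k ^ (n + 1) = h.cre k ^ (n + 1) * h.ann k + ((n : ℂ) + 1) • h.cre k ^ n := by
  induction n with
  | zero => simp [h.ann_mul_cre, hk]
  | succ n ih =>
    rw [pow_succ _ (n + 1), ← mul_assoc, ih, add_mul, mul_assoc, h.ann_mul_cre, hk, smul_mul_assoc,
      ← pow_succ, mul_add, one_smul, mul_one, ← mul_assoc]
    push_cast
    module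

lemma ann_cre_pow_vac (h : IsFockSystem B W Ω) {k : E} (hk : B k k = 1) (n : ℕ) :
    h.ann k ((h.cre k ^ (n + 1)) h.vac) = ((n : ℂ) + 1) • (h.cre k ^ n) h.vac := by
  rw [← Module.End.mul_apply, h.ann_mul_cre_pow hk, LinearMap.add_apply, Module.End.mul_apply,
    h.ann_vac, map_zero, zero_add, LinearMap.smul_apply]

lemma inner_cre_pow_vac (h : IsFockSystem B W Ω) {k : E} (hk : B k k = 1) (m n : ℕ) :
    ⟪((h.cre k ^ m) h.vac : K), ((h.cre k ^ n) h.vac : 𝓓)⟫_ℂ = if m = n then (n.factorial : ℂ) else 0 := by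
  induction m generalizing n with
  | zero =>
    cases n with
    | zero => simp [vac, h.norm_vacuum]
    | succ n =>
      rw [pow_succ' (h.cre k) n, Module.End.mul_apply, ← h.inner_ann, pow_zero,
        Module.End.one_apply, h.ann_vac]
      simp
  | succ m ih =>
    rw [pow_succ' (h.cre k) m, Module.End.mul_apply, h.inner_cre]
    cases n with
    | zero => rw [pow_zero, Module.End.one_apply, h.ann_vac]; simp
    | succ n =>
      rw [h.ann_cre_pow_vac hk, Submodule.coe_smul, inner_smul_right, ih]
      by_cases hmn : m = n
      · simp [hmn, Nat.factorial_succ]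
      · simp [hmn]

lemma commute_ann_cre_pow (h : IsFockSystem B W Ω) {k l : E} (hkl : B k l = 0) (n : ℕ) :
    h.ann k * h.cre l ^ n = h.cre l ^ n * h.ann k := by
  have : Commute (h.ann k) (h.cre l) := by
    rw [Commute, SemiconjBy, h.ann_mul_cre, hkl, zero_smul, add_zero]
  exact (this.pow_right n)

/-- From a₁Ω = 0: the transported annihilator cosh · a₁ - phase · sinh · a₂† kills U(t)Ω. The
relation is obtained weakly, from the fields of ψ₁ and iψ₁, so that the adjoints act on the
finite-particle vector w. -/
lemma inner_cre_squeezed (h : IsFockSystem B W Ω) (hψ : IsModePair B ψ₁ ψ₂)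
    (hU : IsPairGroup h ψ₁ ψ₂ b U) (t : ℝ) (w : 𝓓) :
    (Real.cosh (‖b‖ * t) : ℂ) * ⟪(h.cre ψ₁ w : K), (U t : K →L[ℂ] K) Ω⟫_ℂ =
      phase b * Real.sinh (‖b‖ * t) * ⟪(h.ann ψ₂ w : K), (U t : K →L[ℂ] K) Ω⟫_ℂ := by
  have a1 := h.pairGroup_phi hψ hU ψ₁ h.vac w t
  have a2 := h.pairGroup_phi hψ hU (Complex.I • ψ₁) h.vac w t
  have s : ∀ z : ℂ, squeezeFlow B ψ₁ ψ₂ b t (z • ψ₁) = ((Real.cosh (‖b‖ * t) : ℂ) * z) • ψ₁ +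
      (-(phase b * Real.sinh (‖b‖ * t)) * conj z) • ψ₂ := fun z => by
    have := squeezeFlow_one (b := b) hψ (-t) z
    rw [neg_neg, mul_neg, Real.cosh_neg, Real.sinh_neg] at this
    rw [this]
    push_cast
    module
  have s1 := s 1
  simp only [one_smul, map_one, mul_one] at s1
  rw [s] at a2
  rw [s1] at a1
  have a3 := h.phi_comb_cre (Real.cosh (‖b‖ * t)) (-(phase b * Real.sinh (‖b‖ * t))) ψ₁ ψ₂ w
  have a4 : (((1 / √2 : ℝ) : ℂ) • (h.phi ψ₁ h.vac + Complex.I • h.phi (Complex.I • ψ₁) h.vac) : 𝓓) = 0 := by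
    have := h.phi_comb_ann 1 0 ψ₁ ψ₁ h.vac
    simpa [h.ann_vac] using this
  have a5 := congrArg (fun x : 𝓓 => ⟪(w : K), (U t : K →L[ℂ] K) x⟫_ℂ) a4
  have a6 := congrArg (fun x : 𝓓 => ⟪(x : K), (U t : K →L[ℂ] K) Ω⟫_ℂ) a3
  simp only [Submodule.coe_smul, Submodule.coe_add, Submodule.coe_sub, Submodule.coe_zero, map_zero,
    map_smul, map_add, inner_smul_right, inner_smul_left, inner_add_right, inner_add_left,
    inner_sub_left, inner_zero_right, Complex.conj_ofReal, Complex.conj_I, map_neg, map_mul,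
    Complex.conj_conj] at a5 a6
  rw [a1, a2] at a5
  simp only [vac, Complex.conj_I] at a5
  linear_combination -a6 + a5

lemma inner_pairGroup_neg (h : IsFockSystem B W Ω) (hU : IsPairGroup h ψ₁ ψ₂ b U) (t : ℝ) (x y : K) :
    ⟪x, (U t : K →L[ℂ] K) y⟫_ℂ = ⟪(U (-t) : K →L[ℂ] K) x, y⟫_ℂ := by
  have h1 : U (-t) * U t = 1 := by rw [← hU.map_add, neg_add_cancel, h.pairGroup_zero hU]
  have h2 : (U (-t) : K →L[ℂ] K) ((U t : K →L[ℂ] K) y) = y :=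
    congrArg (fun V : unitary (K →L[ℂ] K) => (V : K →L[ℂ] K) y) h1
  conv_rhs => rw [← h2]
  rw [inner_unitary_apply]

/-- Unitarity moves U(t) to the left slot as U(-t), so the generator acts on v instead of w. -/
lemma hasDerivAt_inner_squeezed (h : IsFockSystem B W Ω) (hU : IsPairGroup h ψ₁ ψ₂ b U)
    (v w : 𝓓) (t : ℝ) :
    HasDerivAt (fun t => ⟪(v : K), (U t : K →L[ℂ] K) w⟫_ℂ)
      (-⟪(h.pair ψ₁ ψ₂ b v : K), (U t : K →L[ℂ] K) w⟫_ℂ) t := by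
  have d := (h.pairGroup_hasDerivAt hU v (-t)).scomp t (hasDerivAt_neg t)
  have := d.inner ℂ (hasDerivAt_const t (w : K))
  rw [inner_zero_right, zero_add, neg_one_smul, inner_neg_left, ← h.inner_pairGroup_neg hU] at this
  refine this.congr_of_eventuallyEq (Eventually.of_forall fun s => ?_)
  exact h.inner_pairGroup_neg hU s _ _

lemma pair_vac (h : IsFockSystem B W Ω) :
    h.pair ψ₁ ψ₂ b h.vac = b • h.cre ψ₁ (h.cre ψ₂ h.vac) := by
  simp [pair, h.ann_vac]

/-- The recursion of `inner_cre_squeezed` fixes only ratios of coefficients, and normalisation would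
leave a phase open. The vacuum coefficient x solves x' = -‖b‖ tanh(‖b‖t) x, so cosh · x is constant.
-/
lemma inner_vac_squeezed (h : IsFockSystem B W Ω) (hψ : IsModePair B ψ₁ ψ₂)
    (hU : IsPairGroup h ψ₁ ψ₂ b U) (t : ℝ) :
    (Real.cosh (‖b‖ * t) : ℂ) * ⟪Ω, (U t : K →L[ℂ] K) Ω⟫_ℂ = 1 := by
  have hd : ∀ t, HasDerivAt (fun t : ℝ => (Real.cosh (‖b‖ * t) : ℂ) * ⟪Ω, (U t : K →L[ℂ] K) Ω⟫_ℂ)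
      0 t := fun t => by
    have d1 := h.hasDerivAt_inner_squeezed hU h.vac h.vac t
    have d2 : HasDerivAt (fun t : ℝ => (Real.cosh (‖b‖ * t) : ℂ)) (Real.sinh (‖b‖ * t) * ‖b‖ : ℝ) t :=
      ((((hasDerivAt_id t).const_mul ‖b‖).cosh).congr_deriv (by simp)).ofReal_comp
    refine (d2.mul d1).congr_deriv ?_
    have d3 := h.inner_cre_squeezed hψ hU t (h.cre ψ₂ h.vac)
    have d4 := h.ann_cre_pow_vac hψ.two_two 0
    simp only [zero_add, pow_one, pow_zero, Module.End.one_apply, Nat.cast_zero, one_smul] at d4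
    rw [d4] at d3
    rw [h.pair_vac, Submodule.coe_smul, inner_smul_left]
    have hb : conj b * phase b = ‖b‖ := by
      have h1 := congrArg conj (norm_mul_phase b)
      rw [map_mul, Complex.conj_ofReal] at h1
      linear_combination -phase b * h1 + ‖b‖ * phase_mul_conj b
    change _ * ⟪Ω, (U t : K →L[ℂ] K) Ω⟫_ℂ + _ * -(_ * ⟪_, (U t : K →L[ℂ] K) Ω⟫_ℂ) = 0
    change _ = _ * ⟪Ω, (U t : K →L[ℂ] K) Ω⟫_ℂ at d3
    push_cast at d3 ⊢
    linear_combination -conj b * d3 -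
      Complex.sinh (‖b‖ * t) * ⟪Ω, (U t : K →L[ℂ] K) Ω⟫_ℂ * hb
  have hc := is_const_of_deriv_eq_zero (fun t => (hd t).differentiableAt) (fun t => (hd t).deriv) t 0
  rw [hc, h.pairGroup_zero hU]
  simp [h.norm_vacuum]

/-- The coefficients of the squeezed vacuum. -/
theorem inner_cre_pow_squeezed (h : IsFockSystem B W Ω) (hψ : IsModePair B ψ₁ ψ₂)
    (hU : IsPairGroup h ψ₁ ψ₂ b U) (t : ℝ) (n : ℕ) :
    ⟪((h.cre ψ₁ ^ n * h.cre ψ₂ ^ n) h.vac : K), (U t : K →L[ℂ] K) Ω⟫_ℂ =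
      n.factorial * (phase b * Real.tanh (‖b‖ * t)) ^ n / Real.cosh (‖b‖ * t) := by
  have hC : (Real.cosh (‖b‖ * t) : ℂ) ≠ 0 := by exact_mod_cast (Real.cosh_pos _).ne'
  induction n with
  | zero =>
    rw [eq_div_iff hC, mul_comm]
    simp only [pow_zero, mul_one, Module.End.one_apply, Nat.factorial_zero, Nat.cast_one]
    exact h.inner_vac_squeezed hψ hU t
  | succ n ih =>
    rw [pow_succ' (h.cre ψ₁), mul_assoc, Module.End.mul_apply]
    -- A creator of the first mode is traded for an annihilator of the second: passing from n to n +
    -- 1 multiplies by (n + 1) · phase · tanh.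
    have h1 := h.inner_cre_squeezed hψ hU t ((h.cre ψ₁ ^ n * h.cre ψ₂ ^ (n + 1)) h.vac)
    have h2 : h.ann ψ₂ ((h.cre ψ₁ ^ n * h.cre ψ₂ ^ (n + 1)) h.vac) =
        ((n : ℂ) + 1) • (h.cre ψ₁ ^ n * h.cre ψ₂ ^ n) h.vac := by
      rw [← Module.End.mul_apply, ← mul_assoc, h.commute_ann_cre_pow hψ.two_one, mul_assoc,
        Module.End.mul_apply, Module.End.mul_apply, h.ann_cre_pow_vac hψ.two_two, map_smul,
        ← Module.End.mul_apply]
    rw [h2, Submodule.coe_smul, inner_smul_left, ih] at h1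
    rw [eq_div_iff hC, mul_comm, h1, Real.tanh_eq_sinh_div_cosh, Nat.factorial_succ]
    push_cast
    rw [map_add, map_natCast, map_one]
    push_cast at hC
    rw [pow_succ (phase b * _)]
    field_simp

end IsFockSystem

/-! ### The Fock space and the doubled Fock space as Fock representations -/

section Instances

variable {H : Type*} [NormedAddCommGroup H] [InnerProductSpace ℂ H]

lemma weyl_vacuum (f : H) :
    weyl f (vacuum H) = ((Finsupp.single f 1 : WeylSpan H) : Fock H) := by
  rw [vacuum, weyl_coe_single]
  simp [weylPhase]

/-- The Fock space is a Fock representation of the Weyl relations. -/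
lemma isFockSystem_weyl :
    IsFockSystem (innerₛₗ ℂ : H →ₗ⋆[ℂ] H →ₗ[ℂ] ℂ) weyl (vacuum H) where
  form_conj f g := inner_conj_symm g f
  form_nonneg f := inner_self_nonneg (𝕜 := ℂ)
  weyl_weyl f g := congrArg (fun T : Fock H →L[ℂ] Fock H => T (vacuum H)) (weyl_mul f g)
  inner_weyl f g := by
    rw [weyl_vacuum, weyl_vacuum, UniformSpace.Completion.inner_coe, inner_single, fockKernel_eq,
      fockState, fockState, ← Complex.exp_add, ← Complex.exp_add, map_one, one_mul, one_mul]
    simp only [innerₛₗ_apply_apply, inner_self_eq_ofReal]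
    congr 1
    push_cast
    ring
  weyl_zero := weyl_vacuum 0
  total := by
    have h1 : ∀ a : WeylSpan H, (a : Fock H) ∈
        Submodule.span ℂ (Set.range fun f : H => weyl f (vacuum H)) := fun a => by
      induction a using Finsupp.induction_linear with
      | zero => rw [UniformSpace.Completion.coe_zero]; exact zero_mem _
      | add a₁ a₂ h₁ h₂ => rw [UniformSpace.Completion.coe_add]; exact add_mem h₁ h₂
      | single f x =>
        have : (Finsupp.single f x : WeylSpan H) = x • Finsupp.single f 1 := by simp
        rw [this, UniformSpace.Completion.coe_smul, ← weyl_vacuum]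
        exact Submodule.smul_mem _ _ (Submodule.subset_span ⟨f, rfl⟩)
    refine (UniformSpace.Completion.denseRange_coe (α := WeylSpan H)).mono ?_
    rintro _ ⟨a, rfl⟩
    exact h1 a

lemma norm_prodVec (v w : Fock H) : ‖prodVec v w‖ = ‖v‖ * ‖w‖ := by
  have h1 := inner_prodVec v w v w
  rw [inner_self_eq_ofReal, inner_self_eq_ofReal, inner_self_eq_ofReal, ← Complex.ofReal_mul,
    Complex.ofReal_inj, ← mul_pow] at h1
  exact (pow_left_inj₀ (norm_nonneg _) (by positivity) two_ne_zero).1 h1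

variable (H) in
/-- The product vector as a continuous bilinear map. -/
noncomputable def prodVecL : Fock H →L[ℂ] Fock H →L[ℂ] DFock H :=
  LinearMap.mkContinuous₂ ((TensorProduct.mk ℂ (Fock H) (Fock H)).compr₂
    (UniformSpace.Completion.toComplL (𝕜 := ℂ) (E := Fock H ⊗[ℂ] Fock H)).toLinearMap) 1
    fun v w => by
      rw [one_mul]
      exact (norm_prodVec v w).le

lemma prodVecL_apply (v w : Fock H) : prodVecL H v w = prodVec v w := rfl

/-- Vectors of the doubled Fock space are determined by inner products with product vectors. -/
lemma dfock_ext_inner {x y : DFock H}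
    (hxy : ∀ v w, ⟪prodVec v w, x⟫_ℂ = ⟪prodVec v w, y⟫_ℂ) : x = y := by
  have hd : Dense (Set.range ((↑) : Fock H ⊗[ℂ] Fock H →
      UniformSpace.Completion (Fock H ⊗[ℂ] Fock H))) := UniformSpace.Completion.denseRange_coe
  refine ext_inner_left ℂ fun z => ?_
  induction z using UniformSpace.Completion.induction_on with
  | hp => exact isClosed_eq (continuous_id.inner continuous_const) (continuous_id.inner continuous_const)
  | ih a =>
    induction a with
    | zero => rw [UniformSpace.Completion.coe_zero]; exact (inner_zero_left _).trans (inner_zero_left _).symm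
    | tmul v w => exact hxy v w
    | add a₁ a₂ h₁ h₂ =>
      rw [UniformSpace.Completion.coe_add]
      exact (inner_add_left _ _ _).trans ((congrArg₂ _ h₁ h₂).trans (inner_add_left _ _ _).symm)

/-- Operators on the doubled Fock space are determined by their values on product vectors. -/
lemma dfock_op_ext {S T : DFock H →L[ℂ] DFock H}
    (hST : ∀ v w, S (prodVec v w) = T (prodVec v w)) : S = T := by
  ext z
  induction z using UniformSpace.Completion.induction_on with
  | hp => exact isClosed_eq S.continuous T.continuous
  | ih a =>
    induction a with
    | zero => rw [UniformSpace.Completion.coe_zero]; exact S.map_zero.trans T.map_zero.symm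
    | tmul v w => exact hST v w
    | add a₁ a₂ h₁ h₂ =>
      rw [UniformSpace.Completion.coe_add]
      exact (S.map_add _ _).trans ((congrArg₂ _ h₁ h₂).trans (T.map_add _ _).symm)

variable (H) in
/-- The hermitian form of the doubled one-particle space. -/
noncomputable def dform : (H × H) →ₗ⋆[ℂ] (H × H) →ₗ[ℂ] ℂ :=
  LinearMap.mk₂'ₛₗ _ _ (fun p q => ⟪p.1, q.1⟫_ℂ + ⟪p.2, q.2⟫_ℂ)
    (fun p p' q => by simp only [Prod.fst_add, Prod.snd_add, inner_add_left]; ring)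
    (fun c p q => by
      simp only [Prod.smul_fst, Prod.smul_snd, inner_smul_left, smul_eq_mul]; ring)
    (fun p q q' => by simp only [Prod.fst_add, Prod.snd_add, inner_add_right]; ring)
    (fun c p q => by
      simp only [Prod.smul_fst, Prod.smul_snd, inner_smul_right, smul_eq_mul, RingHom.id_apply]; ring)

lemma dform_apply (p q : H × H) : dform H p q = ⟪p.1, q.1⟫_ℂ + ⟪p.2, q.2⟫_ℂ := rfl

lemma dweyl_dvacuum (p : H × H) :
    dweyl p (dvacuum H) = prodVec (weyl p.1 (vacuum H)) (weyl p.2 (vacuum H)) :=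
  prodOp_prodVec _ _ _ _

/-- The doubled Fock space is a Fock representation of the doubled Weyl relations. -/
lemma isFockSystem_dweyl : IsFockSystem (dform H) dweyl (dvacuum H) where
  form_conj p q := by
    rw [dform_apply, dform_apply, map_add, inner_conj_symm, inner_conj_symm]
  form_nonneg p := by
    rw [dform_apply, Complex.add_re]
    exact add_nonneg (inner_self_nonneg (𝕜 := ℂ)) (inner_self_nonneg (𝕜 := ℂ))
  weyl_weyl p q := by
    rw [dweyl_dvacuum, dweyl, prodOp_prodVec, dweyl_dvacuum, isFockSystem_weyl.weyl_weyl,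
      isFockSystem_weyl.weyl_weyl, ← prodVecL_apply, map_smul, map_smul, smul_apply,
      smul_smul, ← Complex.exp_add, prodVecL_apply]
    congr 2
    simp only [innerₛₗ_apply_apply, dform_apply, Complex.add_im, Complex.ofReal_add]
    ring
  inner_weyl p q := by
    rw [dweyl_dvacuum, dweyl_dvacuum, inner_prodVec, isFockSystem_weyl.inner_weyl,
      isFockSystem_weyl.inner_weyl, ← Complex.exp_add]
    simp only [innerₛₗ_apply_apply, dform_apply]
    congr 1
    ring
  weyl_zero := by
    rw [dweyl_dvacuum, Prod.fst_zero, Prod.snd_zero, isFockSystem_weyl.weyl_zero, dvacuum]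
  total := by
    rw [Submodule.dense_iff_topologicalClosure_eq_top, Submodule.topologicalClosure_eq_top_iff,
      Submodule.eq_bot_iff]
    intro x hx
    have h0 : ∀ f g : H, ⟪prodVec (weyl f (vacuum H)) (weyl g (vacuum H)), x⟫_ℂ = 0 := fun f g =>
      (Submodule.mem_orthogonal _ x).1 hx _ (Submodule.subset_span ⟨(f, g), dweyl_dvacuum (f, g)⟩)
    -- Orthogonality extends from the vectors W(f)Ω to all vectors in one tensor factor at a time.
    have key : ∀ {T : Fock H →L[ℂ] DFock H}, (∀ f, ⟪T (weyl f (vacuum H)), x⟫_ℂ = 0) →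
        ∀ v, ⟪T v, x⟫_ℂ = 0 := fun {T} hT v => by
      refine closure_minimal (t := {v | ⟪T v, x⟫_ℂ = 0}) ?_ (isClosed_eq (T.continuous.inner continuous_const) continuous_const) (isFockSystem_weyl.total v)
      intro v hv
      induction hv using Submodule.span_induction with
      | mem v hv => obtain ⟨f, rfl⟩ := hv; exact hT f
      | zero => simp
      | add v w _ _ hv hw =>
        change ⟪T v, x⟫_ℂ = 0 at hv
        change ⟪T w, x⟫_ℂ = 0 at hw
        change ⟪T (v + w), x⟫_ℂ = 0
        rw [map_add, inner_add_left, hv, hw, add_zero]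
      | smul a v _ hv =>
        change ⟪T v, x⟫_ℂ = 0 at hv
        change ⟪T (a • v), x⟫_ℂ = 0
        rw [map_smul, inner_smul_left, hv, mul_zero]
    refine dfock_ext_inner fun v w => ?_
    rw [inner_zero_right]
    exact key (T := prodVecL H v) (fun g => key (T := (prodVecL H).flip (weyl g (vacuum H)))
      (fun f => h0 f g) v) w

lemma expVec_prod (f g : H) : expVec (dform H) dweyl (dvacuum H) (f, g) =
    prodVec (expVec (innerₛₗ ℂ) weyl (vacuum H) f) (expVec (innerₛₗ ℂ) weyl (vacuum H) g) := by
  rw [expVec, expVec, expVec, dweyl_dvacuum, ← prodVecL_apply, ← prodVecL_apply, map_smul, map_smul,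
    smul_apply, smul_smul, ← Complex.exp_add]
  congr 2
  simp only [innerₛₗ_apply_apply, dform_apply]
  ring

variable {ψ ψ' : H}

lemma isModePair (hψ : ‖ψ‖ = 1) (hψ' : ‖ψ'‖ = 1) : IsFockSystem.IsModePair (dform H) (ψ, 0) (0, ψ') := by
  constructor <;> simp [dform_apply, hψ, hψ']

lemma IsSqueezingGroup.isPairGroup {b : ℂ} {U : ℝ → unitary (DFock H →L[ℂ] DFock H)}
    (hU : IsSqueezingGroup ψ ψ' b U) :
    IsFockSystem.IsPairGroup isFockSystem_dweyl (ψ, 0) (0, ψ') b U where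
  map_add := hU.map_add
  generator v := hU.generator v v.2

/-- The squeezing group exists and is determined by its generator on finite-particle vectors. -/
theorem existsUnique_isSqueezingGroup (hψ : ‖ψ‖ = 1) (hψ' : ‖ψ'‖ = 1) (b : ℂ) :
    ∃! U : ℝ → unitary (DFock H →L[ℂ] DFock H), IsSqueezingGroup ψ ψ' b U := by
  have h := isFockSystem_dweyl (H := H)
  have hm := isModePair hψ hψ'
  have hA := h.analytic_pair hm.one_one hm.two_two b
  obtain ⟨U, hU₁, hU₂, hU₃⟩ := exists_unitary_group_of_analytic h.dense_finPart hA (by positivity)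
    (h.inner_pair (ψ, 0) (0, ψ') b)
  have hU : IsSqueezingGroup ψ ψ' b U := ⟨hU₁, hU₂, fun v hv => hU₃ ⟨v, hv⟩⟩
  exact ⟨U, hU, fun U' hU' => unitary_group_unique h.dense_finPart hA (by positivity)
    hU'.isPairGroup.map_add hU.isPairGroup.map_add hU'.isPairGroup.generator
    hU.isPairGroup.generator⟩

end Instances

/-! ### Number states and the expansion of the squeezed vacuum -/

/-- A vector with equality in Bessel's inequality is the sum of its Fourier series. -/
lemma Orthonormal.hasSum_of_hasSum_norm_sq {K : Type*} [NormedAddCommGroup K] [InnerProductSpace ℂ K]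
    {ι : Type*} {e : ι → K} (he : Orthonormal ℂ e) {x : K}
    (hx : HasSum (fun k => ‖⟪e k, x⟫_ℂ‖ ^ 2) (‖x‖ ^ 2)) : HasSum (fun k => ⟪e k, x⟫_ℂ • e k) x := by
  -- Pythagoras: the squared distance of a partial sum to x is the missing part of the Bessel sum.
  have key : ∀ s : Finset ι, ‖∑ k ∈ s, ⟪e k, x⟫_ℂ • e k - x‖ ^ 2 =
      ‖x‖ ^ 2 - ∑ k ∈ s, ‖⟪e k, x⟫_ℂ‖ ^ 2 := fun s => by
    have h1 : ⟪∑ k ∈ s, ⟪e k, x⟫_ℂ • e k, ∑ k ∈ s, ⟪e k, x⟫_ℂ • e k⟫_ℂ =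
        ((∑ k ∈ s, ‖⟪e k, x⟫_ℂ‖ ^ 2 : ℝ) : ℂ) := by
      rw [he.inner_sum]
      push_cast
      exact Finset.sum_congr rfl fun k _ => Complex.conj_mul' _
    have h2 : ⟪∑ k ∈ s, ⟪e k, x⟫_ℂ • e k, x⟫_ℂ = ((∑ k ∈ s, ‖⟪e k, x⟫_ℂ‖ ^ 2 : ℝ) : ℂ) := by
      rw [sum_inner]
      push_cast
      exact Finset.sum_congr rfl fun k _ => by rw [inner_smul_left, Complex.conj_mul']
    rw [inner_self_eq_ofReal, Complex.ofReal_inj] at h1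
    rw [norm_sub_sq (𝕜 := ℂ), h1, h2]
    simp only [RCLike.re_to_complex, Complex.ofReal_re]
    ring
  rw [HasSum, tendsto_iff_norm_sub_tendsto_zero]
  have h1 := (tendsto_const_nhds (x := ‖x‖ ^ 2)).sub hx
  simp only [sub_self, ← key] at h1
  have h2 := h1.sqrt
  simpa using h2

lemma one_sub_tanh_sq (x : ℝ) : 1 - Real.tanh x ^ 2 = (Real.cosh x ^ 2)⁻¹ := by
  have h1 := (Real.cosh_pos x).ne'
  rw [Real.tanh_eq_sinh_div_cosh]
  field_simp
  rw [Real.cosh_sq]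
  ring

lemma norm_phase (b : ℂ) : ‖phase b‖ = 1 := Complex.norm_exp_ofReal_mul_I _

namespace IsFockSystem

variable {E K : Type*} [AddCommGroup E] [Module ℂ E] [NormedAddCommGroup K]
  [InnerProductSpace ℂ K] {B : E →ₗ⋆[ℂ] E →ₗ[ℂ] ℂ} {W : E → K →L[ℂ] K} {Ω : K} [CompleteSpace K]

lemma coe_cre_pow (h : IsFockSystem B W Ω) (k : E) (n : ℕ) (v : finPart W Ω) :
    ((h.cre k ^ n) v : K) = (creation W k)^[n] v := by
  induction n with
  | zero => rfl
  | succ n ih => rw [pow_succ', Module.End.mul_apply, coe_cre, ih, Function.iterate_succ_apply']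

lemma inner_expVec_cre_pow (h : IsFockSystem B W Ω) (g k : E) (n : ℕ) (v : finPart W Ω) :
    ⟪expVec B W Ω g, ((h.cre k ^ n) v : K)⟫_ℂ =
      (-(Complex.I / (√2 : ℝ)) * B g k) ^ n * ⟪expVec B W Ω g, (v : K)⟫_ℂ := by
  induction n with
  | zero => simp
  | succ n ih =>
    rw [pow_succ', Module.End.mul_apply, coe_cre, creation_inner h, ih]
    ring

/-- An operator preserving the inner products of exponential vectors is isometric. -/
lemma adjoint_mul_self (h : IsFockSystem B W Ω) {T : K →L[ℂ] K}
    (hT : ∀ f g, ⟪T (expVec B W Ω f), T (expVec B W Ω g)⟫_ℂ = ⟪expVec B W Ω f, expVec B W Ω g⟫_ℂ) :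
    star T * T = 1 := by
  refine h.op_ext fun f => h.ext_inner fun g => ?_
  rw [mul_apply_eq_comp, ContinuousLinearMap.star_eq_adjoint, ContinuousLinearMap.adjoint_inner_right,
    hT, one_apply_eq_self]

end IsFockSystem

section NumberStates

variable {H : Type*} [NormedAddCommGroup H] [InnerProductSpace ℂ H]

local notation "e" => expVec (innerₛₗ ℂ) weyl (vacuum H)

lemma numberState_eq (f : H) (n : ℕ) : numberState f n = ((1 / √(n.factorial : ℝ) : ℝ) : ℂ) •
    ((isFockSystem_weyl.cre f ^ n) isFockSystem_weyl.vac : Fock H) := by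
  rw [IsFockSystem.coe_cre_pow]
  rfl

/-- The symbol of a number state is a pure power. Homogeneity, injectivity and the tensor form below
become scalar identities. -/
lemma inner_expVec_numberState (g f : H) (n : ℕ) : ⟪e g, numberState f n⟫_ℂ =
    ((1 / √(n.factorial : ℝ) : ℝ) : ℂ) * (-(Complex.I / (√2 : ℝ)) * ⟪g, f⟫_ℂ) ^ n := by
  rw [numberState_eq, inner_smul_right, isFockSystem_weyl.inner_expVec_cre_pow]
  simp only [IsFockSystem.vac, isFockSystem_weyl.inner_expVec_vacuum, mul_one, innerₛₗ_apply_apply]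

lemma inv_sqrt_factorial_sq (n : ℕ) :
    ((1 / √(n.factorial : ℝ) : ℝ) : ℂ) * ((1 / √(n.factorial : ℝ) : ℝ) : ℂ) = (n.factorial : ℂ)⁻¹ := by
  rw [← Complex.ofReal_mul, div_mul_div_comm, Real.mul_self_sqrt (by positivity)]
  simp

lemma orthonormal_numberState {f : H} (hf : ‖f‖ = 1) : Orthonormal ℂ (numberState f) := by
  rw [orthonormal_iff_ite]
  intro m n
  rw [numberState_eq, numberState_eq, inner_smul_left, inner_smul_right,
    isFockSystem_weyl.inner_cre_pow_vac (by simp [hf]), Complex.conj_ofReal]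
  split_ifs with hmn
  · rw [hmn, ← mul_assoc, inv_sqrt_factorial_sq, inv_mul_cancel₀]
    exact_mod_cast n.factorial_ne_zero
  · simp

lemma numberState_smul (c : ℂ) (f : H) (n : ℕ) :
    numberState (c • f) n = c ^ n • numberState f n := by
  refine isFockSystem_weyl.ext_inner fun g => ?_
  rw [inner_smul_right, inner_expVec_numberState, inner_expVec_numberState, inner_smul_right]
  ring

/-- The symbol of a one-particle state is a nonzero constant times ⟪g, f⟫. This brings eigenvalue
equations in Fock space down to `H`. -/
lemma numberState_one_injective : Function.Injective fun f : H => numberState f 1 := by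
  intro f f' hff
  refine ext_inner_left ℂ fun g => ?_
  have h1 := congrArg (fun x => ⟪e g, x⟫_ℂ) hff
  simp only [inner_expVec_numberState, pow_one] at h1
  have h2 : ((1 / √(Nat.factorial 1 : ℝ) : ℝ) : ℂ) * (-(Complex.I / (√2 : ℝ))) ≠ 0 := by simp
  rw [← mul_assoc, ← mul_assoc] at h1
  exact mul_left_cancel₀ h2 h1

lemma prodVec_numberState (f g : H) (n : ℕ) : prodVec (numberState f n) (numberState g n) =
    (n.factorial : ℂ)⁻¹ • ((isFockSystem_dweyl.cre (f, 0) ^ n * isFockSystem_dweyl.cre (0, g) ^ n)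
      isFockSystem_dweyl.vac : DFock H) := by
  refine isFockSystem_dweyl.ext_inner fun ⟨p, q⟩ => ?_
  rw [inner_smul_right, Module.End.mul_apply, isFockSystem_dweyl.inner_expVec_cre_pow,
    isFockSystem_dweyl.inner_expVec_cre_pow, expVec_prod, inner_prodVec, inner_expVec_numberState,
    inner_expVec_numberState, ← inv_sqrt_factorial_sq]
  have h1 := isFockSystem_dweyl.inner_expVec_vacuum (p, q)
  rw [expVec_prod] at h1
  simp only [IsFockSystem.vac, h1, dform_apply, inner_zero_right, add_zero, zero_add]
  ring

lemma orthonormal_prodVec {v w : ℕ → Fock H} (hv : Orthonormal ℂ v) (hw : Orthonormal ℂ w) :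
    Orthonormal ℂ fun n => prodVec (v n) (w n) := by
  rw [orthonormal_iff_ite] at *
  intro m n
  rw [inner_prodVec, hv, hw]
  split_ifs <;> simp

/-- The expansion of the squeezed vacuum in number states. -/
theorem hasSum_squeezedVacuum {ψ ψ' : H} (hψ : ‖ψ‖ = 1) (hψ' : ‖ψ'‖ = 1) {b : ℂ}
    {U : ℝ → unitary (DFock H →L[ℂ] DFock H)} (hU : IsSqueezingGroup ψ ψ' b U) :
    HasSum (fun n : ℕ => ((Real.cosh ‖b‖ : ℂ)⁻¹ * (phase b * Real.tanh ‖b‖) ^ n) •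
      prodVec (numberState ψ n) (numberState ψ' n)) (squeezedVacuum U) := by
  have ho := orthonormal_prodVec (orthonormal_numberState hψ) (orthonormal_numberState hψ')
  have hc : ∀ n, ⟪prodVec (numberState ψ n) (numberState ψ' n), squeezedVacuum U⟫_ℂ =
      (Real.cosh ‖b‖ : ℂ)⁻¹ * (phase b * Real.tanh ‖b‖) ^ n := fun n => by
    have h1 := isFockSystem_dweyl.inner_cre_pow_squeezed (isModePair hψ hψ') hU.isPairGroup 1 n
    rw [mul_one] at h1
    rw [prodVec_numberState, inner_smul_left, squeezedVacuum, h1, map_inv₀, map_natCast]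
    have : (n.factorial : ℂ) ≠ 0 := by exact_mod_cast n.factorial_ne_zero
    field_simp
  have hn : ‖squeezedVacuum U‖ = 1 := by
    rw [squeezedVacuum, norm_unitary_apply, isFockSystem_dweyl.norm_vacuum]
  have ht : Real.tanh ‖b‖ ^ 2 < 1 := by
    rw [← sub_pos, one_sub_tanh_sq]
    have := Real.cosh_pos ‖b‖
    positivity
  -- The squared coefficients cosh⁻² tanh²ⁿ sum to cosh⁻² / (1 - tanh²) = 1, the squared norm of the
  -- vector, so no other component is present.
  have hs := ho.hasSum_of_hasSum_norm_sq (x := squeezedVacuum U) (by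
    have h1 := (hasSum_geometric_of_lt_one (sq_nonneg _) ht).mul_left ((Real.cosh ‖b‖ ^ 2)⁻¹)
    rw [one_sub_tanh_sq, inv_inv, inv_mul_cancel₀ (pow_ne_zero 2 (Real.cosh_pos _).ne')] at h1
    rw [hn, one_pow]
    refine h1.congr_fun fun n => ?_
    rw [hc, norm_mul, norm_pow, norm_mul, norm_phase, one_mul, norm_inv, Complex.norm_real,
      Complex.norm_real, Real.norm_eq_abs, Real.norm_eq_abs, mul_pow, inv_pow, sq_abs, ← pow_mul,
      mul_comm n, pow_mul, sq_abs])
  simpa only [hc] using hs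

/-- The reduced state of a vector in Schmidt form. -/
theorem hasSum_reducedState {v w : ℕ → Fock H} (hw : Orthonormal ℂ w)
    {c : ℕ → ℂ} {Φ : DFock H} (hΦ : HasSum (fun n => c n • prodVec (v n) (w n)) Φ)
    (a : Fock H →L[ℂ] Fock H) :
    HasSum (fun n => conj (c n) * c n * ⟪v n, a (v n)⟫_ℂ) (reducedState Φ a) := by
  have h1 := (hΦ.mapL (prodOp a 1)).mapL (innerSL ℂ Φ)
  refine h1.congr_fun fun n => ?_
  have h2 : HasSum (fun m => ⟪prodVec (a (v n)) (w n), c m • prodVec (v m) (w m)⟫_ℂ)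
      ⟪prodVec (a (v n)) (w n), Φ⟫_ℂ := hΦ.mapL (innerSL ℂ _)
  -- Orthonormality of the second factors leaves the single term m = n; this removes the
  -- off-diagonal terms of the reduced state.
  have h3 : ⟪prodVec (a (v n)) (w n), Φ⟫_ℂ = c n * ⟪a (v n), v n⟫_ℂ := by
    refine h2.unique ?_
    convert hasSum_single n fun m hm => ?_ using 1
    · rw [inner_smul_right, inner_prodVec, orthonormal_iff_ite.1 hw]
      simp
    · rw [inner_smul_right, inner_prodVec, orthonormal_iff_ite.1 hw, if_neg hm.symm]
      simp
  rw [innerSL_apply_apply, map_smul, inner_smul_right, prodOp_prodVec, one_apply_eq_self,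
    ← inner_conj_symm Φ, h3, map_mul, inner_conj_symm]
  ring

/-! ### Second quantization -/

lemma secondQuant_expVec (V : H →ₗᵢ[ℂ] H) (f : H) : secondQuant V (e f) = e (V f) := by
  rw [expVec, expVec, map_smul, secondQuant_weyl_vacuum]
  simp

lemma star_secondQuant_mul_self (V : H →ₗᵢ[ℂ] H) : star (secondQuant V) * secondQuant V = 1 := by
  refine isFockSystem_weyl.adjoint_mul_self fun f g => ?_
  rw [secondQuant_expVec, secondQuant_expVec, isFockSystem_weyl.inner_expVec,
    isFockSystem_weyl.inner_expVec]
  simp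

lemma inner_secondQuant (V : H →ₗᵢ[ℂ] H) (x y : Fock H) :
    ⟪secondQuant V x, secondQuant V y⟫_ℂ = ⟪x, y⟫_ℂ := by
  rw [← ContinuousLinearMap.adjoint_inner_right, ← ContinuousLinearMap.star_eq_adjoint,
    ← mul_apply_eq_comp, star_secondQuant_mul_self, one_apply_eq_self]

lemma secondQuant_mul (V V' : H →ₗᵢ[ℂ] H) :
    secondQuant V * secondQuant V' = secondQuant (V.comp V') := by
  refine isFockSystem_weyl.op_ext fun f => ?_
  rw [mul_apply_eq_comp, secondQuant_expVec, secondQuant_expVec, secondQuant_expVec]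
  rfl

lemma secondQuant_id : secondQuant (LinearIsometry.id : H →ₗᵢ[ℂ] H) = 1 := by
  refine isFockSystem_weyl.op_ext fun f => ?_
  rw [secondQuant_expVec]
  rfl

lemma secondQuant_mul_weyl (V : H →ₗᵢ[ℂ] H) (f : H) :
    secondQuant V * weyl f = weyl (V f) * secondQuant V := by
  refine isFockSystem_weyl.op_ext fun g => ?_
  rw [mul_apply_eq_comp, mul_apply_eq_comp, isFockSystem_weyl.weyl_expVec, map_smul,
    secondQuant_expVec, secondQuant_expVec, isFockSystem_weyl.weyl_expVec, map_add]
  simp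

/-- The right inverse writes each exponential vector as an image under Γ(V), after which Γ(V)
cancels from the inner product by isometry. -/
lemma secondQuant_numberState {V V' : H →ₗᵢ[ℂ] H} (hV : V.comp V' = LinearIsometry.id) (f : H)
    (n : ℕ) : secondQuant V (numberState f n) = numberState (V f) n := by
  refine isFockSystem_weyl.ext_inner fun g => ?_
  have h1 : V (V' g) = g := congrArg (fun T : H →ₗᵢ[ℂ] H => T g) hV
  have h2 : e g = secondQuant V (e (V' g)) := by rw [secondQuant_expVec, h1]
  rw [h2, inner_secondQuant, ← h2, inner_expVec_numberState, inner_expVec_numberState]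
  conv_rhs => rw [← h1]
  rw [V.inner_map_map]

/-- Orbits of eigenvectors of the generator. -/
lemma IsGeneratorEigenvector.apply_eq {K : Type*} [NormedAddCommGroup K] [InnerProductSpace ℂ K]
    {V : ℝ → K →L[ℂ] K} {u : ℂ} {v : K} (hv : IsGeneratorEigenvector V u v)
    (hadd : ∀ s t, V (s + t) = V s * V t) (h0 : V 0 = 1) (t : ℝ) :
    V t v = Complex.exp (t * u) • v := by
  -- The orbit counter-rotated by exp(-tu) has zero derivative, hence is constant.
  have h1 : ∀ t : ℝ, HasDerivAt (fun t : ℝ => Complex.exp (-(t * u)) • V t v) 0 t := fun t => by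
    have h2 := hasDerivAt_of_group hadd hv.2 t
    have h3 : HasDerivAt (fun t : ℝ => Complex.exp (-(t * u))) (-u * Complex.exp (-(t * u))) t := by
      have := ((Complex.ofRealCLM.hasDerivAt (x := t)).mul_const u).neg.cexp
      refine this.congr_deriv ?_
      simp [mul_comm]
    refine (h3.smul h2).congr_deriv ?_
    rw [map_smul]
    module
  have h2 := is_const_of_deriv_eq_zero (fun t => (h1 t).differentiableAt) (fun t => (h1 t).deriv) t 0
  simp only [Complex.ofReal_zero, zero_mul, neg_zero, Complex.exp_zero, one_smul, h0,
    one_apply_eq_self] at h2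
  rw [← congrArg (Complex.exp (t * u) • ·) h2, smul_smul, ← Complex.exp_add, add_neg_cancel,
    Complex.exp_zero, one_smul]

lemma IsGeneratorEigenvector.re_eq_zero {K : Type*} [NormedAddCommGroup K] [InnerProductSpace ℂ K]
    {V : ℝ → K →L[ℂ] K} {u : ℂ} {v : K} (hv : IsGeneratorEigenvector V u v)
    (hadd : ∀ s t, V (s + t) = V s * V t) (h0 : V 0 = 1) (hiso : ∀ t x, ‖V t x‖ = ‖x‖) :
    u.re = 0 := by
  have h1 := hiso 1 v
  rw [hv.apply_eq hadd h0, norm_smul, mul_eq_right₀ (norm_ne_zero_iff.2 hv.1), Complex.norm_exp,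
    Real.exp_eq_one_iff] at h1
  simpa using h1

end NumberStates

/-! ### Orthonormal sequences and the KMS function of equidistant energies -/

section Orthonormal

variable {K : Type*} [NormedAddCommGroup K] [InnerProductSpace ℂ K] {v : ℕ → K}

lemma Orthonormal.summable_norm_mul (hv : Orthonormal ℂ v) (x y : K) :
    (Summable fun j => ‖⟪x, v j⟫_ℂ‖ * ‖⟪v j, y⟫_ℂ‖) ∧
      ∑' j, ‖⟪x, v j⟫_ℂ‖ * ‖⟪v j, y⟫_ℂ‖ ≤ ‖x‖ ^ 2 + ‖y‖ ^ 2 := by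
  have hx := hv.inner_products_summable x
  have hy := hv.inner_products_summable y
  have hle : ∀ j, ‖⟪x, v j⟫_ℂ‖ * ‖⟪v j, y⟫_ℂ‖ ≤ ‖⟪v j, x⟫_ℂ‖ ^ 2 + ‖⟪v j, y⟫_ℂ‖ ^ 2 := fun j => by
    rw [norm_inner_symm x]
    nlinarith [sq_nonneg (‖⟪v j, x⟫_ℂ‖ - ‖⟪v j, y⟫_ℂ‖), sq_nonneg ‖⟪v j, x⟫_ℂ‖,
      sq_nonneg ‖⟪v j, y⟫_ℂ‖]
  have hs : Summable fun j => ‖⟪x, v j⟫_ℂ‖ * ‖⟪v j, y⟫_ℂ‖ :=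
    Summable.of_nonneg_of_le (fun j => by positivity) hle (hx.add hy)
  refine ⟨hs, (hs.tsum_le_tsum hle (hx.add hy)).trans ?_⟩
  rw [hx.tsum_add hy]
  exact add_le_add (hv.tsum_inner_products_le x) (hv.tsum_inner_products_le y)

variable [CompleteSpace K]

/-- Fourier expansion in the closed span of an orthonormal sequence. -/
lemma Orthonormal.hasSum_of_mem_closure (hv : Orthonormal ℂ v) {y : K}
    (hy : y ∈ (Submodule.span ℂ (Set.range v)).topologicalClosure) :
    HasSum (fun j => ⟪v j, y⟫_ℂ • v j) y := by
  have hs : Summable fun j => ⟪v j, y⟫_ℂ • v j :=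
    (hv.orthogonalFamily.summable_iff_norm_sq_summable fun j => ⟪v j, y⟫_ℂ).2
      (hv.inner_products_summable y)
  set y' := ∑' j, ⟪v j, y⟫_ℂ • v j with hy'
  have h1 : ∀ j, ⟪v j, y'⟫_ℂ = ⟪v j, y⟫_ℂ := fun j => by
    have h2 : HasSum (fun i => ⟪v j, ⟪v i, y⟫_ℂ • v i⟫_ℂ) ⟪v j, y'⟫_ℂ :=
      hs.hasSum.mapL (innerSL ℂ (v j))
    refine h2.unique ?_
    convert hasSum_single j fun i hi => ?_ using 1
    · rw [inner_smul_right, orthonormal_iff_ite.1 hv]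
      simp
    · rw [inner_smul_right, orthonormal_iff_ite.1 hv, if_neg hi.symm, mul_zero]
  have h2 : y' ∈ (Submodule.span ℂ (Set.range v)).topologicalClosure := by
    refine (Submodule.isClosed_topologicalClosure _).mem_of_tendsto hs.hasSum
      (Filter.Eventually.of_forall fun s => Submodule.sum_mem _ fun j _ => ?_)
    exact Submodule.smul_mem _ _ (Submodule.le_topologicalClosure _ (Submodule.subset_span ⟨j, rfl⟩))
  -- The defect of the Fourier series lies both in the closed span and in its orthogonal complement.
  have h3 : y - y' ∈ (Submodule.span ℂ (Set.range v))ᗮ := by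
    rw [Submodule.mem_orthogonal]
    intro w hw
    induction hw using Submodule.span_induction with
    | mem w hw => obtain ⟨j, rfl⟩ := hw; rw [inner_sub_right, h1, sub_self]
    | zero => simp
    | add w w' _ _ hw hw' => rw [inner_add_left, hw, hw', add_zero]
    | smul a w _ hw => rw [inner_smul_left, hw, mul_zero]
  rw [← Submodule.orthogonal_closure] at h3
  have h4 := (Submodule.mem_orthogonal _ _).1 h3 _ (sub_mem hy h2)
  rw [inner_self_eq_zero, sub_eq_zero] at h4
  conv => arg 2; rw [h4]
  exact hs.hasSum

/-- For fixed k, Bessel's inequality for a* v_k and b v_k bounds the sum over j uniformly in k; the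
weights then make the sum over k converge. -/
lemma Orthonormal.summable_matrix (hv : Orthonormal ℂ v) (a b : K →L[ℂ] K) {w : ℕ → ℝ}
    (hw : Summable w) (hw0 : ∀ k, 0 ≤ w k) : Summable fun p : ℕ × ℕ =>
      w p.1 * (‖⟪v p.1, a (v p.2)⟫_ℂ‖ * ‖⟪v p.2, b (v p.1)⟫_ℂ‖) := by
  have h1 : ∀ k j, ⟪v k, a (v j)⟫_ℂ = ⟪a.adjoint (v k), v j⟫_ℂ := fun k j =>
    (ContinuousLinearMap.adjoint_inner_left _ _ _).symm
  have hb : ∀ (T : K →L[ℂ] K) k, ‖T (v k)‖ ^ 2 ≤ ‖T‖ ^ 2 := fun T k => by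
    have := T.le_opNorm (v k)
    rw [hv.1, mul_one] at this
    gcongr
  rw [summable_prod_of_nonneg fun p => by have := hw0 p.1; positivity]
  simp only [h1]
  refine ⟨fun k => (hv.summable_norm_mul _ _).1.mul_left _, ?_⟩
  refine Summable.of_nonneg_of_le (fun k => tsum_nonneg fun j => by have := hw0 k; positivity)
    (fun k => ?_) (hw.mul_right (‖a.adjoint‖ ^ 2 + ‖b‖ ^ 2))
  rw [tsum_mul_left]
  exact mul_le_mul_of_nonneg_left ((hv.summable_norm_mul _ _).2.trans
    (add_le_add (hb _ k) (hb _ k))) (hw0 k)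

/-- β and ε share a sign, possibly negative. Multiplication by ε brings either strip to the form 0 ≤
ε Im z ≤ βε. -/
lemma strip_bound {β ε y : ℝ} (h : 0 < β * ε) (hy : y ∈ Set.Icc (min 0 β) (max 0 β)) :
    0 ≤ ε * y ∧ ε * y ≤ β * ε := by
  rcases lt_trichotomy β 0 with hβ | hβ | hβ
  · have hε : ε < 0 := by nlinarith
    rw [min_eq_right hβ.le, max_eq_left hβ.le] at hy
    constructor <;> nlinarith [hy.1, hy.2]
  · simp [hβ] at h
  · have hε : 0 < ε := by nlinarith
    rw [min_eq_left hβ.le, max_eq_right hβ.le] at hy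
    constructor <;> nlinarith [hy.1, hy.2]

/-- For fixed k and j the left side is monotone in s, with value exp(-kτ) at s = 0 and exp(-jτ) at s
= τ. The weights inside the strip are thus dominated by those on its two edges. -/
lemma gibbs_weight_le {τ s : ℝ} (h0 : 0 ≤ s) (h1 : s ≤ τ) (k j : ℕ) :
    Real.exp (-(k * τ)) * Real.exp (-(((j : ℝ) - k) * s)) ≤
      Real.exp (-(k * τ)) + Real.exp (-(j * τ)) := by
  rw [← Real.exp_add]
  rcases le_total (k : ℝ) j with hkj | hkj
  · refine le_trans (Real.exp_le_exp.2 ?_) (le_add_of_nonneg_right (Real.exp_pos _).le)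
    nlinarith
  · refine le_trans (Real.exp_le_exp.2 ?_) (le_add_of_nonneg_left (Real.exp_pos _).le)
    nlinarith

/-- The KMS function of a pair of operators in a Gibbs state with equidistant energies. -/
theorem Orthonormal.exists_kms_function (hv : Orthonormal ℂ v) (a b : K →L[ℂ] K) (c : ℂ) {β ε : ℝ}
    (h : 0 < β * ε) : ∃ F : ℂ → ℂ,
      ContinuousOn F {z | z.im ∈ Set.Icc (min 0 β) (max 0 β)} ∧
      DifferentiableOn ℂ F {z | z.im ∈ Set.Ioo (min 0 β) (max 0 β)} ∧
      (∃ C : ℝ, ∀ z : ℂ, z.im ∈ Set.Icc (min 0 β) (max 0 β) → ‖F z‖ ≤ C) ∧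
      ∀ z : ℂ, z.im ∈ Set.Icc (min 0 β) (max 0 β) →
        HasSum (fun p : ℕ × ℕ => c * Real.exp (-(p.1 * (β * ε))) * (⟪v p.1, a (v p.2)⟫_ℂ *
          ⟪v p.2, b (v p.1)⟫_ℂ) * Complex.exp (Complex.I * ε * (p.2 - p.1) * z)) (F z) := by
  set f : ℕ × ℕ → ℂ → ℂ := fun p z => c * Real.exp (-(p.1 * (β * ε))) * (⟪v p.1, a (v p.2)⟫_ℂ *
    ⟪v p.2, b (v p.1)⟫_ℂ) * Complex.exp (Complex.I * ε * (p.2 - p.1) * z) with hf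
  have hw : Summable fun k : ℕ => Real.exp (-(k * (β * ε))) := by
    have := Real.summable_exp_nat_mul_of_ge (neg_lt_zero.2 h) (f := fun k => k) (fun k => le_rfl)
    refine this.congr fun k => ?_
    ring_nf
  -- A majorant independent of z on the closed strip. Its two edge terms are summable by the same
  -- estimate, with the roles of a and b exchanged in the second.
  set g : ℕ × ℕ → ℝ := fun p => ‖c‖ * ((Real.exp (-(p.1 * (β * ε))) + Real.exp (-(p.2 * (β * ε)))) *
    (‖⟪v p.1, a (v p.2)⟫_ℂ‖ * ‖⟪v p.2, b (v p.1)⟫_ℂ‖)) with hg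
  have hgs : Summable g := by
    have h1 := hv.summable_matrix a b hw fun k => (Real.exp_pos _).le
    have h2 := (Equiv.prodComm ℕ ℕ).summable_iff.2
      (hv.summable_matrix b a hw fun k => (Real.exp_pos _).le)
    refine ((h1.add h2).mul_left ‖c‖).congr fun p => ?_
    simp only [hg, Function.comp_apply, Equiv.prodComm_apply, Prod.fst_swap, Prod.snd_swap]
    ring
  have hfg : ∀ p (z : ℂ), z.im ∈ Set.Icc (min 0 β) (max 0 β) → ‖f p z‖ ≤ g p := fun p z hz => by
    obtain ⟨h1, h2⟩ := strip_bound h hz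
    have h3 := gibbs_weight_le h1 h2 p.1 p.2
    have h4 : ‖Complex.exp (Complex.I * ε * (p.2 - p.1) * z)‖ =
        Real.exp (-(((p.2 : ℝ) - p.1) * (ε * z.im))) := by
      rw [Complex.norm_exp]
      congr 1
      have : Complex.I * ε * (p.2 - p.1) * z = ((ε * ((p.2 : ℝ) - p.1) : ℝ) : ℂ) * (Complex.I * z) := by
        push_cast
        ring
      rw [this, Complex.re_ofReal_mul, Complex.I_mul_re]
      ring
    simp only [hf, hg, norm_mul, h4, Complex.norm_real, Real.norm_eq_abs, Real.abs_exp]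
    calc _ = ‖c‖ * (Real.exp (-(p.1 * (β * ε))) * Real.exp (-(((p.2 : ℝ) - p.1) * (ε * z.im))) *
          (‖⟪v p.1, a (v p.2)⟫_ℂ‖ * ‖⟪v p.2, b (v p.1)⟫_ℂ‖)) := by ring
      _ ≤ _ := by gcongr
  refine ⟨fun z => ∑' p, f p z, ?_, ?_, ⟨∑' p, g p, fun z hz => ?_⟩, fun z hz => ?_⟩
  · exact continuousOn_tsum (fun p => by simp only [hf]; fun_prop) hgs hfg
  · refine Complex.differentiableOn_tsum_of_summable_norm hgs (fun p => by simp only [hf]; fun_prop)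
      (isOpen_Ioo.preimage Complex.continuous_im) fun p z hz => hfg p z (Set.Ioo_subset_Icc_self hz)
  · exact tsum_of_norm_bounded hgs.hasSum fun p => hfg p z hz
  · exact (Summable.of_norm_bounded hgs fun p => hfg p z hz).hasSum

end Orthonormal

lemma IsFockSystem.star_weyl {E K : Type*} [AddCommGroup E] [Module ℂ E] [NormedAddCommGroup K]
    [InnerProductSpace ℂ K] [CompleteSpace K] {B : E →ₗ⋆[ℂ] E →ₗ[ℂ] ℂ} {W : E → K →L[ℂ] K} {Ω : K}
    (h : IsFockSystem B W Ω) (k : E) : star (W k) = W (-k) := by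
  refine ((ContinuousLinearMap.eq_adjoint_iff _ _).2 fun x y => ?_).symm
  rw [h.inner_weyl_left, neg_neg]

/-! ### The algebra of one mode and the closed span of its number states -/

section Flow

variable {H : Type*} [NormedAddCommGroup H] [InnerProductSpace ℂ H]

lemma conj_mem_topologicalClosure_adjoin {K : Type*} [NormedAddCommGroup K] [InnerProductSpace ℂ K]
    [CompleteSpace K] {S : Set (K →L[ℂ] K)} (V : unitary (K →L[ℂ] K))
    (hS : ∀ s ∈ S, (V : K →L[ℂ] K) * s * star (V : K →L[ℂ] K) ∈ S) {a : K →L[ℂ] K}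
    (ha : a ∈ (StarAlgebra.adjoin ℂ S).topologicalClosure) :
    (V : K →L[ℂ] K) * a * star (V : K →L[ℂ] K) ∈ (StarAlgebra.adjoin ℂ S).topologicalClosure := by
  set A := (StarAlgebra.adjoin ℂ S).topologicalClosure
  set φ : (K →L[ℂ] K) →⋆ₐ[ℂ] (K →L[ℂ] K) :=
    (Unitary.conjStarAlgAut ℂ (K →L[ℂ] K) V : (K →L[ℂ] K) →⋆ₐ[ℂ] (K →L[ℂ] K))
  have hφ : ∀ x, φ x = (V : K →L[ℂ] K) * x * star (V : K →L[ℂ] K) := fun x => rfl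
  have hc : Continuous φ := by
    have : (φ : (K →L[ℂ] K) → (K →L[ℂ] K)) =
      fun x => (V : K →L[ℂ] K) * x * star (V : K →L[ℂ] K) := funext hφ
    rw [this]
    fun_prop
  have h1 : A ≤ A.comap φ := by
    refine StarSubalgebra.topologicalClosure_minimal (StarAlgebra.adjoin_le fun s hs => ?_) ?_
    · exact StarSubalgebra.le_topologicalClosure _ (StarAlgebra.subset_adjoin ℂ _ (hS s hs))
    · exact (StarSubalgebra.isClosed_topologicalClosure _).preimage hc
  exact h1 ha

/-- The mode algebra leaves the closed span of the exponential vectors of the mode invariant. -/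
lemma modeAlgebra_apply_mem {ψ : H} {a : Fock H →L[ℂ] Fock H} (ha : a ∈ modeAlgebra ψ) {x : Fock H}
    (hx : x ∈ (Submodule.span ℂ (Set.range fun z : ℂ =>
      expVec (innerₛₗ ℂ) weyl (vacuum H) (z • ψ))).topologicalClosure) :
    a x ∈ (Submodule.span ℂ (Set.range fun z : ℂ =>
      expVec (innerₛₗ ℂ) weyl (vacuum H) (z • ψ))).topologicalClosure := by
  set M := (Submodule.span ℂ (Set.range fun z : ℂ =>
      expVec (innerₛₗ ℂ) weyl (vacuum H) (z • ψ))).topologicalClosure with hM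
  have hMc : IsClosed (M : Set (Fock H)) := Submodule.isClosed_topologicalClosure _
  have hW : ∀ z : ℂ, ∀ x ∈ M, weyl (z • ψ) x ∈ M := fun z x hx => by
    refine map_mem_closure (weyl (z • ψ)).continuous hx fun y hy => ?_
    induction hy using Submodule.span_induction with
    | mem y hy =>
      obtain ⟨w, rfl⟩ := hy
      simp only [isFockSystem_weyl.weyl_expVec, ← add_smul]
      exact Submodule.smul_mem _ _ (Submodule.subset_span ⟨z + w, rfl⟩)
    | zero => simp
    | add y y' _ _ hy hy' =>
      rw [map_add]
      exact add_mem hy hy'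
    | smul c y _ hy =>
      rw [map_smul]
      exact Submodule.smul_mem _ _ hy
  have hstar : ∀ z : ℂ, star (weyl (z • ψ)) = weyl ((-z) • ψ) := fun z => by
    rw [isFockSystem_weyl.star_weyl, neg_smul]
  -- Invariance is carried for a and its adjoint together, as induction over the generated star
  -- algebra requires.
  have key : ∀ a ∈ StarAlgebra.adjoin ℂ (Set.range fun z : ℂ => weyl (z • ψ)),
      (∀ x ∈ M, a x ∈ M) ∧ ∀ x ∈ M, (star a) x ∈ M := fun a ha => by
    induction ha using StarAlgebra.adjoin_induction with
    | mem a ha =>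
      obtain ⟨z, rfl⟩ := ha
      simp only [hstar]
      exact ⟨hW z, hW (-z)⟩
    | algebraMap r =>
      rw [Algebra.algebraMap_eq_smul_one, star_smul, star_one]
      exact ⟨fun x hx => M.smul_mem _ hx, fun x hx => M.smul_mem _ hx⟩
    | add a b _ _ ha hb =>
      rw [star_add]
      exact ⟨fun x hx => add_mem (ha.1 x hx) (hb.1 x hx), fun x hx => add_mem (ha.2 x hx) (hb.2 x hx)⟩
    | mul a b _ _ ha hb =>
      rw [star_mul]
      exact ⟨fun x hx => ha.1 _ (hb.1 x hx), fun x hx => hb.2 _ (ha.2 x hx)⟩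
    | star a _ ha =>
      rw [star_star]
      exact ⟨ha.2, ha.1⟩
  have hc : Continuous fun a : Fock H →L[ℂ] Fock H => a x := by fun_prop
  have h1 : a x ∈ closure (M : Set (Fock H)) :=
    map_mem_closure (f := fun a : Fock H →L[ℂ] Fock H => a x) hc
      (show a ∈ closure _ from ha) fun a ha => (key a ha).1 x hx
  rwa [hMc.closure_eq] at h1

/-- Fields are derivatives of the curves t ↦ W(t z ψ) x, which stay in this closed subspace, and a
derivative lies in the closed span of its curve. So the creation operator of ψ preserves the
subspace, which contains the vacuum. -/
lemma numberState_mem_closure (ψ : H) (n : ℕ) : numberState ψ n ∈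
    (Submodule.span ℂ (Set.range fun z : ℂ =>
      expVec (innerₛₗ ℂ) weyl (vacuum H) (z • ψ))).topologicalClosure := by
  set M := (Submodule.span ℂ (Set.range fun z : ℂ =>
      expVec (innerₛₗ ℂ) weyl (vacuum H) (z • ψ))).topologicalClosure with hM
  have hMc : IsClosed (M : Set (Fock H)) := Submodule.isClosed_topologicalClosure _
  have hseg : ∀ z : ℂ, ∀ x ∈ M, segalField weyl (z • ψ) x ∈ M := fun z x hx => by
    refine M.smul_mem _ ?_
    have h1 := range_deriv_subset_closure_span_image
      (fun t : ℝ => weyl ((t : ℂ) • z • ψ) x) dense_univ ⟨0, rfl⟩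
    have h2 : (Submodule.span ℝ ((fun t : ℝ => weyl ((t : ℂ) • z • ψ) x) '' Set.univ) : Set (Fock H)) ⊆
        (M.restrictScalars ℝ : Set (Fock H)) := by
      refine Submodule.span_le.2 ?_
      rintro _ ⟨t, -, rfl⟩
      refine modeAlgebra_apply_mem (StarSubalgebra.le_topologicalClosure _
        (StarAlgebra.subset_adjoin ℂ _ ⟨t * z, ?_⟩)) hx
      simp only [mul_smul]
    exact closure_minimal h2 hMc h1
  have hcre : ∀ x ∈ M, creation weyl ψ x ∈ M := fun x hx => by
    refine M.smul_mem _ (M.sub_mem ?_ (M.smul_mem _ (hseg _ x hx)))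
    simpa using hseg 1 x hx
  refine M.smul_mem _ ?_
  induction n with
  | zero =>
    refine Submodule.le_topologicalClosure _ (Submodule.subset_span ⟨0, ?_⟩)
    simp only [zero_smul, isFockSystem_weyl.expVec_zero]
    rfl
  | succ n ih =>
    rw [Function.iterate_succ_apply']
    exact hcre _ ih

/-- The squared coefficients on number states are (|z|²/2)ⁿ/n!, with sum exp(|z|²/2), the squared
norm: equality holds in Bessel's inequality. -/
lemma expVec_mem_closure {ψ : H} (hψ : ‖ψ‖ = 1) (z : ℂ) :
    expVec (innerₛₗ ℂ) weyl (vacuum H) (z • ψ) ∈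
      (Submodule.span ℂ (Set.range (numberState ψ))).topologicalClosure := by
  have ho := orthonormal_numberState hψ
  have hs := ho.hasSum_of_hasSum_norm_sq (x := expVec (innerₛₗ ℂ) weyl (vacuum H) (z • ψ)) (by
    have h1 : ‖expVec (innerₛₗ ℂ) weyl (vacuum H) (z • ψ)‖ ^ 2 = Real.exp (‖z‖ ^ 2 / 2) := by
      have h2 := isFockSystem_weyl.inner_expVec (z • ψ) (z • ψ)
      rw [inner_self_eq_ofReal, innerₛₗ_apply_apply, inner_self_eq_ofReal, norm_smul, hψ, mul_one] at h2
      exact_mod_cast h2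
    rw [h1, Real.exp_eq_exp_ℝ]
    refine (NormedSpace.expSeries_div_hasSum_exp _).congr_fun fun n => ?_
    rw [norm_inner_symm, inner_expVec_numberState]
    simp only [inner_smul_left, inner_self_eq_ofReal, hψ, norm_mul, norm_pow, norm_neg, norm_div,
      Complex.norm_I, Complex.norm_real, RCLike.norm_conj, one_pow, norm_one, mul_one, mul_pow,
      div_pow, Real.norm_eq_abs, ← pow_mul, mul_comm n 2, one_div, abs_inv, inv_pow,
      Real.sq_sqrt (Nat.cast_nonneg _), abs_of_nonneg (Real.sqrt_nonneg _)]
    rw [pow_mul √2, Real.sq_sqrt zero_le_two]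
    ring)
  refine (Submodule.isClosed_topologicalClosure _).mem_of_tendsto hs
    (Filter.Eventually.of_forall fun s => Submodule.sum_mem _ fun j _ => ?_)
  exact Submodule.smul_mem _ _ (Submodule.le_topologicalClosure _ (Submodule.subset_span ⟨j, rfl⟩))

/-- Number states of a single mode are not complete in Fock space in general. This membership is
what permits expanding a|ψ, n⟩ in them. -/
lemma modeAlgebra_numberState_mem {ψ : H} (hψ : ‖ψ‖ = 1) {a : Fock H →L[ℂ] Fock H}
    (ha : a ∈ modeAlgebra ψ) (n : ℕ) :
    a (numberState ψ n) ∈ (Submodule.span ℂ (Set.range (numberState ψ))).topologicalClosure := by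
  refine Submodule.topologicalClosure_minimal _ (Submodule.span_le.2 ?_)
    (Submodule.isClosed_topologicalClosure _)
    (modeAlgebra_apply_mem ha (numberState_mem_closure ψ n))
  rintro _ ⟨z, rfl⟩
  exact expVec_mem_closure hψ z

end Flow

/-! ### Second-quantized flows and the KMS condition -/

section KMS

variable {H : Type*} [NormedAddCommGroup H] [InnerProductSpace ℂ H]

/-- A one-particle isometric flow. -/
structure IsIsometryFlow (V : ℝ → H →ₗᵢ[ℂ] H) : Prop where
  map_add : ∀ s t, V (s + t) = (V s).comp (V t)
  map_zero : V 0 = LinearIsometry.id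

namespace IsIsometryFlow

variable {V : ℝ → H →ₗᵢ[ℂ] H}

lemma comp_neg (hV : IsIsometryFlow V) (t : ℝ) : (V t).comp (V (-t)) = LinearIsometry.id := by
  rw [← hV.map_add, add_neg_cancel, hV.map_zero]

lemma secondQuant_add (hV : IsIsometryFlow V) (s t : ℝ) :
    secondQuant (V (s + t)) = secondQuant (V s) * secondQuant (V t) := by
  rw [secondQuant_mul, hV.map_add]

lemma secondQuant_zero (hV : IsIsometryFlow V) : secondQuant (V 0) = 1 := by
  rw [hV.map_zero, secondQuant_id]

lemma star_secondQuant (hV : IsIsometryFlow V) (t : ℝ) :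
    star (secondQuant (V t)) = secondQuant (V (-t)) := by
  have h1 : secondQuant (V t) * secondQuant (V (-t)) = 1 := by
    rw [← hV.secondQuant_add, add_neg_cancel, hV.secondQuant_zero]
  calc star (secondQuant (V t)) = star (secondQuant (V t)) * (secondQuant (V t) * secondQuant (V (-t))) := by
        rw [h1, mul_one]
    _ = _ := by rw [← mul_assoc, star_secondQuant_mul_self, one_mul]

lemma norm_secondQuant (V : H →ₗᵢ[ℂ] H) (x : Fock H) : ‖secondQuant V x‖ = ‖x‖ := by
  have h1 := inner_secondQuant V x x
  rw [inner_self_eq_ofReal, inner_self_eq_ofReal, Complex.ofReal_inj] at h1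
  exact (pow_left_inj₀ (norm_nonneg _) (norm_nonneg _) two_ne_zero).1 h1

lemma eigenvalue_re (hV : IsIsometryFlow V) {u : ℂ} {v : Fock H}
    (hv : IsGeneratorEigenvector (fun t => secondQuant (V t)) u v) : u.re = 0 :=
  hv.re_eq_zero hV.secondQuant_add hV.secondQuant_zero fun t => norm_secondQuant (V t)

/-- Γ(V(t)) acts on one-particle states through V(t), and f ↦ |f, 1⟩ is injective, so the eigenvalue
equation descends to the mode itself. -/
lemma apply_mode (hV : IsIsometryFlow V) {u : ℂ} {ψ : H}
    (hv : IsGeneratorEigenvector (fun t => secondQuant (V t)) u (numberState ψ 1)) (t : ℝ) :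
    V t ψ = Complex.exp (t * u) • ψ := by
  refine numberState_one_injective ?_
  have h1 := hv.apply_eq hV.secondQuant_add hV.secondQuant_zero t
  simp only [secondQuant_numberState (hV.comp_neg t)] at h1
  simp only [h1, numberState_smul, pow_one]

lemma secondQuant_numberState_eq (hV : IsIsometryFlow V) {u : ℂ} {ψ : H}
    (hu : ∀ t : ℝ, V t ψ = Complex.exp (t * u) • ψ) (t : ℝ) (k : ℕ) :
    secondQuant (V t) (numberState ψ k) = Complex.exp (t * (k * u)) • numberState ψ k := by
  rw [secondQuant_numberState (hV.comp_neg t), hu, numberState_smul, ← Complex.exp_nat_mul]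
  ring_nf

lemma isGeneratorEigenvector_numberState (hV : IsIsometryFlow V) {u : ℂ} {ψ : H} (hψ : ‖ψ‖ = 1)
    (hu : ∀ t : ℝ, V t ψ = Complex.exp (t * u) • ψ) (k : ℕ) :
    IsGeneratorEigenvector (fun t => secondQuant (V t)) (k * u) (numberState ψ k) := by
  refine ⟨(orthonormal_numberState hψ).ne_zero k, ?_⟩
  simp only [hV.secondQuant_numberState_eq hu]
  refine HasDerivAt.smul_const ?_ _
  have := ((Complex.ofRealCLM.hasDerivAt (x := 0)).mul_const (k * u)).cexp
  refine this.congr_deriv ?_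
  simp

/-- The flow leaves the algebra of an eigenmode invariant. -/
lemma flow_mem_modeAlgebra (hV : IsIsometryFlow V) {u : ℂ} {ψ : H}
    (hu : ∀ t : ℝ, V t ψ = Complex.exp (t * u) • ψ) (t : ℝ) {a : Fock H →L[ℂ] Fock H}
    (ha : a ∈ modeAlgebra ψ) :
    secondQuant (V (-t)) * a * secondQuant (V t) ∈ modeAlgebra ψ := by
  have h0 : secondQuant (V t) = star (secondQuant (V (-t))) := by
    rw [hV.star_secondQuant, neg_neg]
  have hu' : secondQuant (V (-t)) ∈ unitary (Fock H →L[ℂ] Fock H) :=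
    mem_unitary_of_isometry (norm_secondQuant _) (V' := secondQuant (V t)) (by
      rw [← hV.secondQuant_add, neg_add_cancel, hV.secondQuant_zero])
  rw [h0]
  refine conj_mem_topologicalClosure_adjoin ⟨_, hu'⟩ ?_ ha
  rintro _ ⟨z, rfl⟩
  -- Conjugation by Γ(V(-t)) moves the test function z ψ within its complex line.
  refine ⟨z * Complex.exp ((-t : ℝ) * u), ?_⟩
  change _ = secondQuant (V (-t)) * weyl (z • ψ) * star (secondQuant (V (-t)))
  rw [secondQuant_mul_weyl, mul_assoc, (Unitary.mem_iff.1 hu').2, mul_one, map_smul, hu, ← mul_smul]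

/-- A Gibbs state of an eigenmode is a KMS state of the flow on the mode algebra. -/
theorem isKMSState (hV : IsIsometryFlow V) {u : ℂ} {ψ : H} (hψ : ‖ψ‖ = 1)
    (hu : ∀ t : ℝ, V t ψ = Complex.exp (t * u) • ψ) {ε β : ℝ} (hε : Complex.I * u = ε)
    (hβ : 0 < β * ε) {c : ℂ} {φ : (Fock H →L[ℂ] Fock H) → ℂ}
    (hφ : ∀ a, HasSum (fun k : ℕ => c * Real.exp (-(k * (β * ε))) *
      ⟪numberState ψ k, a (numberState ψ k)⟫_ℂ) (φ a)) :
    IsKMSState (modeAlgebra ψ) φ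
      (fun t a => secondQuant (V (-t)) * a * secondQuant (V t)) β where
  invariant t a ha := hV.flow_mem_modeAlgebra hu t ha
  kms a ha b hb := by
    have ho := orthonormal_numberState hψ
    obtain ⟨F, hF₁, hF₂, hF₃, hF⟩ := ho.exists_kms_function a b c hβ
    have hu' : u = -(Complex.I * ε) := by
      rw [← hε, ← mul_assoc, Complex.I_mul_I, neg_one_mul, neg_neg]
    -- The evolved operator has the matrix elements of b times exp(iε(j - k)t), the exponential
    -- factor of the KMS series.
    have hflow : ∀ (t : ℝ) (j k : ℕ), ⟪numberState ψ j, (secondQuant (V (-t)) * b * secondQuant (V t))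
        (numberState ψ k)⟫_ℂ = Complex.exp (Complex.I * ε * (j - k) * t) *
          ⟪numberState ψ j, b (numberState ψ k)⟫_ℂ := fun t j k => by
      rw [← hV.star_secondQuant, mul_apply_eq_comp, mul_apply_eq_comp,
        ContinuousLinearMap.star_eq_adjoint, ContinuousLinearMap.adjoint_inner_right,
        hV.secondQuant_numberState_eq hu, hV.secondQuant_numberState_eq hu, map_smul,
        inner_smul_left, inner_smul_right, ← mul_assoc, ← Complex.exp_conj, ← Complex.exp_add, hu']
      simp only [map_mul, map_neg, Complex.conj_ofReal, map_natCast, Complex.conj_I]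
      ring_nf
    -- Number states are inserted as intermediate states; this is legitimate because T belongs to
    -- the mode algebra.
    have hexp : ∀ (x : Fock H) {T : Fock H →L[ℂ] Fock H} (hT : T ∈ modeAlgebra ψ) (k : ℕ),
        HasSum (fun j => ⟪x, numberState ψ j⟫_ℂ * ⟪numberState ψ j, T (numberState ψ k)⟫_ℂ)
          ⟪x, T (numberState ψ k)⟫_ℂ := fun x T hT k => by
      refine ((ho.hasSum_of_mem_closure (modeAlgebra_numberState_mem hψ hT k)).mapL
        (innerSL ℂ x)).congr_fun fun j => ?_
      rw [map_smul, innerSL_apply_apply, smul_eq_mul, mul_comm]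
    refine ⟨F, hF₁, hF₂, hF₃, fun t => ⟨?_, ?_⟩⟩
    · have h1 := (hF t (by simp)).prod_fiberwise (g := fun k : ℕ => c * Real.exp (-(k * (β * ε))) *
        ⟪numberState ψ k, (a * (secondQuant (V (-t)) * b * secondQuant (V t)))
          (numberState ψ k)⟫_ℂ) fun k => by
        have h2 := (hexp (a.adjoint (numberState ψ k)) (hV.flow_mem_modeAlgebra hu t hb) k).mul_left
          (c * Real.exp (-(k * (β * ε))))
        rw [ContinuousLinearMap.adjoint_inner_left] at h2
        refine h2.congr_fun fun j => ?_
        rw [ContinuousLinearMap.adjoint_inner_left, hflow]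
        ring
      exact h1.unique (hφ _)
    · have h0 := hF (t + β * Complex.I) (by simp)
      have h1 := ((Equiv.prodComm ℕ ℕ).hasSum_iff.2 h0).prod_fiberwise
        (g := fun k : ℕ => c * Real.exp (-(k * (β * ε))) *
          ⟪numberState ψ k, (secondQuant (V (-t)) * b * secondQuant (V t) * a)
            (numberState ψ k)⟫_ℂ) fun j => by
        have h2 := (hexp ((secondQuant (V (-t)) * b * secondQuant (V t)).adjoint (numberState ψ j))
          ha j).mul_left (c * Real.exp (-(j * (β * ε))))
        rw [ContinuousLinearMap.adjoint_inner_left] at h2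
        refine h2.congr_fun fun k => ?_
        rw [ContinuousLinearMap.adjoint_inner_left, hflow]
        simp only [Function.comp_apply, Equiv.prodComm_apply, Prod.swap_prod_mk]
        -- At Im z = β the Gibbs weight passes from the index k to the index j, which exchanges a
        -- and the evolved b in the trace.
        have h3 : (Real.exp (-(k * (β * ε))) : ℂ) * Complex.exp (Complex.I * ε * (j - k) *
            (t + β * Complex.I)) = Real.exp (-(j * (β * ε))) *
              Complex.exp (Complex.I * ε * (j - k) * t) := by
          push_cast
          rw [← Complex.exp_add, ← Complex.exp_add]
          congr 1
          linear_combination (ε * (j - k) * β : ℂ) * Complex.I_mul_I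
        linear_combination c * (⟪numberState ψ k, a (numberState ψ j)⟫_ℂ *
          ⟪numberState ψ j, b (numberState ψ k)⟫_ℂ) * h3
      exact h1.unique (hφ _)

end IsIsometryFlow

end KMS

/-! ### Symplectic maps and their implementation on the Weyl algebra -/

section Bogoliubov

variable {H : Type*} [NormedAddCommGroup H] [InnerProductSpace ℂ H]

/-- Conjugation by U and by its adjoint both map Weyl generators to Weyl generators. By continuity
both preserve the generated C*-algebra, where they are mutually inverse. -/
lemma isImplementedBogoliubov_of_intertwines {T : (H × H) ≃L[ℝ] (H × H)}
    {U : unitary (DFock H →L[ℂ] DFock H)}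
    (hT : ∀ p q, symplecticForm (T p) (T q) = symplecticForm p q)
    (hU : ∀ p, (U : DFock H →L[ℂ] DFock H) * dweyl p = dweyl (T p) * (U : DFock H →L[ℂ] DFock H)) :
    IsImplementedBogoliubov T U where
  symplectic := hT
  implemented := by
    have h1 : ∀ p, (U : DFock H →L[ℂ] DFock H) * dweyl p * star (U : DFock H →L[ℂ] DFock H) =
        dweyl (T p) := fun p => by
      rw [hU, mul_assoc, (Unitary.mem_iff.1 U.2).2, mul_one]
    have h2 : ∀ p, star (U : DFock H →L[ℂ] DFock H) * dweyl p * (U : DFock H →L[ℂ] DFock H) =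
        dweyl (T.symm p) := fun p => by
      have := hU (T.symm p)
      rw [T.apply_symm_apply] at this
      rw [mul_assoc, ← this, ← mul_assoc, (Unitary.mem_iff.1 U.2).1, one_mul]
    set e := Unitary.conjStarAlgAut ℂ (DFock H →L[ℂ] DFock H) U
    have hm : ∀ a ∈ dweylAlgebra H, e a ∈ dweylAlgebra H := fun a ha =>
      conj_mem_topologicalClosure_adjoin U
        (by rintro _ ⟨p, rfl⟩; exact ⟨T p, (h1 p).symm⟩) ha
    have hm' : ∀ a ∈ dweylAlgebra H, e.symm a ∈ dweylAlgebra H := fun a ha => by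
      have := conj_mem_topologicalClosure_adjoin (star U)
        (by rintro _ ⟨p, rfl⟩; exact ⟨T.symm p, by simp [h2]⟩) ha
      rwa [Unitary.coe_star, star_star] at this
    have hs : ∀ a, e (star a) = star (e a) := fun a => by simp [e, mul_assoc]
    refine ⟨{ toFun := fun a => ⟨e a, hm a a.2⟩
              invFun := fun a => ⟨e.symm a, hm' a a.2⟩
              left_inv := fun a => Subtype.ext (e.symm_apply_apply _)
              right_inv := fun a => Subtype.ext (e.apply_symm_apply _)
              map_mul' := fun a b => Subtype.ext (map_mul e _ _)
              map_add' := fun a b => Subtype.ext (map_add e _ _)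
              map_star' := fun a => Subtype.ext (hs _)
              map_smul' := fun c a => Subtype.ext (map_smul e c _) }, fun p => ?_, fun a => rfl⟩
    exact Subtype.ext (h1 p)

lemma squeezeMap_eq (ψ ψ' : H) (b : ℂ) (t : ℝ) (p : H × H) :
    squeezeMap ψ ψ' (phase b) (Real.cosh (‖b‖ * t)) (Real.sinh (‖b‖ * t)) p =
      IsFockSystem.squeezeFlow (dform H) (ψ, 0) (0, ψ') b t p := by
  simp [squeezeMap, IsFockSystem.squeezeFlow, IsFockSystem.squeeze, dform_apply, Prod.ext_iff]

lemma symplecticForm_squeezeMap {ψ ψ' : H} (hψ : ‖ψ‖ = 1) (hψ' : ‖ψ'‖ = 1) {c : ℂ}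
    (hc : c * conj c = 1) {C S : ℝ} (hCS : C ^ 2 - S ^ 2 = 1) (p q : H × H) :
    symplecticForm (squeezeMap ψ ψ' c C S p) (squeezeMap ψ ψ' c C S q) = symplecticForm p q := by
  -- Comparing imaginary parts through z - z̄ makes the claim polynomial in inner products, to be
  -- settled by C² - S² = 1 and c c̄ = 1.
  have key : ∀ z w : ℂ, z - conj z = w - conj w → z.im = w.im := fun z w h => by
    have := congrArg Complex.im h
    simp only [Complex.sub_im, Complex.conj_im] at this
    linarith
  have hCS' : (C : ℂ) ^ 2 - (S : ℂ) ^ 2 = 1 := by exact_mod_cast hCS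
  refine key _ _ ?_
  simp only [squeezeMap, inner_add_left, inner_add_right, inner_smul_left,
    inner_smul_right, inner_self_eq_ofReal, hψ, hψ', map_add, map_sub, map_mul, Complex.conj_ofReal,
    Complex.conj_conj, inner_conj_symm, map_one, one_pow, Complex.ofReal_one, mul_one]
  linear_combination (⟪p.1, ψ⟫_ℂ * ⟪ψ, q.1⟫_ℂ - ⟪ψ, p.1⟫_ℂ * ⟪q.1, ψ⟫_ℂ +
    ⟪p.2, ψ'⟫_ℂ * ⟪ψ', q.2⟫_ℂ - ⟪ψ', p.2⟫_ℂ * ⟪q.2, ψ'⟫_ℂ) * (hCS' - (S : ℂ) ^ 2 * hc)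

lemma squeezeMap_add (ψ ψ' : H) (c : ℂ) (C S : ℝ) (p q : H × H) :
    squeezeMap ψ ψ' c C S (p + q) = squeezeMap ψ ψ' c C S p + squeezeMap ψ ψ' c C S q := by
  simp only [squeezeMap, Prod.fst_add, Prod.snd_add, inner_add_right, map_add, Prod.mk_add_mk,
    Prod.mk.injEq]
  exact ⟨by module, by module⟩

lemma squeezeMap_real_smul (ψ ψ' : H) (c : ℂ) (C S : ℝ) (r : ℝ) (p : H × H) :
    squeezeMap ψ ψ' c C S (r • p) = r • squeezeMap ψ ψ' c C S p := by
  simp only [squeezeMap, Prod.smul_fst, Prod.smul_snd, Prod.smul_mk, Prod.mk.injEq,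
    ← Complex.coe_smul, inner_smul_right, map_mul, Complex.conj_ofReal]
  exact ⟨by module, by module⟩

/-- The squeezing transformation of test functions. -/
noncomputable def squeezeEquiv {ψ ψ' : H} (hψ : ‖ψ‖ = 1) (hψ' : ‖ψ'‖ = 1) (b : ℂ) :
    (H × H) ≃L[ℝ] (H × H) :=
  have hinv : ∀ t p, squeezeMap ψ ψ' (phase b) (Real.cosh (‖b‖ * t)) (Real.sinh (‖b‖ * t))
      (squeezeMap ψ ψ' (phase b) (Real.cosh (‖b‖ * -t)) (Real.sinh (‖b‖ * -t)) p) = p := fun t p => by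
    rw [squeezeMap_eq, squeezeMap_eq, IsFockSystem.squeezeFlow_neg (isModePair hψ hψ')]
  { toFun := squeezeMap ψ ψ' (phase b) (Real.cosh (‖b‖ * 1)) (Real.sinh (‖b‖ * 1))
    invFun := squeezeMap ψ ψ' (phase b) (Real.cosh (‖b‖ * -1)) (Real.sinh (‖b‖ * -1))
    left_inv := fun p => by simpa using hinv (-1) p
    right_inv := hinv 1
    map_add' := squeezeMap_add _ _ _ _ _
    map_smul' := squeezeMap_real_smul _ _ _ _ _
    continuous_toFun := by
      unfold squeezeMap
      fun_prop
    continuous_invFun := by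
      unfold squeezeMap
      fun_prop }

end Bogoliubov

/-! ### Implementation, phase removal, Weyl functional and temperature of the squeezed vacuum -/

section Squeezing

variable {H : Type*} [NormedAddCommGroup H] [InnerProductSpace ℂ H] {ψ ψ' : H} {b : ℂ}
  {U : ℝ → unitary (DFock H →L[ℂ] DFock H)}

lemma squeezeEquiv_apply (hψ : ‖ψ‖ = 1) (hψ' : ‖ψ'‖ = 1) (b : ℂ) (p : H × H) :
    squeezeEquiv hψ hψ' b p =
      squeezeMap ψ ψ' (phase b) (Real.cosh ‖b‖) (Real.sinh ‖b‖) p := by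
  change squeezeMap ψ ψ' (phase b) (Real.cosh (‖b‖ * 1)) (Real.sinh (‖b‖ * 1)) p = _
  rw [mul_one]

/-- The squeezing operator implements the squeezing transformation. -/
theorem isImplementedBogoliubov_squeezeEquiv (hψ : ‖ψ‖ = 1) (hψ' : ‖ψ'‖ = 1)
    (hU : IsSqueezingGroup ψ ψ' b U) :
    IsImplementedBogoliubov (squeezeEquiv hψ hψ' b) (U 1) := by
  refine isImplementedBogoliubov_of_intertwines (fun p q => ?_) fun p => ?_
  · rw [squeezeEquiv_apply, squeezeEquiv_apply]
    exact symplecticForm_squeezeMap hψ hψ' (phase_mul_conj b)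
      (Real.cosh_sq_sub_sinh_sq _) p q
  · rw [isFockSystem_dweyl.pairGroup_weyl (isModePair hψ hψ') hU.isPairGroup, ← squeezeMap_eq,
      squeezeEquiv_apply, mul_one]

/-- Multiplication by a phase. -/
noncomputable def phaseIsometry (H : Type*) [NormedAddCommGroup H] [InnerProductSpace ℂ H] {c : ℂ}
    (hc : ‖c‖ = 1) : H →ₗᵢ[ℂ] H :=
  ⟨c • LinearMap.id, fun x => by simp [norm_smul, hc]⟩

lemma phaseIsometry_apply {c : ℂ} (hc : ‖c‖ = 1) (x : H) : phaseIsometry H hc x = c • x := rfl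

lemma phaseIsometry_comp {c c' : ℂ} (hc : ‖c‖ = 1) (hc' : ‖c'‖ = 1) (h : c * c' = 1) :
    (phaseIsometry H hc).comp (phaseIsometry H hc') = LinearIsometry.id := by
  ext x
  change c • c' • x = x
  rw [smul_smul, h, one_smul]

lemma prodOp_mul (a b a' b' : Fock H →L[ℂ] Fock H) :
    prodOp a b * prodOp a' b' = prodOp (a * a') (b * b') := by
  refine dfock_op_ext fun v w => ?_
  rw [mul_apply_eq_comp, prodOp_prodVec, prodOp_prodVec, prodOp_prodVec]
  rfl

lemma prodOp_one : prodOp (1 : Fock H →L[ℂ] Fock H) 1 = 1 :=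
  dfock_op_ext fun _ _ => prodOp_prodVec _ _ _ _

/-- A phase of the tilde mode is removed by an implemented Bogoliubov transformation. -/
theorem exists_remove_phase (ψ : H) (ψ' : H) {c : ℂ} (hc : ‖c‖ = 1) :
    ∃ (R : (H × H) ≃L[ℝ] (H × H)) (V : unitary (DFock H →L[ℂ] DFock H)),
      IsImplementedBogoliubov R V ∧ ∀ n, (V : DFock H →L[ℂ] DFock H)
        (prodVec (numberState ψ n) (numberState (c • ψ') n)) =
          prodVec (numberState ψ n) (numberState ψ' n) := by
  have hc' : ‖conj c‖ = 1 := by rwa [RCLike.norm_conj]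
  have hcc : c * conj c = 1 := by rw [Complex.mul_conj']; simp [hc]
  have hcc' : conj c * c = 1 := by rwa [mul_comm]
  -- The unitary second-quantizes multiplication by c̄ in the tilde factor, which takes c ψ' back to
  -- ψ'.
  have hu : prodOp 1 (secondQuant (phaseIsometry H hc')) ∈ unitary (DFock H →L[ℂ] DFock H) := by
    refine mem_unitary_of_isometry (V' := prodOp 1 (secondQuant (phaseIsometry H hc))) ?_ ?_
    · refine ContinuousLinearMap.norm_map_iff_adjoint_comp_self _ |>.2 ?_
      refine isFockSystem_dweyl.adjoint_mul_self fun ⟨f, g⟩ ⟨f', g'⟩ => ?_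
      rw [expVec_prod, expVec_prod, prodOp_prodVec, prodOp_prodVec, inner_prodVec, inner_prodVec,
        inner_secondQuant]
      rfl
    · rw [prodOp_mul, secondQuant_mul, phaseIsometry_comp hc' hc hcc', secondQuant_id, one_mul,
        prodOp_one]
  let R : (H × H) ≃L[ℝ] (H × H) :=
    { toFun := fun p => (p.1, conj c • p.2)
      invFun := fun p => (p.1, c • p.2)
      left_inv := fun p => by simp [smul_smul, hcc]
      right_inv := fun p => by simp [smul_smul, hcc']
      map_add' := fun p q => by simp
      map_smul' := fun r p => by simp [smul_comm r]
      continuous_toFun := by fun_prop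
      continuous_invFun := by fun_prop }
  refine ⟨R, ⟨_, hu⟩, isImplementedBogoliubov_of_intertwines (fun p q => ?_) (fun p => ?_),
    fun n => ?_⟩
  · change (⟪p.1, q.1⟫_ℂ + ⟪conj c • p.2, conj c • q.2⟫_ℂ).im = _
    rw [inner_smul_left, inner_smul_right, ← mul_assoc, Complex.conj_conj, hcc, one_mul]
    rfl
  · change prodOp _ _ * prodOp _ _ = prodOp (weyl p.1) (weyl (conj c • p.2)) * prodOp _ _
    rw [prodOp_mul, prodOp_mul, secondQuant_mul_weyl, phaseIsometry_apply, one_mul, mul_one]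
  · change prodOp _ _ _ = _
    rw [prodOp_prodVec, secondQuant_numberState (phaseIsometry_comp hc' hc hcc'),
      phaseIsometry_apply, smul_smul, hcc', one_smul, one_apply_eq_self]

/-- The Weyl functional of the reduced squeezed vacuum. -/
theorem reducedState_squeezedVacuum_weyl (hψ : ‖ψ‖ = 1) (hψ' : ‖ψ'‖ = 1)
    (hU : IsSqueezingGroup ψ ψ' b U) (z : ℂ) : reducedState (squeezedVacuum U) (weyl (z • ψ)) =
      Complex.exp (-(((Real.cosh ‖b‖ ^ 2 + Real.sinh ‖b‖ ^ 2) * ‖z‖ ^ 2 / 4 : ℝ) : ℂ)) := by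
  have hm := isModePair hψ hψ'
  -- p is (z ψ, 0) under the inverse squeezing: pulled through U(1), the Weyl operator becomes W(p),
  -- and a vacuum expectation remains.
  set p := IsFockSystem.squeezeFlow (dform H) (ψ, 0) (0, ψ') b (-1) (z • (ψ, 0)) with hp
  have h1 : prodOp (weyl (z • ψ)) 1 = dweyl (z • ((ψ, 0) : H × H)) := by
    rw [dweyl, Prod.smul_fst, Prod.smul_snd, smul_zero, isFockSystem_weyl.weyl_zero_op]
  have h2 := isFockSystem_dweyl.pairGroup_weyl hm hU.isPairGroup p 1
  rw [hp, IsFockSystem.squeezeFlow_neg hm, ← hp] at h2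
  have h3 : prodOp (weyl (z • ψ)) 1 (squeezedVacuum U) =
      (U 1 : DFock H →L[ℂ] DFock H) (dweyl p (dvacuum H)) := by
    rw [h1]
    exact (congrArg (fun T : DFock H →L[ℂ] DFock H => T (dvacuum H)) h2).symm
  have h4 := isFockSystem_dweyl.inner_weyl 0 p
  rw [isFockSystem_dweyl.weyl_zero] at h4
  rw [reducedState, h3, squeezedVacuum, inner_unitary_apply, h4]
  congr 1
  have hs := IsFockSystem.squeezeFlow_one (b := b) hm 1 z
  -- The components of p have coefficients cosh · z and phase · sinh · z̄, whose squared moduli add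
  -- up to (cosh² + sinh²)|z|².
  rw [← hp, mul_one] at hs
  have hph := phase_mul_conj b
  have hz : z * conj z = (‖z‖ : ℂ) ^ 2 := Complex.mul_conj' z
  rw [hs]
  simp only [map_add, map_smul, map_smulₛₗ, LinearMap.add_apply, LinearMap.smul_apply, smul_eq_mul,
    hm.one_one, hm.one_two, hm.two_one, hm.two_two, map_mul, Complex.conj_ofReal, Complex.conj_conj,
    map_zero, LinearMap.zero_apply]
  push_cast
  linear_combination (-(Complex.cosh ‖b‖ ^ 2 + Complex.sinh ‖b‖ ^ 2) / 4) * hz -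
    (Complex.sinh ‖b‖ ^ 2 * (z * conj z) / 4) * hph

lemma exp_neg_two_log_tanh {r : ℝ} (hr : 0 < r) :
    Real.exp (-(-2 * Real.log (Real.tanh r)) / 2) = Real.tanh r := by
  have h1 : 0 < Real.tanh r := by
    rw [Real.tanh_eq_sinh_div_cosh]
    exact div_pos (Real.sinh_pos_iff.2 hr) (Real.cosh_pos r)
  rw [show -(-2 * Real.log (Real.tanh r)) / 2 = Real.log (Real.tanh r) by ring, Real.exp_log h1]

/-- The squeezing parameter as an inverse temperature. -/
lemma exists_thermal_parameter {r : ℝ} (hr : 0 < r) : ∃ τ : ℝ, 0 < τ ∧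
    Real.exp (-τ / 2) = Real.tanh r ∧ 1 - Real.exp (-τ) = (Real.cosh r ^ 2)⁻¹ ∧
    Real.cosh r = (1 - Real.exp (-τ)) ^ (-(1 / 2) : ℝ) ∧
    Real.sinh r = Real.exp (-τ / 2) * (1 - Real.exp (-τ)) ^ (-(1 / 2) : ℝ) ∧
    Real.cosh (τ / 2) / Real.sinh (τ / 2) = Real.cosh r ^ 2 + Real.sinh r ^ 2 ∧
    ∀ τ', 0 < τ' → Real.cosh r = (1 - Real.exp (-τ')) ^ (-(1 / 2) : ℝ) → τ' = τ := by
  have hC := Real.cosh_pos r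
  have hS := Real.sinh_pos_iff.2 hr
  have ht : 0 < Real.tanh r := by
    rw [Real.tanh_eq_sinh_div_cosh]
    exact div_pos hS hC
  have ht1 := one_sub_tanh_sq r
  have ht2 : Real.tanh r < 1 := by
    have : 0 < (Real.cosh r ^ 2)⁻¹ := by positivity
    nlinarith
  -- Chosen so that exp(-τ/2) = tanh r; the other relations then follow from 1 - tanh² = cosh⁻².
  set τ := -2 * Real.log (Real.tanh r) with hτ
  have h1 : Real.exp (-τ / 2) = Real.tanh r := exp_neg_two_log_tanh hr
  have h2 : 1 - Real.exp (-τ) = (Real.cosh r ^ 2)⁻¹ := by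
    rw [← ht1, ← h1, ← Real.exp_nat_mul]
    congr 2
    push_cast
    ring
  have h3 : Real.cosh r = (1 - Real.exp (-τ)) ^ (-(1 / 2) : ℝ) := by
    rw [h2, Real.rpow_neg (by positivity), ← Real.sqrt_eq_rpow, Real.sqrt_inv,
      Real.sqrt_sq hC.le, inv_inv]
  refine ⟨τ, ?_, h1, h2, h3, ?_, ?_, fun τ' hτ' h => ?_⟩
  · have := Real.log_neg ht ht2
    linarith
  · rw [← h3, h1, Real.tanh_eq_sinh_div_cosh, div_mul_cancel₀ _ hC.ne']
  · have h4 : Real.exp (τ / 2) = (Real.tanh r)⁻¹ := by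
      rw [← h1, ← Real.exp_neg]
      ring_nf
    have h5 : Real.exp (-(τ / 2)) = Real.tanh r := by rw [← h1]; ring_nf
    rw [Real.cosh_eq (τ / 2), Real.sinh_eq (τ / 2), h4, h5, Real.tanh_eq_sinh_div_cosh, inv_div]
    have h6 := Real.cosh_sq r
    have h7 : Real.cosh r / Real.sinh r - Real.sinh r / Real.cosh r ≠ 0 := by
      rw [div_sub_div _ _ hS.ne' hC.ne']
      have : Real.cosh r * Real.cosh r - Real.sinh r * Real.sinh r = 1 := by linarith
      rw [this]
      positivity
    rw [div_div_div_cancel_right₀ two_ne_zero, div_eq_iff h7]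
    field_simp
    linear_combination -h6
  · have hx : 0 < 1 - Real.exp (-τ') := by
      rw [sub_pos, Real.exp_lt_one_iff]
      linarith
    have hy : 0 < 1 - Real.exp (-τ) := by rw [h2]; positivity
    -- Uniqueness: x ↦ x^(-1/2) is injective here, and so is the exponential.
    have h4 := Real.rpow_left_injOn (x := -(1 / 2)) (by norm_num) hx.le hy.le (h.symm.trans h3)
    have h5 : Real.exp (-τ') = Real.exp (-τ) := by linarith
    linarith [Real.exp_injective h5]

end Squeezing

/-! ### The thermofield double for an isometric flow -/

section ThermofieldDouble

variable {H : Type*} [NormedAddCommGroup H] [InnerProductSpace ℂ H]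

/-- The squeezed vacuum is the thermofield double state of an isometric flow, at the temperature
given by the squeezing parameter. -/
theorem thermofieldDouble {ψ ψ' : H} (hψ : ‖ψ‖ = 1) (hψ' : ‖ψ'‖ = 1) {b : ℂ} (hb : b ≠ 0)
    {U : ℝ → unitary (DFock H →L[ℂ] DFock H)} (hU : IsSqueezingGroup ψ ψ' b U)
    {V : ℝ → H →ₗᵢ[ℂ] H} (hV : IsIsometryFlow V) {u : ℂ} (hu : u ≠ 0)
    (hv : ∃ v, IsGeneratorEigenvector (fun t => secondQuant (V t)) u v) :
    ∃ ε β Z : ℝ,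
      Complex.I * u = ε ∧ 0 < β * ε ∧
      Real.cosh ‖b‖ = (1 - Real.exp (-(β * ε))) ^ (-(1 / 2) : ℝ) ∧
      Real.sinh ‖b‖ = Real.exp (-(β * ε) / 2) * (1 - Real.exp (-(β * ε))) ^ (-(1 / 2) : ℝ) ∧
      (∀ β' : ℝ, 0 < β' * ε →
        Real.cosh ‖b‖ = (1 - Real.exp (-(β' * ε))) ^ (-(1 / 2) : ℝ) → β' = β) ∧
      HasSum (fun k : ℕ => Complex.exp (-(Complex.I * k * β * u))) (Z : ℂ) ∧
      (Z : ℂ) = (1 - Complex.exp (-(Complex.I * β * u)))⁻¹ ∧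
      IsTFDState ψ (phase b • ψ') Z β u (squeezedVacuum U) ∧
      (∃ (R : (H × H) ≃L[ℝ] (H × H)) (V : unitary (DFock H →L[ℂ] DFock H)),
        IsImplementedBogoliubov R V ∧
        IsTFDState ψ ψ' Z β u ((V : DFock H →L[ℂ] DFock H) (squeezedVacuum U))) ∧
      (∀ a : Fock H →L[ℂ] Fock H,
        HasSum (fun k : ℕ => (Z : ℂ)⁻¹ * Complex.exp (-(Complex.I * k * β * u)) *
          ⟪numberState ψ k, a (numberState ψ k)⟫_ℂ) (reducedState (squeezedVacuum U) a)) ∧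
      (∀ z : ℂ, reducedState (squeezedVacuum U) (weyl (z • ψ)) =
        Complex.exp
          (-((Real.cosh (β * ε / 2) / Real.sinh (β * ε / 2) * ‖z‖ ^ 2 / 4 : ℝ) : ℂ))) ∧
      (IsGeneratorEigenvector (fun t => secondQuant (V t)) u (numberState ψ 1) →
        (∀ k : ℕ, IsGeneratorEigenvector (fun t => secondQuant (V t)) (k * u) (numberState ψ k)) ∧
        IsKMSState (modeAlgebra ψ) (reducedState (squeezedVacuum U))
          (fun t a => secondQuant (V (-t)) * a * secondQuant (V t)) β) := by
  obtain ⟨v, hv⟩ := hv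
  have hre := hV.eigenvalue_re hv
  have hε : Complex.I * u = ((-u.im : ℝ) : ℂ) := by
    apply Complex.ext <;> simp [hre]
  set ε := -u.im
  have hε0 : ε ≠ 0 := fun h0 => by
    rw [h0, Complex.ofReal_zero, mul_eq_zero] at hε
    exact hε.elim Complex.I_ne_zero hu
  obtain ⟨τ, hτ, ht, hZ, hcosh, hsinh, hcoth, huniq⟩ := exists_thermal_parameter (norm_pos_iff.2 hb)
  -- The squeezing fixes only τ = βε; the eigenvalue converts it into β, with the sign of ε. The
  -- partition function is Z = cosh²|b|.
  have hβ : τ / ε * ε = τ := div_mul_cancel₀ _ hε0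
  set β := τ / ε
  have hC := Real.cosh_pos ‖b‖
  have hexp : ∀ k : ℕ, Complex.exp (-(Complex.I * k * β * u)) = Real.exp (-(k * (β * ε))) := fun k => by
    have : -(Complex.I * k * β * u) = ((-(k * (β * ε)) : ℝ) : ℂ) := by
      push_cast
      linear_combination -(k * β : ℂ) * hε
    rw [this, Complex.ofReal_exp]
  have hexp2 : ∀ k : ℕ, Complex.exp (-(Complex.I * k * β * u / 2)) = (Real.tanh ‖b‖ : ℂ) ^ k :=
      fun k => by
    have : -(Complex.I * k * β * u / 2) = ((k * (-τ / 2) : ℝ) : ℂ) := by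
      rw [← hβ]
      push_cast
      linear_combination -(k * β / 2 : ℂ) * hε
    rw [this, ← Complex.ofReal_exp, Real.exp_nat_mul, ht, Complex.ofReal_pow]
  have hpow : ∀ k : ℕ, Real.exp (-(k * τ)) = Real.exp (-τ) ^ k := fun k => by
    rw [← Real.exp_nat_mul]
    ring_nf
  have hsq : √(Real.cosh ‖b‖ ^ 2) = Real.cosh ‖b‖ := Real.sqrt_sq hC.le
  have hZ' : (1 - Real.exp (-τ))⁻¹ = Real.cosh ‖b‖ ^ 2 := by rw [hZ, inv_inv]
  have hexpand := hasSum_squeezedVacuum hψ hψ' hU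
  have htfd : IsTFDState ψ (phase b • ψ') (Real.cosh ‖b‖ ^ 2) β u (squeezedVacuum U) := by
    refine hexpand.congr_fun fun n => ?_
    rw [hexp2, hsq, numberState_smul, ← prodVecL_apply, ← prodVecL_apply, map_smul, smul_smul]
    congr 1
    push_cast
    ring
  have hred : ∀ a : Fock H →L[ℂ] Fock H,
      HasSum (fun k : ℕ => ((Real.cosh ‖b‖ ^ 2 : ℝ) : ℂ)⁻¹ * Real.exp (-(k * (β * ε))) *
        ⟪numberState ψ k, a (numberState ψ k)⟫_ℂ) (reducedState (squeezedVacuum U) a) := fun a => by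
    refine (hasSum_reducedState (orthonormal_numberState hψ') hexpand a).congr_fun fun k => ?_
    have h1 : Real.exp (-(k * τ)) = (Real.tanh ‖b‖ ^ k) ^ 2 := by
      rw [← ht, ← Real.exp_nat_mul, ← Real.exp_nat_mul]
      congr 1
      push_cast
      ring
    -- The phase of b cancels in the diagonal weights, so the reduced state does not see it.
    have h2 : conj (phase b) ^ k * phase b ^ k = 1 := by
      rw [← mul_pow, mul_comm, phase_mul_conj, one_pow]
    rw [hβ, h1]
    simp only [map_mul, map_inv₀, map_pow, Complex.conj_ofReal, mul_pow]
    push_cast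
    linear_combination -(((Complex.cosh ‖b‖)⁻¹ ^ 2 * (Complex.tanh ‖b‖ ^ k) ^ 2) *
      ⟪numberState ψ k, a (numberState ψ k)⟫_ℂ) * h2
  refine ⟨ε, β, Real.cosh ‖b‖ ^ 2, hε, by rwa [hβ], by rwa [hβ], by rwa [hβ], fun β' hβ' h => ?_, ?_,
    ?_, htfd, ?_, fun a => ?_, fun z => ?_, fun hv1 => ?_⟩
  · rw [eq_div_iff hε0]
    exact huniq _ hβ' h
  · simp only [hexp, hβ, hpow]
    rw [← hZ']
    exact_mod_cast hasSum_geometric_of_lt_one (Real.exp_pos _).le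
      (Real.exp_lt_one_iff.2 (neg_lt_zero.2 hτ))
  · have := hexp 1
    rw [Nat.cast_one, Nat.cast_one, mul_one, one_mul, hβ] at this
    rw [this, ← hZ']
    push_cast
    rfl
  · obtain ⟨R, V, hRV, hV⟩ := exists_remove_phase ψ ψ' (norm_phase b)
    refine ⟨R, V, hRV, (htfd.mapL (V : DFock H →L[ℂ] DFock H)).congr_fun fun n => ?_⟩
    rw [map_smul, hV]
  · simp only [hexp]
    exact hred a
  · rw [reducedState_squeezedVacuum_weyl hψ hψ' hU, hβ, hcoth]
  · have hmode := hV.apply_mode hv1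
    exact ⟨hV.isGeneratorEigenvector_numberState hψ hmode,
      hV.isKMSState hψ hmode hε (by rwa [hβ]) hred⟩

end ThermofieldDouble

/-! ### Left translations of group fields -/

section Translations

open MeasureTheory

/-- The operator depends on a proof that its map preserves the measure, so equal maps are exchanged
by substitution rather than rewriting. -/
lemma compMeasurePreserving_congr {X : Type*} [MeasurableSpace X] {μ : Measure X} {f f' : X → X}
    (h : f = f') (hf : MeasurePreserving f μ μ) (hf' : MeasurePreserving f' μ μ) (φ : Lp ℂ 2 μ) :
    Lp.compMeasurePreserving f hf φ = Lp.compMeasurePreserving f' hf' φ := by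
  subst h
  rfl

variable {G : Type*} [Group G] [MeasurableSpace G] [MeasurableMul G]

/-- Left translations along one-parameter subgroups form an isometric flow. -/
lemma isIsometryFlow_leftTranslation {n : ℕ} (μ : Measure G) [SigmaFinite μ]
    [μ.IsMulLeftInvariant] {γ : Fin n → ℝ → G} (hγ : ∀ i s t, γ i (s + t) = γ i s * γ i t) :
    IsIsometryFlow fun t => leftTranslation μ fun i => γ i t where
  map_add s t := by
    ext1 φ
    change Lp.compMeasurePreserving _ _ φ =
      Lp.compMeasurePreserving _ _ (Lp.compMeasurePreserving _ _ φ)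
    -- The inverse in φ(a⁻¹ g) reverses products and composition of pullbacks reverses them again,
    -- so the flow has the order of the group law.
    rw [← Lp.compMeasurePreserving_comp_apply]
    refine compMeasurePreserving_congr (funext fun g => funext fun i => ?_) _ _ φ
    simp [hγ, mul_assoc]
  map_zero := by
    ext1 φ
    change Lp.compMeasurePreserving _ _ φ = φ
    refine (compMeasurePreserving_congr (funext fun g => funext fun i => ?_) _ (.id _) φ).trans
      (Lp.compMeasurePreserving_id_apply φ)
    have h0 : γ i 0 = 1 := by
      have := hγ i 0 0
      rwa [add_zero, left_eq_mul] at this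
    simp [h0]

end Translations

theorem mainTheorem1
    {E : Type*} [NormedAddCommGroup E] [NormedSpace ℝ E] [FiniteDimensional ℝ E]
    {G : Type*} [Group G] [TopologicalSpace G] [ChartedSpace E G] [LieGroup 𝓘(ℝ, E) ∞ G]
    [IsTopologicalGroup G]
    [T2Space G] [SecondCountableTopology G] [LocallyCompactSpace G]
    [MeasurableSpace G] [BorelSpace G]
    (μ : MeasureTheory.Measure G) [μ.IsHaarMeasure] (n : ℕ)
    (ψ ψ' : GroupFields n μ) (hψ : ‖ψ‖ = 1) (hψ' : ‖ψ'‖ = 1) (b : ℂ) :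
    (∃! U : ℝ → unitary (DFock (GroupFields n μ) →L[ℂ] DFock (GroupFields n μ)),
      IsSqueezingGroup ψ ψ' b U) ∧
    ∀ U : ℝ → unitary (DFock (GroupFields n μ) →L[ℂ] DFock (GroupFields n μ)),
      IsSqueezingGroup ψ ψ' b U →
      -- the Bogoliubov transformation implemented by `U 1`, on test functions
      (∃ T : (GroupFields n μ × GroupFields n μ) ≃L[ℝ] (GroupFields n μ × GroupFields n μ),
        IsImplementedBogoliubov T (U 1) ∧
        ∀ p, T p = squeezeMap ψ ψ' (phase b) (Real.cosh ‖b‖) (Real.sinh ‖b‖) p) ∧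
      -- the same transformation, on field operators
      (∀ v ∈ finiteParticle (GroupFields n μ),
        (U 1 : DFock (GroupFields n μ) →L[ℂ] DFock (GroupFields n μ))
            (annihilation dweyl (ψ, 0) v) =
          (Real.cosh ‖b‖ : ℂ) • annihilation dweyl (ψ, 0)
              ((U 1 : DFock (GroupFields n μ) →L[ℂ] DFock (GroupFields n μ)) v) -
            (phase b * Real.sinh ‖b‖) • creation dweyl (0, ψ')
              ((U 1 : DFock (GroupFields n μ) →L[ℂ] DFock (GroupFields n μ)) v)) ∧
      -- for every nonzero eigenvalue `u` of the generator `U_*` along `X`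
      (b ≠ 0 → ∀ (X : Fin n → GroupLieAlgebra 𝓘(ℝ, E) G) (γ : Fin n → ℝ → G),
        (∀ i, IsExpCurve (X i) (γ i)) → ∀ u : ℂ, u ≠ 0 →
        (∃ v, IsGeneratorEigenvector (translationFlow μ γ) u v) →
        ∃ ε β Z : ℝ,
          Complex.I * u = ε ∧ 0 < β * ε ∧
          -- `β` is the unique parameter given by the Bogoliubov coefficients
          Real.cosh ‖b‖ = (1 - Real.exp (-(β * ε))) ^ (-(1 / 2) : ℝ) ∧
          Real.sinh ‖b‖ = Real.exp (-(β * ε) / 2) * (1 - Real.exp (-(β * ε))) ^ (-(1 / 2) : ℝ) ∧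
          (∀ β' : ℝ, 0 < β' * ε →
            Real.cosh ‖b‖ = (1 - Real.exp (-(β' * ε))) ^ (-(1 / 2) : ℝ) → β' = β) ∧
          HasSum (fun k : ℕ => Complex.exp (-(Complex.I * k * β * u))) (Z : ℂ) ∧
          (Z : ℂ) = (1 - Complex.exp (-(Complex.I * β * u)))⁻¹ ∧
          -- the squeezed vacuum is a thermofield double state, the phase of `b` being carried by
          -- the tilde mode, or removed by a further Bogoliubov transformation
          IsTFDState ψ (phase b • ψ') Z β u (squeezedVacuum U) ∧
          (∃ (R : (GroupFields n μ × GroupFields n μ) ≃L[ℝ] (GroupFields n μ × GroupFields n μ))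
            (V : unitary (DFock (GroupFields n μ) →L[ℂ] DFock (GroupFields n μ))),
            IsImplementedBogoliubov R V ∧
            IsTFDState ψ ψ' Z β u
              ((V : DFock (GroupFields n μ) →L[ℂ] DFock (GroupFields n μ))
                (squeezedVacuum U))) ∧
          -- its reduced state is the Gibbs state of the mode `ψ`
          (∀ a : Fock (GroupFields n μ) →L[ℂ] Fock (GroupFields n μ),
            HasSum (fun k : ℕ => (Z : ℂ)⁻¹ * Complex.exp (-(Complex.I * k * β * u)) *
              ⟪numberState ψ k, a (numberState ψ k)⟫_ℂ) (reducedState (squeezedVacuum U) a)) ∧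
          (∀ z : ℂ, reducedState (squeezedVacuum U) (weyl (z • ψ)) =
            Complex.exp
              (-((Real.cosh (β * ε / 2) / Real.sinh (β * ε / 2) * ‖z‖ ^ 2 / 4 : ℝ) : ℂ))) ∧
          -- if the quanta `ψ` carry the eigenvalue `u`, it is a KMS state of the translation flow
          (IsGeneratorEigenvector (translationFlow μ γ) u (numberState ψ 1) →
            (∀ k : ℕ, IsGeneratorEigenvector (translationFlow μ γ) (k * u) (numberState ψ k)) ∧
            IsKMSState (modeAlgebra ψ) (reducedState (squeezedVacuum U)) (gibbsFlow μ γ) β)) := by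
  have hH := existsUnique_isSqueezingGroup hψ hψ' b
  refine ⟨hH, fun U hU => ⟨⟨squeezeEquiv hψ hψ' b, isImplementedBogoliubov_squeezeEquiv hψ hψ' hU,
    squeezeEquiv_apply hψ hψ' b⟩, fun v hv => ?_, fun hb X γ hγ u hu hv => ?_⟩⟩
  · have h1 := isFockSystem_dweyl.pairGroup_annihilation (isModePair hψ hψ') hU.isPairGroup ⟨v, hv⟩ 1
    rwa [mul_one] at h1
  · exact thermofieldDouble hψ hψ' hb hU
      (isIsometryFlow_leftTranslation μ fun i => (hγ i).map_add) hu hv
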